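/- **Proposition.** Let $\Omega=\mathbb R\times(0,1)$ and $\Omega_r=(-r,r)\times(0,1)$ for $r>0$. Let $k>0$ with $k\ne n\pi$ for all $n\in\mathbb N=\{0,1,2,\dots\}$. Put $\varphi_0=1$ and $\varphi_n(y)=\sqrt2\cos(n\pi y)$ for $n\ge1$, and let $k_n$ be the complex number with $k_n^2=k^2-n^2\pi^2$, $\operatorname{Re}k_n\ge0$, $\operatorname{Im}k_n\ge0$. For a function $f$ on $\Omega$ write $f_n(x)=\int_0^1 f(x,y)\varphi_n(y)\,\mathrm dy$. Let $L^2_{\mathrm{loc}}(\Omega)$, respectively $H^2_{\mathrm{loc}}(\Omega)$, be the space of complex functions on $\Omega$ that belong to $L^2(\Omega_r)$, respectively $H^2(\Omega_r)$, for every $r>0$; functions equal almost everywhere are identified. A function $u\in H^2_{\mathrm{loc}}(\Omega)$ is called outgoing if for every $n\in\mathbb N$ its coefficient $u_n$ (taken as its $C^1$ representative) satisfies $$\Big|u_n'(x)\,\frac{x}{|x|}-ik_n\,u_n(x)\Big|\longrightarrow 0\qquad\text{as }|x|\to+\infty .$$ Then for every $s\in L^1(\Omega)\cap L^2_{\mathrm{loc}}(\Omega)$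 the problem $$\Delta u+k^2u=-s\ \text{ in }\Omega,\qquad \partial_\nu u=0\ \text{ on }\partial\Omega\ \text{(in the sense of traces)},\qquad u\ \text{outgoing},$$ has exactly one solution $u\in H^2_{\mathrm{loc}}(\Omega)$. Moreover, for all $n$ and $x$ the integral in $$u_{k,n}(x)=\frac{i}{2k_n}\int_{\mathbb R}s_n(z)\,e^{ik_n|x-z|}\,\mathrm dz$$ converges absolutely, for every $n$ one has $\int_0^1u(x,y)\varphi_n(y)\,\mathrm dy=u_{k,n}(x)$ for almost every $x\in\mathbb R$, and $$u(x,y)=\sum_{n\in\mathbb N}u_{k,n}(x)\,\varphi_n(y),$$ where the series converges unconditionally for almost every $(x,y)\in\Omega$, and also in $L^2(\Omega_r)$ for every $r>0$. -/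

import Mathlib

open MeasureTheory Filter Topology
open scoped ContDiff

noncomputable section

namespace Waveguide

/-- The infinite strip `Ω = ℝ × (0,1)`. -/
def strip : Set (ℝ × ℝ) := Set.univ ×ˢ Set.Ioo (0 : ℝ) 1

/-- The truncated strip `Ω_r = (-r,r) × (0,1)`. -/
def truncStrip (r : ℝ) : Set (ℝ × ℝ) := Set.Ioo (-r) r ×ˢ Set.Ioo (0 : ℝ) 1

/-- Neumann eigenfunctions of the interval `(0,1)`: `φ_0 = 1`, `φ_n(y) = √2 cos(nπy)`. -/
def mode (n : ℕ) (y : ℝ) : ℝ :=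
  if n = 0 then 1 else Real.sqrt 2 * Real.cos (n * Real.pi * y)

/-- The `n`-th wavenumber `k_n`, i.e. the square root of `k² - n²π²` with nonnegative real and
imaginary parts (see `waveNumber_eq_iff`). One of the two real square roots below is zero, because
`Real.sqrt` vanishes on negative numbers. -/
def waveNumber (k : ℝ) (n : ℕ) : ℂ :=
  (Real.sqrt (k ^ 2 - n ^ 2 * Real.pi ^ 2) : ℂ) +
    Complex.I * (Real.sqrt (n ^ 2 * Real.pi ^ 2 - k ^ 2) : ℂ)

theorem waveNumber_eq_iff (k : ℝ) (n : ℕ) (κ : ℂ) :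
    κ = waveNumber k n ↔
      κ ^ 2 = (k : ℂ) ^ 2 - (n : ℂ) ^ 2 * (Real.pi : ℂ) ^ 2 ∧ 0 ≤ κ.re ∧ 0 ≤ κ.im := by
  have key : waveNumber k n ^ 2 = (k : ℂ) ^ 2 - (n : ℂ) ^ 2 * (Real.pi : ℂ) ^ 2 ∧
      0 ≤ (waveNumber k n).re ∧ 0 ≤ (waveNumber k n).im := by
    refine ⟨?_, ?_, ?_⟩
    · rcases le_total 0 (k ^ 2 - n ^ 2 * Real.pi ^ 2) with h | h
      · have h' : (n : ℝ) ^ 2 * Real.pi ^ 2 - k ^ 2 ≤ 0 := by linarith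
        rw [waveNumber, Real.sqrt_eq_zero_of_nonpos h', Complex.ofReal_zero, mul_zero, add_zero,
          ← Complex.ofReal_pow, Real.sq_sqrt h]
        push_cast
        ring
      · have h' : 0 ≤ (n : ℝ) ^ 2 * Real.pi ^ 2 - k ^ 2 := by linarith
        rw [waveNumber, Real.sqrt_eq_zero_of_nonpos h, Complex.ofReal_zero, zero_add, mul_pow,
          ← Complex.ofReal_pow, Real.sq_sqrt h', Complex.I_sq]
        push_cast
        ring
    · simp [waveNumber, Real.sqrt_nonneg]
    · simp [waveNumber, Real.sqrt_nonneg]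
  constructor
  · rintro rfl
    exact key
  · rintro ⟨h1, h2, h3⟩
    obtain ⟨g1, g2, g3⟩ := key
    rcases sq_eq_sq_iff_eq_or_eq_neg.mp (h1.trans g1.symm) with h | h
    · exact h
    · have hr : κ.re = -(waveNumber k n).re := by rw [h, Complex.neg_re]
      have hi : κ.im = -(waveNumber k n).im := by rw [h, Complex.neg_im]
      apply Complex.ext <;> linarith

/-- The modal coefficient `x ↦ ⟨f(x,·), φ_n⟩` in `L²(0,1)` (the function `φ_n` is real). -/
def modalCoeff (f : ℝ × ℝ → ℂ) (n : ℕ) (x : ℝ) : ℂ :=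
  ∫ y in Set.Ioo (0 : ℝ) 1, (mode n y : ℂ) * f (x, y)

/-- `L²_loc(Ω)`: square integrable on every truncated strip `Ω_r`. -/
def MemL2Loc (f : ℝ × ℝ → ℂ) : Prop :=
  ∀ r : ℝ, 0 < r → MemLp f 2 (volume.restrict (truncStrip r))

/-- `v ∈ L²_loc(Ω)` is the weak derivative of `u ∈ L²_loc(Ω)` in `Ω`, in the direction `e`. -/
def HasWeakDeriv (e : ℝ × ℝ) (u v : ℝ × ℝ → ℂ) : Prop :=
  MemL2Loc u ∧ MemL2Loc v ∧
    ∀ ψ : ℝ × ℝ → ℝ, ContDiff ℝ ∞ ψ → HasCompactSupport ψ → tsupport ψ ⊆ strip →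
      ∫ p in strip, ((fderiv ℝ ψ p e : ℝ) : ℂ) * u p = -∫ p in strip, (ψ p : ℂ) * v p

/-- `u ∈ H¹_loc(Ω)`. -/
def MemH1Loc (u : ℝ × ℝ → ℂ) : Prop :=
  ∃ ux uy : ℝ × ℝ → ℂ, HasWeakDeriv (1, 0) u ux ∧ HasWeakDeriv (0, 1) u uy

/-- `u ∈ H²_loc(Ω)`: `u` and its weak derivatives of order at most two are in `L²_loc(Ω)`. -/
def MemH2Loc (u : ℝ × ℝ → ℂ) : Prop :=
  ∃ ux uy : ℝ × ℝ → ℂ, HasWeakDeriv (1, 0) u ux ∧ HasWeakDeriv (0, 1) u uy ∧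
    MemH1Loc ux ∧ MemH1Loc uy

/-- `Δu + k²u = -s` almost everywhere in `Ω`, the derivatives being weak derivatives. -/
def SolvesHelmholtz (k : ℝ) (s u : ℝ × ℝ → ℂ) : Prop :=
  ∃ ux uy uxx uyy : ℝ × ℝ → ℂ,
    HasWeakDeriv (1, 0) u ux ∧ HasWeakDeriv (0, 1) u uy ∧
    HasWeakDeriv (1, 0) ux uxx ∧ HasWeakDeriv (0, 1) uy uyy ∧
    ∀ᵐ p ∂(volume.restrict strip), uxx p + uyy p + (k : ℂ) ^ 2 * u p = -s p

/-- `g₀` and `g₁` are the traces of `w` on the boundary lines `y = 0` and `y = 1` of `Ω`.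
Traces are defined by integration by parts in `y` against smooth compactly supported
functions on the plane, which need not vanish on the boundary of `Ω`. -/
def HasTraces (w : ℝ × ℝ → ℂ) (g₀ g₁ : ℝ → ℂ) : Prop :=
  LocallyIntegrable g₀ ∧ LocallyIntegrable g₁ ∧
  ∃ wy : ℝ × ℝ → ℂ, HasWeakDeriv (0, 1) w wy ∧
    ∀ ψ : ℝ × ℝ → ℝ, ContDiff ℝ ∞ ψ → HasCompactSupport ψ →
      (∫ p in strip, ((fderiv ℝ ψ p (0, 1) : ℝ) : ℂ) * w p) + ∫ p in strip, (ψ p : ℂ) * wy p =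
        (∫ x, (ψ (x, 1) : ℂ) * g₁ x) - ∫ x, (ψ (x, 0) : ℂ) * g₀ x

/-- The Neumann condition `∂_ν u = 0` on `∂Ω` in the sense of traces. The outward normal is
`(0,1)` at `y = 1` and `(0,-1)` at `y = 0`, so the trace of `∂u/∂y` vanishes on both lines. -/
def NeumannZero (u : ℝ × ℝ → ℂ) : Prop :=
  ∃ uy : ℝ × ℝ → ℂ, HasWeakDeriv (0, 1) u uy ∧ HasTraces uy 0 0

/-- The modal radiation condition: for every `n`, `c(x) = ⟨u(x,·), φ_n⟩` satisfies
`|c'(x) x/|x| - i k_n c(x)| → 0` as `|x| → ∞`. The coefficient is only defined for almost every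
`x`, and `c` is its (unique) continuously differentiable representative. -/
def Outgoing (k : ℝ) (u : ℝ × ℝ → ℂ) : Prop :=
  ∀ n : ℕ, ∃ c : ℝ → ℂ, ContDiff ℝ 1 c ∧ (∀ᵐ x : ℝ, modalCoeff u n x = c x) ∧
    Tendsto (fun x : ℝ => ‖deriv c x * ((x / |x| : ℝ) : ℂ) - Complex.I * waveNumber k n * c x‖)
      (comap (fun x : ℝ => |x|) atTop) (𝓝 0)

/-- `u ∈ H²_loc(Ω)` is an outgoing solution of the Neumann problem for `Δu + k²u = -s`. -/
structure IsSolution (k : ℝ) (s u : ℝ × ℝ → ℂ) : Prop where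
  memH2Loc : MemH2Loc u
  helmholtz : SolvesHelmholtz k s u
  neumann : NeumannZero u
  outgoing : Outgoing k u

/-- `u_{k,n}(x) = (i / 2k_n) ∫_ℝ s_n(z) exp(i k_n |x - z|) dz`. -/
def modalSolution (k : ℝ) (s : ℝ × ℝ → ℂ) (n : ℕ) (x : ℝ) : ℂ :=
  Complex.I / (2 * waveNumber k n) *
    ∫ z : ℝ, modalCoeff s n z * Complex.exp (Complex.I * waveNumber k n * (|x - z| : ℝ))

end Waveguide

end

/-!
Testing the equation against `χ(x) φ_n(y)`, with `χ` a test function on the line, and using the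
vanishing trace of `∂u/∂y`, shows that the coefficients of a solution satisfy
`u_n'' + k_n² u_n = -s_n`; smooth cutoffs near the boundary of the strip make such tests admissible.
Among the solutions of this ordinary differential equation only `u_{k,n}` is outgoing: if
`h'' = -k_n² h`, then `h' - i k_n h` and `-h' - i k_n h` are multiples of `exp (-i k_n x)` and
`exp (i k_n x)`, which do not decay at `+∞`, respectively `-∞`. Since the `φ_n` are complete in
`L²(0,1)`, uniqueness follows.

For existence, all but finitely many modes are evanescent, `k_n = iα` with `α ≥ n`, and `|u_{k,n}|`
is the convolution of `|s_n|` with `e^{-α|x|} / (2α)` at most. For `|x| < r` the part of `s_n` on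
`|z| < r + 1` contributes at most `α⁻²` times its `L²` norm, and the remaining part is
exponentially small because `s` is integrable. The `L²` norms are square summable by Bessel's
inequality, so the modal series of all derivatives of order at most two converge in `L²_loc`, and
weak derivatives and traces, which are computed term by term, pass to the limit.
-/

namespace Waveguide

open Set

section Integration

variable {α E : Type*} [MeasurableSpace α] {μ : Measure α} [NormedAddCommGroup E] {p : ENNReal}

theorem ae_eq_of_tendsto_eLpNorm_of_tendsto_ae (hp : p ≠ 0) {f : ℕ → α → E} {g h : α → E}
    (hf : ∀ n, AEStronglyMeasurable (f n) μ) (hg : AEStronglyMeasurable g μ)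
    (hfg : Tendsto (fun n => eLpNorm (f n - g) p μ) atTop (𝓝 0))
    (hfh : ∀ᵐ a ∂μ, Tendsto (fun n => f n a) atTop (𝓝 (h a))) : g =ᵐ[μ] h := by
  obtain ⟨ns, hns, hlim⟩ :=
    (tendstoInMeasure_of_tendsto_eLpNorm hp hf hg hfg).exists_seq_tendsto_ae
  filter_upwards [hlim, hfh] with a hga hha
  exact tendsto_nhds_unique hga (hha.comp hns.tendsto_atTop)

theorem ae_eq_of_tendsto_eLpNorm (hp : p ≠ 0) {f : ℕ → α → E} {g h : α → E}
    (hf : ∀ n, AEStronglyMeasurable (f n) μ) (hg : AEStronglyMeasurable g μ)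
    (hh : AEStronglyMeasurable h μ)
    (hfg : Tendsto (fun n => eLpNorm (f n - g) p μ) atTop (𝓝 0))
    (hfh : Tendsto (fun n => eLpNorm (f n - h) p μ) atTop (𝓝 0)) : g =ᵐ[μ] h :=
  tendstoInMeasure_ae_unique (tendstoInMeasure_of_tendsto_eLpNorm hp hf hg hfg)
    (tendstoInMeasure_of_tendsto_eLpNorm hp hf hh hfh)

theorem tendsto_eLpNorm_mono_measure {ν : Measure α} (hνμ : ν ≤ μ) {f : ℕ → α → E}
    (h : Tendsto (fun n => eLpNorm (f n) p μ) atTop (𝓝 0)) :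
    Tendsto (fun n => eLpNorm (f n) p ν) atTop (𝓝 0) :=
  tendsto_of_tendsto_of_tendsto_of_le_of_le tendsto_const_nhds h (fun _ => zero_le)
    fun _ => eLpNorm_mono_measure _ hνμ

theorem exists_forall_tendsto_eLpNorm_restrict (hp : p ≠ 0) {A : ℕ → Set α} (hA : Monotone A)
    (hAm : ∀ m, MeasurableSet (A m)) {f : ℕ → α → E}
    (hf : ∀ n m, AEStronglyMeasurable (f n) (μ.restrict (A m)))
    (h : ∀ m, ∃ g, MemLp g p (μ.restrict (A m)) ∧
      Tendsto (fun n => eLpNorm (f n - g) p (μ.restrict (A m))) atTop (𝓝 0)) :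
    ∃ g, ∀ m, MemLp g p (μ.restrict (A m)) ∧
      Tendsto (fun n => eLpNorm (f n - g) p (μ.restrict (A m))) atTop (𝓝 0) := by
  choose g hg hlim using h
  have hmono : ∀ {j m}, j ≤ m → μ.restrict (A j) ≤ μ.restrict (A m) := fun hjm =>
    Measure.restrict_mono (hA hjm) le_rfl
  have compatible : ∀ m j, j ≤ m → ∀ᵐ a ∂(μ.restrict (A j)), g j a = g m a := fun m j hjm =>
    ae_eq_of_tendsto_eLpNorm hp (fun n => hf n j) (hg j).aestronglyMeasurable
      ((hg m).mono_measure (hmono hjm)).aestronglyMeasurable (hlim j)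
      (tendsto_eLpNorm_mono_measure (hmono hjm) (hlim m))
  -- On the first of the sets `A m` that contains `a`, use the limit found there.
  let glued : α → E := fun a => g (sInf {m | a ∈ A m}) a
  have glued_eq : ∀ m, g m =ᵐ[μ.restrict (A m)] glued := by
    intro m
    have hall : ∀ᵐ a ∂μ, ∀ j, j ≤ m → a ∈ A j → g j a = g m a := ae_all_iff.2 fun j => by
      by_cases hj : j ≤ m
      · filter_upwards [(ae_restrict_iff' (hAm j)).1 (compatible m j hj)] with a ha _ using ha
      · exact Eventually.of_forall fun _ h => absurd h hj
    refine (ae_restrict_iff' (hAm m)).2 (hall.mono fun a ha ham => ?_)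
    exact (ha _ (Nat.sInf_le ham) (Nat.sInf_mem (s := {m | a ∈ A m}) ⟨m, ham⟩)).symm
  exact ⟨glued, fun m => ⟨(hg m).ae_eq (glued_eq m), (hlim m).congr fun n =>
    eLpNorm_congr_ae (EventuallyEq.rfl.sub (glued_eq m))⟩⟩

theorem ae_summable_of_summable_integral {f : ℕ → α → ℝ} (hf : ∀ n, Integrable (f n) μ)
    (hf0 : ∀ n a, 0 ≤ f n a) (h : Summable fun n => ∫ a, f n a ∂μ) :
    ∀ᵐ a ∂μ, Summable fun n => f n a := by
  have hm : ∀ n, AEMeasurable (fun a => ENNReal.ofReal (f n a)) μ :=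
    fun n => (hf n).aestronglyMeasurable.aemeasurable.ennreal_ofReal
  have hfin : ∫⁻ a, ∑' n, ENNReal.ofReal (f n a) ∂μ ≠ ⊤ := by
    simp_rw [lintegral_tsum hm, ← ofReal_integral_eq_lintegral_ofReal (hf _)
      (Eventually.of_forall (hf0 _))]
    exact h.tsum_ofReal_ne_top
  filter_upwards [ae_lt_top' (AEMeasurable.tsum hm) hfin] with a ha
  exact (ENNReal.summable_toReal ha.ne).congr fun n => ENNReal.toReal_ofReal (hf0 n a)

theorem sq_integral_mul_le_of_integral_le {f w : α → ℝ} {A : ℝ} (hA : 0 < A)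
    (hw : ∀ a, 0 ≤ w a) (hwi : Integrable w μ) (hwA : ∫ a, w a ∂μ ≤ A)
    (hfw : Integrable (fun a => f a * w a) μ) (hffw : Integrable (fun a => f a ^ 2 * w a) μ) :
    (∫ a, f a * w a ∂μ) ^ 2 ≤ A * ∫ a, f a ^ 2 * w a ∂μ := by
  set B := ∫ a, f a * w a ∂μ
  have hnonneg : 0 ≤ ∫ a, (f a - B / A) ^ 2 * w a ∂μ :=
    integral_nonneg fun a => mul_nonneg (sq_nonneg _) (hw a)
  have hexpand : ∫ a, (f a - B / A) ^ 2 * w a ∂μ =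
      (∫ a, f a ^ 2 * w a ∂μ) - 2 * (B / A) * B + (B / A) ^ 2 * ∫ a, w a ∂μ := by
    have hpt : ∀ a, (f a - B / A) ^ 2 * w a =
        f a ^ 2 * w a - 2 * (B / A) * (f a * w a) + (B / A) ^ 2 * w a := fun a => by ring
    have hsub : Integrable (fun a => f a ^ 2 * w a - 2 * (B / A) * (f a * w a)) μ :=
      hffw.sub (hfw.const_mul _)
    simp_rw [hpt]
    rw [integral_add hsub (hwi.const_mul _),
      integral_sub hffw (hfw.const_mul _), integral_const_mul, integral_const_mul]
  have hmass : (B / A) ^ 2 * ∫ a, w a ∂μ ≤ (B / A) ^ 2 * A := by gcongr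
  have hcomplete : 2 * (B / A) * B - (B / A) ^ 2 * A = B ^ 2 / A := by field_simp; ring
  rw [← div_le_iff₀' hA]
  linarith

end Integration

section HilbertSpace

variable {α : Type*} [MeasurableSpace α] {μ : Measure α}

theorem inner_toLp_toLp {f g : α → ℂ} (hf : MemLp f 2 μ) (hg : MemLp g 2 μ) :
    inner ℂ (hf.toLp f) (hg.toLp g) = ∫ a, g a * (starRingEnd ℂ) (f a) ∂μ := by
  rw [L2.inner_def]
  refine integral_congr_ae ?_
  filter_upwards [hf.coeFn_toLp, hg.coeFn_toLp] with a hfa hga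
  rw [hfa, hga]
  rfl

theorem norm_sq_toLp {f : α → ℂ} (hf : MemLp f 2 μ) :
    ‖hf.toLp f‖ ^ 2 = ∫ a, ‖f a‖ ^ 2 ∂μ := by
  have h := inner_self_eq_norm_sq (𝕜 := ℂ) (hf.toLp f)
  simp_rw [inner_toLp_toLp, Complex.mul_conj', ← Complex.ofReal_pow] at h
  rw [integral_complex_ofReal] at h
  exact h.symm

theorem integrable_norm_sq {f : α → ℂ} (hf : MemLp f 2 μ) : Integrable (fun a => ‖f a‖ ^ 2) μ :=
  (memLp_two_iff_integrable_sq_norm hf.aestronglyMeasurable).1 hf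

theorem summable_of_pairwise_inner_eq_zero {ι 𝕜 E : Type*} [RCLike 𝕜] [NormedAddCommGroup E]
    [InnerProductSpace 𝕜 E] [CompleteSpace E] {v : ι → E}
    (hv : Pairwise fun i j => inner 𝕜 (v i) (v j) = 0) (hs : Summable fun i => ‖v i‖ ^ 2) :
    Summable v := by
  have hV : OrthogonalFamily 𝕜 (fun i => Submodule.span 𝕜 {v i})
      fun i => (Submodule.span 𝕜 {v i}).subtypeₗᵢ := by
    refine OrthogonalFamily.of_pairwise fun i j hij => ?_
    change Submodule.span 𝕜 {v i} ⟂ Submodule.span 𝕜 {v j}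
    rw [Submodule.isOrtho_span]
    rintro _ rfl _ rfl
    exact hv hij
  exact (hV.summable_iff_norm_sq_summable
    fun i => ⟨v i, Submodule.mem_span_singleton_self (v i)⟩).2 hs

theorem exists_tendsto_eLpNorm_sum_range {F : ℕ → α → ℂ} (hF : ∀ n, MemLp (F n) 2 μ)
    (horth : Pairwise fun m n => ∫ a, F n a * (starRingEnd ℂ) (F m a) ∂μ = 0)
    (hs : Summable fun n => ∫ a, ‖F n a‖ ^ 2 ∂μ) :
    ∃ w, MemLp w 2 μ ∧
      Tendsto (fun N => eLpNorm ((fun a => ∑ n ∈ Finset.range N, F n a) - w) 2 μ) atTop (𝓝 0) := by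
  have hsum : Summable fun n => (hF n).toLp (F n) := by
    refine summable_of_pairwise_inner_eq_zero (𝕜 := ℂ)
      (fun m n hmn => (inner_toLp_toLp _ _).trans (horth hmn)) ?_
    simpa only [norm_sq_toLp] using hs
  obtain ⟨w, hw⟩ := hsum
  refine ⟨w, Lp.memLp w, ?_⟩
  have hpartial : ∀ N, (⇑(∑ n ∈ Finset.range N, (hF n).toLp (F n)) : α → ℂ) =ᵐ[μ]
      fun a => ∑ n ∈ Finset.range N, F n a := fun N => by
    filter_upwards [Lp.coeFn_finsetSum (Finset.range N) fun n => (hF n).toLp (F n),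
      ae_all_iff.2 fun n => (hF n).coeFn_toLp] with a hsum_a hF_a
    simp only [hsum_a, Finset.sum_apply, hF_a]
  refine ((Lp.tendsto_Lp_iff_tendsto_eLpNorm' _ _).1 hw.tendsto_sum_nat).congr fun N => ?_
  exact eLpNorm_congr_ae ((hpartial N).sub EventuallyEq.rfl)

end HilbertSpace

section Geometry

theorem restrict_strip : (volume : Measure (ℝ × ℝ)).restrict strip =
    (volume : Measure ℝ).prod (volume.restrict (Ioo (0 : ℝ) 1)) := by
  rw [strip, Measure.volume_eq_prod, ← Measure.prod_restrict, Measure.restrict_univ]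

theorem restrict_truncStrip (r : ℝ) : (volume : Measure (ℝ × ℝ)).restrict (truncStrip r) =
    ((volume : Measure ℝ).restrict (Ioo (-r) r)).prod (volume.restrict (Ioo (0 : ℝ) 1)) := by
  rw [truncStrip, Measure.volume_eq_prod, ← Measure.prod_restrict]

instance isFiniteMeasure_restrict_truncStrip (r : ℝ) :
    IsFiniteMeasure ((volume : Measure (ℝ × ℝ)).restrict (truncStrip r)) := by
  rw [restrict_truncStrip]
  infer_instance

theorem isOpen_strip : IsOpen strip := isOpen_univ.prod isOpen_Ioo

theorem isOpen_truncStrip (r : ℝ) : IsOpen (truncStrip r) := isOpen_Ioo.prod isOpen_Ioo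

theorem mem_truncStrip_iff {r : ℝ} {p : ℝ × ℝ} :
    p ∈ truncStrip r ↔ |p.1| < r ∧ p ∈ strip := by
  simp [truncStrip, strip, abs_lt]

theorem truncStrip_subset_strip (r : ℝ) : truncStrip r ⊆ strip :=
  prod_mono (subset_univ _) subset_rfl

theorem truncStrip_mono : Monotone truncStrip := fun _ _ h =>
  prod_mono (Ioo_subset_Ioo (neg_le_neg h) h) subset_rfl

theorem iUnion_truncStrip : ⋃ m : ℕ, truncStrip (m + 1 : ℝ) = strip := by
  refine (iUnion_subset fun m => truncStrip_subset_strip _).antisymm fun p hp => ?_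
  obtain ⟨m, hm⟩ := exists_nat_gt |p.1|
  exact mem_iUnion.2 ⟨m, mem_truncStrip_iff.2 ⟨by linarith, hp⟩⟩

theorem ae_strip_iff {P : ℝ × ℝ → Prop} :
    (∀ᵐ p ∂(volume.restrict strip), P p) ↔
      ∀ r : ℝ, 0 < r → ∀ᵐ p ∂(volume.restrict (truncStrip r)), P p := by
  refine ⟨fun h r _ => ae_restrict_of_ae_restrict_of_subset (truncStrip_subset_strip r) h,
    fun h => ?_⟩
  rw [← iUnion_truncStrip, ae_restrict_iUnion_iff]
  exact fun m => h _ (by positivity)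

theorem ae_real_iff {P : ℝ → Prop} :
    (∀ᵐ x : ℝ, P x) ↔ ∀ r : ℝ, 0 < r → ∀ᵐ x ∂(volume.restrict (Ioo (-r) r)), P x := by
  refine ⟨fun h r _ => ae_restrict_of_ae h, fun h => ?_⟩
  have hcover : ⋃ m : ℕ, Ioo (-(m + 1 : ℝ)) (m + 1 : ℝ) = univ := by
    refine eq_univ_of_forall fun x => ?_
    obtain ⟨m, hm⟩ := exists_nat_gt |x|
    exact mem_iUnion.2 ⟨m, abs_lt.1 (by linarith)⟩
  rw [← Measure.restrict_univ (μ := (volume : Measure ℝ)), ← hcover, ae_restrict_iUnion_iff]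
  exact fun m => h _ (by positivity)

theorem ae_strip_of_ae_fst {P : ℝ → Prop} (h : ∀ᵐ x : ℝ, P x) :
    ∀ᵐ p ∂((volume : Measure (ℝ × ℝ)).restrict strip), P p.1 := by
  rw [restrict_strip]
  exact Measure.quasiMeasurePreserving_fst.ae h

end Geometry

section LocalSquareIntegrability

variable {f g : ℝ × ℝ → ℂ}

theorem MemL2Loc.aestronglyMeasurable (hf : MemL2Loc f) :
    AEStronglyMeasurable f (volume.restrict strip) := by
  rw [← iUnion_truncStrip]
  exact AEStronglyMeasurable.iUnion fun m => (hf _ (by positivity)).aestronglyMeasurable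

theorem MemL2Loc.integrableOn (hf : MemL2Loc f) {r : ℝ} (hr : 0 < r) :
    IntegrableOn f (truncStrip r) :=
  (hf r hr).integrable one_le_two

theorem MemL2Loc.locallyIntegrableOn (hf : MemL2Loc f) : LocallyIntegrableOn f strip :=
  fun p hp => ⟨truncStrip (|p.1| + 1), mem_nhdsWithin_of_mem_nhds <|
    (isOpen_truncStrip _).mem_nhds (mem_truncStrip_iff.2 ⟨lt_add_one _, hp⟩),
    hf.integrableOn (by positivity)⟩

theorem MemL2Loc.add (hf : MemL2Loc f) (hg : MemL2Loc g) : MemL2Loc (fun p => f p + g p) :=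
  fun r hr => (hf r hr).add (hg r hr)

theorem MemL2Loc.sub (hf : MemL2Loc f) (hg : MemL2Loc g) : MemL2Loc (fun p => f p - g p) :=
  fun r hr => (hf r hr).sub (hg r hr)

theorem MemL2Loc.const_mul (hf : MemL2Loc f) (c : ℂ) : MemL2Loc (fun p => c * f p) :=
  fun r hr => (hf r hr).const_mul c

theorem MemL2Loc.sum {ι : Type*} (t : Finset ι) {f : ι → ℝ × ℝ → ℂ}
    (hf : ∀ i ∈ t, MemL2Loc (f i)) : MemL2Loc (fun p => ∑ i ∈ t, f i p) :=
  fun r hr => memLp_finsetSum t fun i hi => hf i hi r hr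

theorem MemL2Loc.congr (hf : MemL2Loc f) (h : ∀ᵐ p ∂(volume.restrict strip), f p = g p) :
    MemL2Loc g :=
  fun r hr => (hf r hr).ae_eq (ae_strip_iff.1 h r hr)

theorem memL2Loc_mul {c : ℝ → ℂ} {b : ℝ → ℝ}
    (hc : ∀ r : ℝ, 0 < r → MemLp c 2 (volume.restrict (Ioo (-r) r)))
    (hb : Continuous b) {C : ℝ} (hC : ∀ y, |b y| ≤ C) :
    MemL2Loc (fun p => c p.1 * (b p.2 : ℂ)) := by
  intro r hr
  rw [restrict_truncStrip]
  have hfst := (hc r hr).comp_fst (volume.restrict (Ioo (0 : ℝ) 1))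
  refine hfst.of_le_mul (c := C) (hfst.aestronglyMeasurable.mul (by fun_prop))
    (Eventually.of_forall fun p => ?_)
  rw [norm_mul, mul_comm, Complex.norm_real]
  exact mul_le_mul_of_nonneg_right (hC _) (norm_nonneg _)

end LocalSquareIntegrability

section LocalWeights

/-- Bounded measurable weights on the plane that vanish for large `|x|`. They pair with
`L²_loc(Ω)`; they need not vanish near `∂Ω` and need not be continuous. -/
structure LocalWeight (g : ℝ × ℝ → ℂ) : Prop where
  measurable : Measurable g
  bounded : ∃ C : ℝ, ∀ p, ‖g p‖ ≤ C
  eq_zero : ∃ R : ℝ, 0 < R ∧ ∀ p : ℝ × ℝ, R ≤ |p.1| → g p = 0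

variable {g : ℝ × ℝ → ℂ}

theorem localWeight_of_hasCompactSupport {ψ : ℝ × ℝ → ℝ} (hc : Continuous ψ)
    (hs : HasCompactSupport ψ) : LocalWeight (fun p => (ψ p : ℂ)) where
  measurable := by fun_prop
  bounded := by
    obtain ⟨C, hC⟩ := hs.exists_bound_of_continuous hc
    exact ⟨C, fun p => by simpa only [Complex.norm_real] using hC p⟩
  eq_zero := by
    obtain ⟨R, hR, hzero⟩ := hs.exists_pos_le_norm
    exact ⟨R, hR, fun p hp => by rw [hzero p (hp.trans (norm_fst_le p)), Complex.ofReal_zero]⟩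

theorem localWeight_fderiv {ψ : ℝ × ℝ → ℝ} (hψ : ContDiff ℝ ∞ ψ) (hs : HasCompactSupport ψ)
    (e : ℝ × ℝ) : LocalWeight (fun p => ((fderiv ℝ ψ p e : ℝ) : ℂ)) :=
  localWeight_of_hasCompactSupport
    ((hψ.continuous_fderiv (by simp)).clm_apply continuous_const) (hs.fderiv_apply (𝕜 := ℝ) e)

theorem LocalWeight.exists_setIntegral_eq (hg : LocalWeight g) :
    ∃ R : ℝ, 0 < R ∧ ∀ f : ℝ × ℝ → ℂ,
      (∀ p ∈ strip \ truncStrip R, g p * f p = 0) ∧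
      ∫ p in strip, g p * f p = ∫ p in truncStrip R, g p * f p := by
  obtain ⟨R, hR, hzero⟩ := hg.eq_zero
  have hout : ∀ f : ℝ × ℝ → ℂ, ∀ p ∈ strip \ truncStrip R, g p * f p = 0 := fun f p hp => by
    have : R ≤ |p.1| := not_lt.1 fun h => hp.2 (mem_truncStrip_iff.2 ⟨h, hp.1⟩)
    rw [hzero p this, zero_mul]
  exact ⟨R, hR, fun f => ⟨hout f, setIntegral_eq_of_subset_of_forall_sdiff_eq_zero
    isOpen_strip.measurableSet (truncStrip_subset_strip R) (hout f)⟩⟩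

theorem LocalWeight.integrableOn_mul (hg : LocalWeight g) {f : ℝ × ℝ → ℂ} (hf : MemL2Loc f) :
    IntegrableOn (fun p => g p * f p) strip := by
  obtain ⟨C, hC⟩ := hg.bounded
  obtain ⟨R, hR, hgR⟩ := hg.exists_setIntegral_eq
  have hint : IntegrableOn (fun p => g p * f p) (truncStrip R) :=
    (hf.integrableOn hR).bdd_mul hg.measurable.aestronglyMeasurable (Eventually.of_forall hC)
  exact hint.of_forall_sdiff_eq_zero isOpen_strip.measurableSet (hgR f).1

end LocalWeights

section LocalConvergence

/-- Convergence `S N → w` in `L²_loc(Ω)`, that is, in `L²(Ω_r)` for every `r > 0`. -/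
structure TendstoL2Loc (S : ℕ → ℝ × ℝ → ℂ) (w : ℝ × ℝ → ℂ) : Prop where
  mem : ∀ N, MemL2Loc (S N)
  mem_lim : MemL2Loc w
  tendsto : ∀ r : ℝ, 0 < r →
    Tendsto (fun N => eLpNorm (S N - w) 2 (volume.restrict (truncStrip r))) atTop (𝓝 0)

variable {S T : ℕ → ℝ × ℝ → ℂ} {v w : ℝ × ℝ → ℂ}

theorem TendstoL2Loc.add (hS : TendstoL2Loc S v) (hT : TendstoL2Loc T w) :
    TendstoL2Loc (fun N p => S N p + T N p) (fun p => v p + w p) := by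
  refine ⟨fun N => (hS.mem N).add (hT.mem N), hS.mem_lim.add hT.mem_lim, fun r hr => ?_⟩
  have hsum := (hS.tendsto r hr).add (hT.tendsto r hr)
  rw [add_zero] at hsum
  refine tendsto_of_tendsto_of_tendsto_of_le_of_le tendsto_const_nhds hsum (fun _ => zero_le)
    fun N => ?_
  have hle := eLpNorm_add_le (p := 2)
    ((hS.mem N r hr).sub (hS.mem_lim r hr)).aestronglyMeasurable
    ((hT.mem N r hr).sub (hT.mem_lim r hr)).aestronglyMeasurable (by norm_num)
  rwa [← add_sub_add_comm] at hle

theorem TendstoL2Loc.const_mul (hS : TendstoL2Loc S v) (c : ℂ) :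
    TendstoL2Loc (fun N p => c * S N p) (fun p => c * v p) := by
  refine ⟨fun N => (hS.mem N).const_mul c, hS.mem_lim.const_mul c, fun r hr => ?_⟩
  have h := ENNReal.Tendsto.const_mul (a := ‖c‖ₑ) (hS.tendsto r hr) (Or.inr (by simp))
  rw [mul_zero] at h
  refine h.congr fun N => ?_
  rw [← eLpNorm_const_smul, smul_sub]
  rfl

theorem TendstoL2Loc.congr_lim (hS : TendstoL2Loc S v)
    (h : ∀ᵐ p ∂(volume.restrict strip), v p = w p) : TendstoL2Loc S w :=
  ⟨hS.mem, hS.mem_lim.congr h, fun r hr => (hS.tendsto r hr).congr fun _ =>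
    eLpNorm_congr_ae (EventuallyEq.rfl.sub (ae_strip_iff.1 h r hr))⟩

theorem TendstoL2Loc.ae_eq_of_tendsto (hS : TendstoL2Loc S w)
    (h : ∀ᵐ p ∂(volume.restrict strip), Tendsto (fun N => S N p) atTop (𝓝 (v p))) :
    ∀ᵐ p ∂(volume.restrict strip), w p = v p :=
  ae_strip_iff.2 fun r hr => ae_eq_of_tendsto_eLpNorm_of_tendsto_ae two_ne_zero
    (fun N => (hS.mem N r hr).aestronglyMeasurable) (hS.mem_lim r hr).aestronglyMeasurable
    (hS.tendsto r hr) (ae_strip_iff.1 h r hr)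

theorem exists_tendstoL2Loc (hS : ∀ N, MemL2Loc (S N))
    (h : ∀ r : ℝ, 0 < r → ∃ w, MemLp w 2 (volume.restrict (truncStrip r)) ∧
      Tendsto (fun N => eLpNorm (S N - w) 2 (volume.restrict (truncStrip r))) atTop (𝓝 0)) :
    ∃ w, TendstoL2Loc S w := by
  have hmono : Monotone fun m : ℕ => truncStrip (m + 1 : ℝ) := fun j m hjm =>
    truncStrip_mono (by gcongr)
  obtain ⟨w, hw⟩ := exists_forall_tendsto_eLpNorm_restrict two_ne_zero hmono
    (fun m => (isOpen_truncStrip _).measurableSet)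
    (fun N m => (hS N _ (by positivity)).aestronglyMeasurable) (fun m => h _ (by positivity))
  have hle : ∀ r : ℝ, ∃ m : ℕ, (volume : Measure (ℝ × ℝ)).restrict (truncStrip r) ≤
      volume.restrict (truncStrip (m + 1 : ℝ)) := fun r => by
    obtain ⟨m, hm⟩ := exists_nat_gt r
    exact ⟨m, Measure.restrict_mono (truncStrip_mono (by linarith)) le_rfl⟩
  refine ⟨w, hS, fun r _ => ?_, fun r _ => ?_⟩ <;> obtain ⟨m, hm⟩ := hle r
  · exact (hw m).1.mono_measure hm
  · exact tendsto_eLpNorm_mono_measure hm (hw m).2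

theorem LocalWeight.tendsto_integral {g : ℝ × ℝ → ℂ} (hg : LocalWeight g)
    (hS : TendstoL2Loc S w) :
    Tendsto (fun N => ∫ p in strip, g p * S N p) atTop (𝓝 (∫ p in strip, g p * w p)) := by
  obtain ⟨R, hR, hgR⟩ := hg.exists_setIntegral_eq
  obtain ⟨C, hC⟩ := hg.bounded
  simp only [(hgR _).2]
  set μ := (volume : Measure (ℝ × ℝ)).restrict (truncStrip R)
  have hint : ∀ f : ℝ × ℝ → ℂ, MemL2Loc f → Integrable (fun p => g p * f p) μ :=
    fun f hf => (hg.integrableOn_mul hf).mono_set (truncStrip_subset_strip R)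
  refine tendsto_integral_of_L1' _ (hint w hS.mem_lim).aestronglyMeasurable
    (Eventually.of_forall fun N => hint _ (hS.mem N)) ?_
  set A : ENNReal := μ univ ^ (1 / (1 : ENNReal).toReal - 1 / (2 : ENNReal).toReal)
  have hA : A ≠ ⊤ := ENNReal.rpow_ne_top_of_nonneg (by norm_num) (measure_ne_top _ _)
  have hbound := ENNReal.Tendsto.const_mul (a := ENNReal.ofReal C)
    (ENNReal.Tendsto.mul_const (hS.tendsto R hR) (Or.inr hA)) (Or.inr ENNReal.ofReal_ne_top)
  rw [zero_mul, mul_zero] at hbound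
  refine tendsto_of_tendsto_of_tendsto_of_le_of_le tendsto_const_nhds hbound (fun _ => zero_le)
    fun N => ?_
  calc eLpNorm ((fun p => g p * S N p) - fun p => g p * w p) 1 μ
      ≤ ENNReal.ofReal C * eLpNorm (S N - w) 1 μ := by
        refine eLpNorm_le_mul_eLpNorm_of_ae_le_mul (Eventually.of_forall fun p => ?_) 1
        rw [Pi.sub_apply, Pi.sub_apply, ← mul_sub, norm_mul]
        exact mul_le_mul_of_nonneg_right (hC p) (norm_nonneg _)
    _ ≤ ENNReal.ofReal C * (eLpNorm (S N - w) 2 μ * A) := by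
        gcongr
        exact eLpNorm_le_eLpNorm_mul_rpow_measure_univ one_le_two
          ((hS.mem N R hR).sub (hS.mem_lim R hR)).aestronglyMeasurable

theorem TendstoL2Loc.integral_add_eq_zero (hS : TendstoL2Loc S v) (hT : TendstoL2Loc T w)
    {f g : ℝ × ℝ → ℂ} (hf : LocalWeight f) (hg : LocalWeight g)
    (h : ∀ N, (∫ p in strip, f p * S N p) + ∫ p in strip, g p * T N p = 0) :
    (∫ p in strip, f p * v p) + ∫ p in strip, g p * w p = 0 := by
  have hlim := (hf.tendsto_integral hS).add (hg.tendsto_integral hT)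
  simp only [h] at hlim
  exact tendsto_nhds_unique hlim tendsto_const_nhds

end LocalConvergence

section WeakDerivatives

variable {e : ℝ × ℝ} {u u' v v' : ℝ × ℝ → ℂ}

theorem HasWeakDeriv.of_tendsto {S T : ℕ → ℝ × ℝ → ℂ} (hS : TendstoL2Loc S u)
    (hT : TendstoL2Loc T v) (h : ∀ N, HasWeakDeriv e (S N) (T N)) : HasWeakDeriv e u v := by
  refine ⟨hS.mem_lim, hT.mem_lim, fun ψ hψ hc hsupp => ?_⟩
  rw [eq_neg_iff_add_eq_zero]
  refine hS.integral_add_eq_zero hT (localWeight_fderiv hψ hc e)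
    (localWeight_of_hasCompactSupport hψ.continuous hc) fun N => ?_
  exact eq_neg_iff_add_eq_zero.1 ((h N).2.2 ψ hψ hc hsupp)

theorem MemL2Loc.ae_eq_of_integral_test_mul (hv : MemL2Loc v) (hv' : MemL2Loc v')
    (h : ∀ ψ : ℝ × ℝ → ℝ, ContDiff ℝ ∞ ψ → HasCompactSupport ψ → tsupport ψ ⊆ strip →
      ∫ p in strip, (ψ p : ℂ) * v p = ∫ p in strip, (ψ p : ℂ) * v' p) :
    ∀ᵐ p ∂(volume.restrict strip), v p = v' p := by
  have hzero := isOpen_strip.ae_eq_zero_of_integral_contDiff_smul_eq_zero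
    (hv.sub hv').locallyIntegrableOn fun ψ hψ hc hsupp => by
      have hw := localWeight_of_hasCompactSupport hψ.continuous hc
      rw [← setIntegral_eq_integral_of_forall_compl_eq_zero (s := strip) fun p hp => by
        rw [image_eq_zero_of_notMem_tsupport fun h => hp (hsupp h), zero_smul]]
      simp_rw [Complex.real_smul, mul_sub]
      rw [integral_sub (hw.integrableOn_mul hv) (hw.integrableOn_mul hv'),
        h ψ hψ hc hsupp, sub_self]
  rw [ae_restrict_iff' isOpen_strip.measurableSet]
  filter_upwards [hzero] with p hp hps
  exact sub_eq_zero.1 (hp hps)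

theorem HasWeakDeriv.ae_eq (h : HasWeakDeriv e u v) (h' : HasWeakDeriv e u' v')
    (hu : ∀ᵐ p ∂(volume.restrict strip), u p = u' p) :
    ∀ᵐ p ∂(volume.restrict strip), v p = v' p := by
  refine h.2.1.ae_eq_of_integral_test_mul h'.2.1 fun ψ hψ hc hsupp => neg_injective ?_
  rw [← h.2.2 ψ hψ hc hsupp, ← h'.2.2 ψ hψ hc hsupp]
  refine integral_congr_ae ?_
  filter_upwards [hu] with p hp
  rw [hp]

end WeakDerivatives

section TransverseModes

/-- The Dirichlet eigenfunctions `√2 sin(nπy)` of `(0,1)`, into which differentiation maps the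
functions `mode n`. -/
noncomputable def sinMode (n : ℕ) (y : ℝ) : ℝ := Real.sqrt 2 * Real.sin (n * Real.pi * y)

theorem mode_eq_ite_mul_cos (n : ℕ) (y : ℝ) :
    mode n y = (if n = 0 then 1 else Real.sqrt 2) * Real.cos (n * Real.pi * y) := by
  unfold mode
  split_ifs with h
  · simp [h]
  · rfl

theorem contDiff_mode (n : ℕ) : ContDiff ℝ ∞ (mode n) := by
  rw [funext (mode_eq_ite_mul_cos n)]
  fun_prop

theorem contDiff_sinMode (n : ℕ) : ContDiff ℝ ∞ (sinMode n) := by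
  unfold sinMode
  fun_prop

@[fun_prop]
theorem continuous_mode (n : ℕ) : Continuous (mode n) := (contDiff_mode n).continuous

@[fun_prop]
theorem continuous_sinMode (n : ℕ) : Continuous (sinMode n) := (contDiff_sinMode n).continuous

theorem hasDerivAt_mode (n : ℕ) (y : ℝ) :
    HasDerivAt (mode n) (-(n * Real.pi) * sinMode n y) y := by
  rw [funext (mode_eq_ite_mul_cos n)]
  refine ((((hasDerivAt_id y).const_mul (n * Real.pi)).cos).const_mul _).congr_deriv ?_
  rcases eq_or_ne n 0 with rfl | hn
  · simp
  · simp only [sinMode, hn, if_false, id_eq]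
    ring

theorem hasDerivAt_sinMode (n : ℕ) (y : ℝ) :
    HasDerivAt (sinMode n) (n * Real.pi * mode n y) y := by
  refine ((((hasDerivAt_id y).const_mul (n * Real.pi)).sin).const_mul _).congr_deriv ?_
  rcases eq_or_ne n 0 with rfl | hn
  · simp
  · simp only [mode, hn, if_false, id_eq]
    ring

theorem sinMode_zero (n : ℕ) : sinMode n 0 = 0 := by simp [sinMode]

theorem sinMode_one (n : ℕ) : sinMode n 1 = 0 := by simp [sinMode, Real.sin_nat_mul_pi]

theorem abs_mode_le (n : ℕ) (y : ℝ) : |mode n y| ≤ Real.sqrt 2 := by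
  have hcoeff : |if n = 0 then 1 else Real.sqrt 2| ≤ Real.sqrt 2 := by
    split_ifs
    · rw [abs_one]
      exact Real.one_le_sqrt.2 one_le_two
    · rw [abs_of_nonneg (Real.sqrt_nonneg _)]
  rw [mode_eq_ite_mul_cos, abs_mul]
  exact (mul_le_of_le_one_right (abs_nonneg _) (Real.abs_cos_le_one _)).trans hcoeff

theorem abs_sinMode_le (n : ℕ) (y : ℝ) : |sinMode n y| ≤ Real.sqrt 2 := by
  rw [sinMode, abs_mul, abs_of_nonneg (Real.sqrt_nonneg _)]
  exact mul_le_of_le_one_right (Real.sqrt_nonneg _) (Real.abs_sin_le_one _)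

theorem integrableOn_Ioo_of_continuous {E : Type*} [NormedAddCommGroup E] {f : ℝ → E}
    (hf : Continuous f) (a b : ℝ) : IntegrableOn f (Ioo a b) :=
  hf.integrableOn_Icc.mono_set Ioo_subset_Icc_self

theorem integral_cos_int_mul_pi (j : ℤ) :
    ∫ y in Ioo (0 : ℝ) 1, Real.cos (j * Real.pi * y) = if j = 0 then 1 else 0 := by
  rw [← integral_Ioc_eq_integral_Ioo, ← intervalIntegral.integral_of_le zero_le_one]
  split_ifs with hj
  · simp [hj]
  · have hjpi : (j : ℝ) * Real.pi ≠ 0 := mul_ne_zero (mod_cast hj) Real.pi_ne_zero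
    rw [intervalIntegral.integral_comp_mul_left (fun y => Real.cos y) hjpi, integral_cos]
    simp [Real.sin_int_mul_pi]

theorem integral_cos_mul_cos (m n : ℕ) :
    ∫ y in Ioo (0 : ℝ) 1, Real.cos (m * Real.pi * y) * Real.cos (n * Real.pi * y) =
      ((if (m - n : ℤ) = 0 then 1 else 0) + (if (m + n : ℤ) = 0 then 1 else 0)) / 2 := by
  have hprod : ∀ y : ℝ, Real.cos (m * Real.pi * y) * Real.cos (n * Real.pi * y) =
      (Real.cos (((m - n : ℤ) : ℝ) * Real.pi * y) +
        Real.cos (((m + n : ℤ) : ℝ) * Real.pi * y)) / 2 := fun y => by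
    have h := Real.two_mul_cos_mul_cos (m * Real.pi * y) (n * Real.pi * y)
    push_cast
    rw [sub_mul, sub_mul, add_mul, add_mul]
    linarith
  simp_rw [hprod]
  rw [integral_div, integral_add (integrableOn_Ioo_of_continuous (by fun_prop) _ _)
    (integrableOn_Ioo_of_continuous (by fun_prop) _ _), integral_cos_int_mul_pi,
    integral_cos_int_mul_pi]

theorem integral_sin_mul_sin (m n : ℕ) :
    ∫ y in Ioo (0 : ℝ) 1, Real.sin (m * Real.pi * y) * Real.sin (n * Real.pi * y) =
      ((if (m - n : ℤ) = 0 then 1 else 0) - (if (m + n : ℤ) = 0 then 1 else 0)) / 2 := by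
  have hprod : ∀ y : ℝ, Real.sin (m * Real.pi * y) * Real.sin (n * Real.pi * y) =
      (Real.cos (((m - n : ℤ) : ℝ) * Real.pi * y) -
        Real.cos (((m + n : ℤ) : ℝ) * Real.pi * y)) / 2 := fun y => by
    have h := Real.two_mul_sin_mul_sin (m * Real.pi * y) (n * Real.pi * y)
    push_cast
    rw [sub_mul, sub_mul, add_mul, add_mul]
    linarith
  simp_rw [hprod]
  rw [integral_div, integral_sub (integrableOn_Ioo_of_continuous (by fun_prop) _ _)
    (integrableOn_Ioo_of_continuous (by fun_prop) _ _), integral_cos_int_mul_pi,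
    integral_cos_int_mul_pi]

theorem integral_mode_mul_mode (m n : ℕ) :
    ∫ y in Ioo (0 : ℝ) 1, mode m y * mode n y = if m = n then 1 else 0 := by
  simp_rw [mode_eq_ite_mul_cos, mul_mul_mul_comm _ (Real.cos _)]
  rw [integral_const_mul, integral_cos_mul_cos]
  have hsub : (m - n : ℤ) = 0 ↔ m = n := by omega
  have hadd : (m + n : ℤ) = 0 ↔ m = 0 ∧ n = 0 := by omega
  simp only [hsub, hadd]
  rcases eq_or_ne m n with rfl | hmn
  · rcases eq_or_ne m 0 with rfl | hm
    · norm_num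
    · simp [hm]
  · have : ¬(m = 0 ∧ n = 0) := fun h => hmn (h.1.trans h.2.symm)
    simp [hmn, this]

theorem integral_sinMode_mul_sinMode_of_ne {m n : ℕ} (hmn : m ≠ n) :
    ∫ y in Ioo (0 : ℝ) 1, sinMode m y * sinMode n y = 0 := by
  simp_rw [sinMode, mul_mul_mul_comm _ (Real.sin _)]
  rw [integral_const_mul, integral_sin_mul_sin, if_neg (by omega), if_neg (by omega)]
  simp

end TransverseModes

section Completeness

variable {f : ℝ → ℂ}

theorem integrableOn_ofReal_mul {b : ℝ → ℝ} (hb : Continuous b) (hf : IntegrableOn f (Ioo 0 1)) :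
    IntegrableOn (fun y => (b y : ℂ) * f y) (Ioo 0 1) := by
  obtain ⟨C, hC⟩ := (isCompact_Icc (a := (0 : ℝ)) (b := 1)).exists_bound_of_continuousOn
    hb.continuousOn
  refine hf.bdd_mul (c := C) (by fun_prop) ?_
  filter_upwards [ae_restrict_mem measurableSet_Ioo] with y hy
  simpa only [Complex.norm_real] using hC y (Ioo_subset_Icc_self hy)

theorem integral_eval_cos_mul_eq_zero (hf : IntegrableOn f (Ioo 0 1))
    (h : ∀ n : ℕ, ∫ y in Ioo (0 : ℝ) 1, (Real.cos (n * (Real.pi * y)) : ℂ) * f y = 0)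
    (P : Polynomial ℝ) :
    ∫ y in Ioo (0 : ℝ) 1, ((P.eval (Real.cos (Real.pi * y)) : ℝ) : ℂ) * f y = 0 := by
  have hP : P ∈ Submodule.span ℝ (range (Polynomial.Chebyshev.chebyshevTsequence ℝ)) := by
    rw [Polynomial.Sequence.span]
    · trivial
    · intro n
      change IsUnit (Polynomial.Chebyshev.T ℝ n).leadingCoeff
      simp
  induction hP using Submodule.span_induction with
  | mem _ hT =>
    obtain ⟨n, rfl⟩ := hT
    refine (integral_congr_ae (Eventually.of_forall fun y => ?_)).trans (h n)
    change ((Polynomial.Chebyshev.T ℝ n).eval _ : ℂ) * f y = _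
    rw [Polynomial.Chebyshev.T_real_cos]
    simp
  | zero => simp
  | add P Q _ _ hP hQ =>
    simp_rw [Polynomial.eval_add, Complex.ofReal_add, add_mul]
    rw [integral_add (integrableOn_ofReal_mul (by fun_prop) hf)
      (integrableOn_ofReal_mul (by fun_prop) hf), hP, hQ, add_zero]
  | smul a P _ hP =>
    simp_rw [Polynomial.eval_smul, smul_eq_mul, Complex.ofReal_mul, mul_assoc]
    rw [integral_const_mul, hP, mul_zero]

theorem integral_continuous_mul_eq_zero (hf : IntegrableOn f (Ioo 0 1))
    (h : ∀ P : Polynomial ℝ,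
      ∫ y in Ioo (0 : ℝ) 1, ((P.eval (Real.cos (Real.pi * y)) : ℝ) : ℂ) * f y = 0)
    {g : ℝ → ℝ} (hg : Continuous g) : ∫ y in Ioo (0 : ℝ) 1, (g y : ℂ) * f y = 0 := by
  rw [← norm_le_zero_iff]
  refine le_of_forall_pos_le_add fun ε hε => ?_
  set A := ∫ y in Ioo (0 : ℝ) 1, ‖f y‖
  have hA : 0 ≤ A := integral_nonneg fun _ => norm_nonneg _
  -- On `[0,1]`, `g` is a continuous function of `cos (π y)`.
  obtain ⟨P, hP⟩ := exists_polynomial_near_of_continuousOn (-1) 1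
    (fun t => g (Real.arccos t / Real.pi))
    (hg.comp (Real.continuous_arccos.div_const _)).continuousOn (ε / (A + 1))
    (div_pos hε (by linarith))
  have hnear : ∀ y ∈ Ioo (0 : ℝ) 1, |g y - P.eval (Real.cos (Real.pi * y))| ≤ ε / (A + 1) := by
    intro y hy
    have hPy := hP (Real.cos (Real.pi * y)) ⟨Real.neg_one_le_cos _, Real.cos_le_one _⟩
    rw [Real.arccos_cos (by have := hy.1; positivity) (by nlinarith [hy.2, Real.pi_pos]),
      mul_div_cancel_left₀ _ Real.pi_ne_zero] at hPy
    rw [abs_sub_comm]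
    exact hPy.le
  calc ‖∫ y in Ioo (0 : ℝ) 1, (g y : ℂ) * f y‖
      = ‖∫ y in Ioo (0 : ℝ) 1, ((g y - P.eval (Real.cos (Real.pi * y)) : ℝ) : ℂ) * f y‖ := by
        simp_rw [Complex.ofReal_sub, sub_mul]
        rw [integral_sub (integrableOn_ofReal_mul hg hf)
          (integrableOn_ofReal_mul (by fun_prop) hf), h, sub_zero]
    _ ≤ ∫ y in Ioo (0 : ℝ) 1, ε / (A + 1) * ‖f y‖ := by
        refine norm_integral_le_of_norm_le (hf.norm.const_mul _) ?_
        filter_upwards [ae_restrict_mem measurableSet_Ioo] with y hy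
        rw [norm_mul, Complex.norm_real]
        exact mul_le_mul_of_nonneg_right (hnear y hy) (norm_nonneg _)
    _ = ε / (A + 1) * A := integral_const_mul _ _
    _ ≤ 0 + ε := by
        rw [zero_add, div_mul_eq_mul_div, div_le_iff₀ (by linarith)]
        nlinarith

theorem ae_eq_zero_of_integral_mode_mul_eq_zero (hf : IntegrableOn f (Ioo 0 1))
    (h : ∀ n, ∫ y in Ioo (0 : ℝ) 1, (mode n y : ℂ) * f y = 0) :
    ∀ᵐ y ∂(volume.restrict (Ioo (0 : ℝ) 1)), f y = 0 := by
  have hcos : ∀ n : ℕ,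
      ∫ y in Ioo (0 : ℝ) 1, (Real.cos (n * (Real.pi * y)) : ℂ) * f y = 0 := fun n => by
    have hn := h n
    simp_rw [mode_eq_ite_mul_cos, Complex.ofReal_mul, mul_assoc] at hn
    rw [integral_const_mul] at hn
    refine (mul_eq_zero.1 hn).resolve_left ?_
    split_ifs <;> simp
  rw [ae_restrict_iff' measurableSet_Ioo]
  refine isOpen_Ioo.ae_eq_zero_of_integral_contDiff_smul_eq_zero hf.locallyIntegrableOn
    fun g hg _ hsupp => ?_
  rw [← integral_continuous_mul_eq_zero hf (integral_eval_cos_mul_eq_zero hf hcos) hg.continuous]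
  simp_rw [Complex.real_smul]
  refine (setIntegral_eq_integral_of_forall_compl_eq_zero fun y hy => ?_).symm
  rw [image_eq_zero_of_notMem_tsupport fun hy' => hy (hsupp hy'), Complex.ofReal_zero, zero_mul]

end Completeness

section ModalCoefficients

variable {f g : ℝ × ℝ → ℂ}

theorem MemL2Loc.ae_integrableOn_slice (hf : MemL2Loc f) :
    ∀ᵐ x : ℝ, IntegrableOn (fun y => f (x, y)) (Ioo 0 1) := by
  refine ae_real_iff.2 fun r hr => ?_
  have hint := hf.integrableOn hr
  rw [IntegrableOn, restrict_truncStrip] at hint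
  exact hint.prod_right_ae

theorem MemL2Loc.ae_memLp_slice (hf : MemL2Loc f) :
    ∀ᵐ x : ℝ, MemLp (fun y => f (x, y)) 2 (volume.restrict (Ioo (0 : ℝ) 1)) := by
  refine ae_real_iff.2 fun r hr => ?_
  have hmeas := (hf r hr).aestronglyMeasurable
  have hsq := integrable_norm_sq (hf r hr)
  rw [restrict_truncStrip] at hmeas hsq
  filter_upwards [hsq.prod_right_ae, hmeas.prodMk_left] with x hsq_x hmeas_x
  exact (memLp_two_iff_integrable_sq_norm hmeas_x).2 hsq_x

theorem MemL2Loc.ae_eq_zero_of_modalCoeff (hf : MemL2Loc f)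
    (h : ∀ n, ∀ᵐ x : ℝ, modalCoeff f n x = 0) : ∀ᵐ p ∂(volume.restrict strip), f p = 0 := by
  refine ae_strip_iff.2 fun r hr => ?_
  have hnorm := (hf.integrableOn hr).norm
  have hzero : ∫ p in truncStrip r, ‖f p‖ = 0 := by
    rw [restrict_truncStrip] at hnorm ⊢
    rw [integral_prod _ hnorm]
    refine integral_eq_zero_of_ae (ae_restrict_of_ae ?_)
    filter_upwards [hf.ae_integrableOn_slice, ae_all_iff.2 h] with x hint hcoeff
    refine integral_eq_zero_of_ae ?_
    filter_upwards [ae_eq_zero_of_integral_mode_mul_eq_zero hint hcoeff] with y hy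
    rw [hy, norm_zero, Pi.zero_apply]
  rw [integral_eq_zero_iff_of_nonneg (fun _ => norm_nonneg _) hnorm] at hzero
  filter_upwards [hzero] with p hp
  exact norm_eq_zero.1 hp

theorem MemL2Loc.modalCoeff_sub (hf : MemL2Loc f) (hg : MemL2Loc g) (n : ℕ) :
    ∀ᵐ x : ℝ, modalCoeff (fun p => f p - g p) n x = modalCoeff f n x - modalCoeff g n x := by
  filter_upwards [hf.ae_integrableOn_slice, hg.ae_integrableOn_slice] with x hfx hgx
  simp only [modalCoeff, mul_sub]
  exact integral_sub (integrableOn_ofReal_mul (continuous_mode n) hfx)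
    (integrableOn_ofReal_mul (continuous_mode n) hgx)

theorem MemL2Loc.ae_eq_of_modalCoeff (hf : MemL2Loc f) (hg : MemL2Loc g)
    (h : ∀ n, ∀ᵐ x : ℝ, modalCoeff f n x = modalCoeff g n x) :
    ∀ᵐ p ∂(volume.restrict strip), f p = g p := by
  have hzero := (hf.sub hg).ae_eq_zero_of_modalCoeff fun n => by
    filter_upwards [h n, hf.modalCoeff_sub hg n] with x hx hsub
    rw [hsub, hx, sub_self]
  filter_upwards [hzero] with p hp
  exact sub_eq_zero.1 hp

theorem integrable_mode_mul {μ : Measure (ℝ × ℝ)} (hf : Integrable f μ) (n : ℕ) :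
    Integrable (fun p : ℝ × ℝ => (mode n p.2 : ℂ) * f p) μ :=
  hf.bdd_mul (c := Real.sqrt 2) (by fun_prop)
    (Eventually.of_forall fun p => by
      simpa only [Complex.norm_real, Real.norm_eq_abs] using abs_mode_le n p.2)

theorem integrable_modalCoeff (hf : IntegrableOn f strip) (n : ℕ) :
    Integrable (modalCoeff f n) := by
  rw [IntegrableOn, restrict_strip] at hf
  exact (integrable_mode_mul hf n).integral_prod_left

theorem integral_norm_modalCoeff_le (hf : IntegrableOn f strip) (n : ℕ) :
    ∫ x, ‖modalCoeff f n x‖ ≤ Real.sqrt 2 * ∫ p in strip, ‖f p‖ := by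
  have hcoeff := (integrable_modalCoeff hf n).norm
  rw [IntegrableOn, restrict_strip] at hf
  rw [restrict_strip, integral_prod _ hf.norm, ← integral_const_mul]
  refine integral_mono_ae hcoeff (hf.norm.integral_prod_left.const_mul _) ?_
  filter_upwards [hf.prod_right_ae] with x hx
  rw [← integral_const_mul]
  refine norm_integral_le_of_norm_le (hx.norm.const_mul _) (Eventually.of_forall fun y => ?_)
  rw [norm_mul, Complex.norm_real]
  exact mul_le_mul_of_nonneg_right (abs_mode_le n y) (norm_nonneg _)

theorem MemL2Loc.integrableOn_modalCoeff (hf : MemL2Loc f) (n : ℕ) {r : ℝ} (hr : 0 < r) :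
    IntegrableOn (modalCoeff f n) (Ioo (-r) r) := by
  have hint := hf.integrableOn hr
  rw [IntegrableOn, restrict_truncStrip] at hint
  exact (integrable_mode_mul hint n).integral_prod_left

theorem MemL2Loc.locallyIntegrable_modalCoeff (hf : MemL2Loc f) (n : ℕ) :
    LocallyIntegrable (modalCoeff f n) := fun x =>
  ⟨Ioo (-(|x| + 1)) (|x| + 1), isOpen_Ioo.mem_nhds (abs_lt.1 (lt_add_one _)),
    hf.integrableOn_modalCoeff n (by positivity)⟩

theorem modalCoeff_sum_mode (c : ℕ → ℝ → ℂ) {n N : ℕ} (h : n < N) (x : ℝ) :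
    modalCoeff (fun p => ∑ m ∈ Finset.range N, c m p.1 * (mode m p.2 : ℂ)) n x = c n x := by
  have hterm : ∀ m, ∫ y in Ioo (0 : ℝ) 1, (mode n y : ℂ) * (c m x * (mode m y : ℂ)) =
      if n = m then c m x else 0 := fun m => by
    simp_rw [mul_left_comm _ (c m x), ← Complex.ofReal_mul]
    rw [integral_const_mul, integral_complex_ofReal, integral_mode_mul_mode]
    split_ifs <;> simp
  simp only [modalCoeff, Finset.mul_sum]
  rw [integral_finsetSum _ fun m _ => integrableOn_Ioo_of_continuous (by fun_prop) _ _]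
  simp_rw [hterm]
  rw [Finset.sum_ite_eq, if_pos (Finset.mem_range.2 h)]

end ModalCoefficients

section TestFunctions

variable {χ b : ℝ → ℝ} {C : ℝ}

theorem localWeight_mul (hχ : Continuous χ) (hs : HasCompactSupport χ) (hb : Continuous b)
    (hC : ∀ y, |b y| ≤ C) : LocalWeight (fun p => (χ p.1 : ℂ) * (b p.2 : ℂ)) where
  measurable := by fun_prop
  bounded := by
    obtain ⟨D, hD⟩ := hs.exists_bound_of_continuous hχ
    refine ⟨D * C, fun p => ?_⟩
    rw [norm_mul, Complex.norm_real, Complex.norm_real]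
    exact mul_le_mul (hD _) (hC _) (norm_nonneg _) ((norm_nonneg _).trans (hD p.1))
  eq_zero := by
    obtain ⟨R, hR, hzero⟩ := hs.exists_pos_le_norm
    exact ⟨R, hR, fun p hp => by rw [hzero p.1 hp, Complex.ofReal_zero, zero_mul]⟩

theorem integral_strip_mul (hχ : Continuous χ) (hs : HasCompactSupport χ) (hb : Continuous b)
    (hC : ∀ y, |b y| ≤ C) {f : ℝ × ℝ → ℂ} (hf : MemL2Loc f) :
    ∫ p in strip, ((χ p.1 : ℂ) * (b p.2 : ℂ)) * f p =
      ∫ x, (χ x : ℂ) * ∫ y in Ioo (0 : ℝ) 1, (b y : ℂ) * f (x, y) := by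
  have hint := (localWeight_mul hχ hs hb hC).integrableOn_mul hf
  rw [IntegrableOn, restrict_strip] at hint
  rw [restrict_strip, integral_prod _ hint]
  simp_rw [mul_assoc, integral_const_mul]

theorem integral_strip_mode_mul (hχ : Continuous χ) (hs : HasCompactSupport χ) (n : ℕ)
    {f : ℝ × ℝ → ℂ} (hf : MemL2Loc f) :
    ∫ p in strip, ((χ p.1 : ℂ) * (mode n p.2 : ℂ)) * f p =
      ∫ x, (χ x : ℂ) * modalCoeff f n x :=
  integral_strip_mul hχ hs (continuous_mode n) (abs_mode_le n) hf

theorem integrable_ofReal_mul_of_locallyIntegrable (hχ : Continuous χ) (hs : HasCompactSupport χ)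
    {c : ℝ → ℂ} (hc : LocallyIntegrable c) : Integrable (fun x => (χ x : ℂ) * c x) := by
  simpa only [Complex.real_smul] using hc.integrable_smul_left_of_hasCompactSupport hχ hs

theorem ae_eq_of_integral_test_mul {c d : ℝ → ℂ} (hc : LocallyIntegrable c)
    (hd : LocallyIntegrable d)
    (h : ∀ χ : ℝ → ℝ, ContDiff ℝ ∞ χ → HasCompactSupport χ →
      ∫ x, (χ x : ℂ) * c x = ∫ x, (χ x : ℂ) * d x) : ∀ᵐ x : ℝ, c x = d x := by
  have hzero := ae_eq_zero_of_integral_contDiff_smul_eq_zero (hc.sub hd) fun χ hχ hs => by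
    simp only [Pi.sub_apply, Complex.real_smul, mul_sub]
    rw [integral_sub (integrable_ofReal_mul_of_locallyIntegrable hχ.continuous hs hc)
      (integrable_ofReal_mul_of_locallyIntegrable hχ.continuous hs hd), h χ hχ hs, sub_self]
  filter_upwards [hzero] with x hx
  exact sub_eq_zero.1 hx

theorem TendstoL2Loc.modalCoeff_ae_eq {S : ℕ → ℝ × ℝ → ℂ} {w : ℝ × ℝ → ℂ}
    (hS : TendstoL2Loc S w) (n : ℕ) {c : ℝ → ℂ} (hc : LocallyIntegrable c)
    (h : ∀ᶠ N in atTop, ∀ x, modalCoeff (S N) n x = c x) :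
    ∀ᵐ x : ℝ, modalCoeff w n x = c x := by
  refine ae_eq_of_integral_test_mul (hS.mem_lim.locallyIntegrable_modalCoeff n) hc
    fun χ hχ hs => ?_
  have hlim := (localWeight_mul hχ.continuous hs (continuous_mode n)
    (abs_mode_le n)).tendsto_integral hS
  rw [integral_strip_mode_mul hχ.continuous hs n hS.mem_lim] at hlim
  refine tendsto_nhds_unique hlim (tendsto_const_nhds.congr' ?_)
  filter_upwards [h] with N hN
  simp_rw [integral_strip_mode_mul hχ.continuous hs n (hS.mem N), hN]

end TestFunctions

section ModalExpansion

theorem memLp_ofReal_of_continuous {b : ℝ → ℝ} (hb : Continuous b) {C : ℝ}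
    (hC : ∀ y, |b y| ≤ C) :
    MemLp (fun y => (b y : ℂ)) 2 (volume.restrict (Ioo (0 : ℝ) 1)) :=
  MemLp.of_bound (by fun_prop) C
    (Eventually.of_forall fun y => by simpa only [Complex.norm_real, Real.norm_eq_abs] using hC y)

theorem sum_norm_sq_integral_mode_mul_le {f : ℝ → ℂ}
    (hf : MemLp f 2 (volume.restrict (Ioo (0 : ℝ) 1))) (t : Finset ℕ) :
    ∑ n ∈ t, ‖∫ y in Ioo (0 : ℝ) 1, (mode n y : ℂ) * f y‖ ^ 2 ≤
      ∫ y in Ioo (0 : ℝ) 1, ‖f y‖ ^ 2 := by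
  have hmode := fun n => memLp_ofReal_of_continuous (continuous_mode n) (abs_mode_le n)
  have horth : Orthonormal ℂ fun n => (hmode n).toLp _ := by
    rw [orthonormal_iff_ite]
    intro i j
    simp_rw [inner_toLp_toLp, Complex.conj_ofReal, ← Complex.ofReal_mul]
    rw [integral_complex_ofReal, integral_mode_mul_mode]
    simp only [eq_comm (a := j), Complex.ofReal_one, Complex.ofReal_zero, apply_ite Complex.ofReal]
  have hbessel := horth.sum_inner_products_le (hf.toLp f) (s := t)
  simp_rw [norm_sq_toLp, inner_toLp_toLp, Complex.conj_ofReal] at hbessel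
  simpa only [mul_comm] using hbessel

theorem MemL2Loc.memLp_modalCoeff {f : ℝ × ℝ → ℂ} (hf : MemL2Loc f) (n : ℕ) {r : ℝ}
    (hr : 0 < r) : MemLp (modalCoeff f n) 2 (volume.restrict (Ioo (-r) r)) := by
  have hmeas := (hf.integrableOn_modalCoeff n hr).aestronglyMeasurable
  have hsq := integrable_norm_sq (hf r hr)
  rw [restrict_truncStrip] at hsq
  rw [memLp_two_iff_integrable_sq_norm hmeas]
  refine hsq.integral_prod_left.mono' (hmeas.norm.pow 2) ?_
  filter_upwards [ae_restrict_of_ae hf.ae_memLp_slice] with x hx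
  have hbessel := sum_norm_sq_integral_mode_mul_le hx {n}
  rw [Finset.sum_singleton] at hbessel
  rwa [Real.norm_of_nonneg (by positivity)]

theorem MemL2Loc.summable_modalCoeff {f : ℝ × ℝ → ℂ} (hf : MemL2Loc f) {r : ℝ}
    (hr : 0 < r) : Summable fun n => ∫ x in Ioo (-r) r, ‖modalCoeff f n x‖ ^ 2 := by
  refine summable_of_sum_range_le (c := ∫ p in truncStrip r, ‖f p‖ ^ 2)
    (fun n => integral_nonneg fun _ => by positivity) fun N => ?_
  have hsq := integrable_norm_sq (hf r hr)
  have hcoeff := fun n => integrable_norm_sq (hf.memLp_modalCoeff n hr)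
  rw [restrict_truncStrip] at hsq ⊢
  rw [integral_prod _ hsq, ← integral_finsetSum _ fun n _ => hcoeff n]
  refine integral_mono_ae (integrable_finsetSum _ fun n _ => hcoeff n) hsq.integral_prod_left ?_
  filter_upwards [ae_restrict_of_ae hf.ae_memLp_slice] with x hx
  exact sum_norm_sq_integral_mode_mul_le hx _

theorem exists_tendstoL2Loc_series {c : ℕ → ℝ → ℂ} {b : ℕ → ℝ → ℝ}
    (hc : ∀ n, ∀ r : ℝ, 0 < r → MemLp (c n) 2 (volume.restrict (Ioo (-r) r)))
    (hb : ∀ n, Continuous (b n)) {C : ℝ} (hC : ∀ n y, |b n y| ≤ C)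
    (horth : Pairwise fun m n => ∫ y in Ioo (0 : ℝ) 1, b m y * b n y = 0)
    (hs : ∀ r : ℝ, 0 < r → Summable fun n => ∫ x in Ioo (-r) r, ‖c n x‖ ^ 2) :
    ∃ w, TendstoL2Loc (fun N p => ∑ n ∈ Finset.range N, c n p.1 * (b n p.2 : ℂ)) w := by
  have hterm := fun n => memL2Loc_mul (hc n) (hb n) (hC n)
  refine exists_tendstoL2Loc (fun N => MemL2Loc.sum _ fun n _ => hterm n) fun r hr =>
    exists_tendsto_eLpNorm_sum_range (fun n => hterm n r hr) (fun m n hmn => ?_) ?_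
  · have hfac : ∀ p : ℝ × ℝ,
        c n p.1 * (b n p.2 : ℂ) * (starRingEnd ℂ) (c m p.1 * (b m p.2 : ℂ)) =
          c n p.1 * (starRingEnd ℂ) (c m p.1) * ((b n p.2 * b m p.2 : ℝ) : ℂ) := fun p => by
      rw [map_mul, Complex.conj_ofReal, mul_mul_mul_comm, Complex.ofReal_mul]
    beta_reduce
    simp_rw [hfac]
    rw [restrict_truncStrip, integral_prod_mul (fun x => c n x * (starRingEnd ℂ) (c m x))
      fun y => ((b n y * b m y : ℝ) : ℂ), integral_complex_ofReal, horth hmn.symm,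
      Complex.ofReal_zero, mul_zero]
  · refine Summable.of_nonneg_of_le (fun n => integral_nonneg fun _ => by positivity)
      (fun n => ?_) ((hs r hr).mul_right (C ^ 2))
    have hb_sq : ∫ y in Ioo (0 : ℝ) 1, ‖(b n y : ℂ)‖ ^ 2 ≤ C ^ 2 := by
      refine (integral_mono (integrableOn_Ioo_of_continuous (by fun_prop) _ _)
        (integrableOn_Ioo_of_continuous continuous_const _ _) fun _ => ?_).trans_eq
        (b := ∫ _ in Ioo (0 : ℝ) 1, C ^ 2) (by simp)
      rw [Complex.norm_real]
      exact pow_le_pow_left₀ (norm_nonneg _) (hC n _) 2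
    simp_rw [norm_mul, mul_pow]
    rw [restrict_truncStrip, integral_prod_mul (fun x => ‖c n x‖ ^ 2)
      fun y => ‖(b n y : ℂ)‖ ^ 2]
    exact mul_le_mul_of_nonneg_left hb_sq (integral_nonneg fun _ => by positivity)

theorem exists_tendstoL2Loc_mode_series {c : ℕ → ℝ → ℂ}
    (hc : ∀ n, ∀ r : ℝ, 0 < r → MemLp (c n) 2 (volume.restrict (Ioo (-r) r)))
    (hs : ∀ r : ℝ, 0 < r → Summable fun n => ∫ x in Ioo (-r) r, ‖c n x‖ ^ 2) :
    ∃ w, TendstoL2Loc (fun N p => ∑ n ∈ Finset.range N, c n p.1 * (mode n p.2 : ℂ)) w :=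
  exists_tendstoL2Loc_series hc continuous_mode abs_mode_le
    (fun m n hmn => (integral_mode_mul_mode m n).trans (if_neg hmn)) hs

theorem exists_tendstoL2Loc_sinMode_series {c : ℕ → ℝ → ℂ}
    (hc : ∀ n, ∀ r : ℝ, 0 < r → MemLp (c n) 2 (volume.restrict (Ioo (-r) r)))
    (hs : ∀ r : ℝ, 0 < r → Summable fun n => ∫ x in Ioo (-r) r, ‖c n x‖ ^ 2) :
    ∃ w, TendstoL2Loc (fun N p => ∑ n ∈ Finset.range N, c n p.1 * (sinMode n p.2 : ℂ)) w :=
  exists_tendstoL2Loc_series hc continuous_sinMode abs_sinMode_le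
    (fun _ _ hmn => integral_sinMode_mul_sinMode_of_ne hmn) hs

theorem MemL2Loc.tendstoL2Loc_modalExpansion {f : ℝ × ℝ → ℂ} (hf : MemL2Loc f) :
    TendstoL2Loc (fun N p => ∑ n ∈ Finset.range N, modalCoeff f n p.1 * (mode n p.2 : ℂ)) f := by
  obtain ⟨w, hw⟩ := exists_tendstoL2Loc_mode_series (fun n r hr => hf.memLp_modalCoeff n hr)
    (fun r hr => hf.summable_modalCoeff hr)
  refine hw.congr_lim (hw.mem_lim.ae_eq_of_modalCoeff hf fun n =>
    hw.modalCoeff_ae_eq n (hf.locallyIntegrable_modalCoeff n) ?_)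
  filter_upwards [eventually_gt_atTop n] with N hN x
  exact modalCoeff_sum_mode _ hN x

end ModalExpansion

section WaveKernel

variable {κ : ℂ}

/-- The kernel `exp (iκ|t|)`: up to the factor `i / (2κ)`, the outgoing fundamental solution of
`-(d²/dt² + κ²)` on the line. -/
noncomputable def waveKernel (κ : ℂ) (t : ℝ) : ℂ := Complex.exp (Complex.I * κ * (|t| : ℝ))

/-- The kernel `sgn(t) exp (iκ|t|)`, which is the derivative of `waveKernel κ` away from `t = 0`,
divided by `iκ`. -/
noncomputable def signedWaveKernel (κ : ℂ) (t : ℝ) : ℂ :=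
  ((SignType.sign t : ℝ) : ℂ) * waveKernel κ t

theorem signedWaveKernel_of_pos (κ : ℂ) {t : ℝ} (ht : 0 < t) :
    signedWaveKernel κ t = waveKernel κ t := by
  simp only [signedWaveKernel, sign_pos ht, SignType.coe_one, Complex.ofReal_one, one_mul]

theorem signedWaveKernel_of_neg (κ : ℂ) {t : ℝ} (ht : t < 0) :
    signedWaveKernel κ t = -waveKernel κ t := by
  simp only [signedWaveKernel, sign_neg ht, SignType.coe_neg_one, Complex.ofReal_neg,
    Complex.ofReal_one, neg_one_mul]

theorem norm_waveKernel (κ : ℂ) (t : ℝ) : ‖waveKernel κ t‖ = Real.exp (-(κ.im * |t|)) := by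
  simp [waveKernel, Complex.norm_exp]

theorem norm_waveKernel_le_one (hκ : 0 ≤ κ.im) (t : ℝ) : ‖waveKernel κ t‖ ≤ 1 := by
  rw [norm_waveKernel, Real.exp_le_one_iff, neg_nonpos]
  positivity

theorem norm_signedWaveKernel_le (κ : ℂ) (t : ℝ) : ‖signedWaveKernel κ t‖ ≤ ‖waveKernel κ t‖ := by
  rw [signedWaveKernel, norm_mul, Complex.norm_real]
  refine mul_le_of_le_one_left (norm_nonneg _) ?_
  rcases SignType.sign t <;> simp

theorem norm_signedWaveKernel_le_one (hκ : 0 ≤ κ.im) (t : ℝ) : ‖signedWaveKernel κ t‖ ≤ 1 :=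
  (norm_signedWaveKernel_le κ t).trans (norm_waveKernel_le_one hκ t)

@[fun_prop]
theorem continuous_waveKernel (κ : ℂ) : Continuous (waveKernel κ) := by
  unfold waveKernel
  fun_prop

theorem continuousAt_signedWaveKernel (κ : ℂ) {t : ℝ} (ht : t ≠ 0) :
    ContinuousAt (signedWaveKernel κ) t :=
  ((Complex.continuous_ofReal.comp continuous_of_discreteTopology).continuousAt.comp
    (continuousAt_sign_of_ne_zero ht)).mul (continuous_waveKernel κ).continuousAt

@[fun_prop]
theorem measurable_waveKernel (κ : ℂ) : Measurable (waveKernel κ) :=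
  (continuous_waveKernel κ).measurable

@[fun_prop]
theorem measurable_signedWaveKernel (κ : ℂ) : Measurable (signedWaveKernel κ) :=
  measurable_of_continuousOn_compl_singleton 0 fun _ ht =>
    (continuousAt_signedWaveKernel κ ht).continuousWithinAt

theorem hasDerivAt_waveKernel (κ : ℂ) {t : ℝ} (ht : t ≠ 0) :
    HasDerivAt (waveKernel κ) (Complex.I * κ * signedWaveKernel κ t) t :=
  (((hasDerivAt_abs ht).ofReal_comp).const_mul (Complex.I * κ)).cexp.congr_deriv (by
    rw [signedWaveKernel, waveKernel]; ring)

theorem norm_waveKernel_sub_le (hκ : 0 ≤ κ.im) (s t : ℝ) :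
    ‖waveKernel κ s - waveKernel κ t‖ ≤ ‖κ‖ * |s - t| := by
  have hlip := (convex_Ici (0 : ℝ)).norm_image_sub_le_of_norm_hasDerivWithin_le
    (f := fun t : ℝ => Complex.exp (Complex.I * κ * t))
    (f' := fun t => Complex.exp (Complex.I * κ * t) * (Complex.I * κ)) (C := ‖κ‖)
    (fun t _ => HasDerivAt.hasDerivWithinAt <| by
      simpa using ((hasDerivAt_id t).ofReal_comp.const_mul (Complex.I * κ)).cexp)
    (fun t ht => by
      rw [norm_mul, norm_mul, Complex.norm_I, one_mul]
      refine mul_le_of_le_one_left (norm_nonneg _) ?_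
      simpa only [waveKernel, abs_of_nonneg (mem_Ici.1 ht)] using norm_waveKernel_le_one hκ t)
    (abs_nonneg t) (abs_nonneg s)
  refine hlip.trans (mul_le_mul_of_nonneg_left ?_ (norm_nonneg _))
  exact abs_abs_sub_abs_le_abs_sub s t

end WaveKernel

section Convolution

variable {g : ℝ → ℂ} {M : ℝ → ℂ} {C : ℝ}

theorem ae_sub_ne_zero (x : ℝ) : ∀ᵐ z : ℝ, x - z ≠ 0 := by
  filter_upwards [volume.ae_ne x] with z hz
  exact sub_ne_zero.2 hz.symm

theorem integrable_mul_kernel (hg : Integrable g) (hM : Measurable M) (hMC : ∀ t, ‖M t‖ ≤ C)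
    (x : ℝ) : Integrable fun z => g z * M (x - z) :=
  hg.mul_bdd (Measurable.aestronglyMeasurable (by fun_prop)) (Eventually.of_forall fun _ => hMC _)

theorem integrable_prod_mul_kernel {h : ℝ → ℂ} (hh : Integrable h) (hg : Integrable g)
    (hM : Measurable M) (hMC : ∀ t, ‖M t‖ ≤ C) :
    Integrable (Function.uncurry fun x z => h x * (g z * M (x - z)))
      (volume.prod (volume : Measure ℝ)) := by
  simp_rw [← mul_assoc]
  exact (hh.mul_prod hg).mul_bdd (g := fun p : ℝ × ℝ => M (p.1 - p.2))
    (Measurable.aestronglyMeasurable (by fun_prop)) (Eventually.of_forall fun _ => hMC _)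

theorem integral_mul_integral_kernel {h : ℝ → ℂ} (hh : Integrable h) (hg : Integrable g)
    (hM : Measurable M) (hMC : ∀ t, ‖M t‖ ≤ C) :
    ∫ x, h x * ∫ z, g z * M (x - z) = ∫ z, g z * ∫ x, h x * M (x - z) := by
  simp_rw [← integral_const_mul]
  rw [integral_integral_swap (integrable_prod_mul_kernel hh hg hM hMC)]
  simp_rw [mul_left_comm]

theorem integrable_mul_integral_kernel {h : ℝ → ℂ} (hh : Integrable h) (hg : Integrable g)
    (hM : Measurable M) (hMC : ∀ t, ‖M t‖ ≤ C) :
    Integrable fun z => g z * ∫ x, h x * M (x - z) := by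
  simp_rw [← integral_const_mul, mul_left_comm (g _)]
  exact (integrable_prod_mul_kernel hh hg hM hMC).integral_prod_right

theorem tendsto_integral_mul_kernel_zero (hg : Integrable g) (hM : Measurable M)
    (hMC : ∀ t, ‖M t‖ ≤ C) {l : Filter ℝ} [l.IsCountablyGenerated]
    (h : ∀ z, ∀ᶠ x in l, M (x - z) = 0) :
    Tendsto (fun x => ∫ z, g z * M (x - z)) l (𝓝 0) := by
  have hlim := tendsto_integral_filter_of_dominated_convergence (μ := volume) (l := l)
    (F := fun x z => g z * M (x - z)) (f := fun _ => (0 : ℂ)) (fun z => ‖g z‖ * C)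
    (Eventually.of_forall fun x => (integrable_mul_kernel hg hM hMC x).aestronglyMeasurable)
    (Eventually.of_forall fun x => Eventually.of_forall fun z =>
      (norm_mul _ _).trans_le (mul_le_mul_of_nonneg_left (hMC _) (norm_nonneg _)))
    (hg.norm.mul_const C)
    (Eventually.of_forall fun z => tendsto_const_nhds.congr' ((h z).mono fun x hx => by
      simp only [hx, mul_zero]))
  simpa only [integral_zero] using hlim

end Convolution

section OutgoingSolution

variable {κ : ℂ} {g : ℝ → ℂ}

/-- The outgoing solution of `U'' + κ² U = -g` on the line. -/
noncomputable def outgoingSol (κ : ℂ) (g : ℝ → ℂ) (x : ℝ) : ℂ :=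
  Complex.I / (2 * κ) * ∫ z, g z * waveKernel κ (x - z)

/-- The derivative of `outgoingSol κ g`, see `hasDerivAt_outgoingSol`. -/
noncomputable def outgoingSolDeriv (κ : ℂ) (g : ℝ → ℂ) (x : ℝ) : ℂ :=
  -(1 / 2) * ∫ z, g z * signedWaveKernel κ (x - z)

theorem integrable_mul_waveKernel (hκ : 0 ≤ κ.im) (hg : Integrable g) (x : ℝ) :
    Integrable fun z => g z * waveKernel κ (x - z) :=
  integrable_mul_kernel hg (measurable_waveKernel κ) (norm_waveKernel_le_one hκ) x

theorem integrable_mul_signedWaveKernel (hκ : 0 ≤ κ.im) (hg : Integrable g) (x : ℝ) :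
    Integrable fun z => g z * signedWaveKernel κ (x - z) :=
  integrable_mul_kernel hg (measurable_signedWaveKernel κ) (norm_signedWaveKernel_le_one hκ) x

theorem hasDerivAt_integral_mul_waveKernel (hκ : 0 ≤ κ.im) (hg : Integrable g) (x : ℝ) :
    HasDerivAt (fun x => ∫ z, g z * waveKernel κ (x - z))
      (∫ z, g z * (Complex.I * κ * signedWaveKernel κ (x - z))) x := by
  refine (hasDerivAt_integral_of_dominated_loc_of_lip (𝕜 := ℝ)
    (F := fun x z => g z * waveKernel κ (x - z)) (bound := fun z => ‖g z‖ * ‖κ‖) univ_mem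
    (Eventually.of_forall fun y => (integrable_mul_waveKernel hκ hg y).aestronglyMeasurable)
    (integrable_mul_waveKernel hκ hg x)
    (hg.aestronglyMeasurable.mul (Measurable.aestronglyMeasurable (by fun_prop)))
    (Eventually.of_forall fun z => LipschitzOnWith.of_dist_le_mul fun a _ b _ => ?_)
    (hg.norm.mul_const _) ?_).2
  · rw [dist_eq_norm, ← mul_sub, norm_mul, Real.coe_nnabs, abs_of_nonneg (by positivity),
      mul_assoc]
    refine mul_le_mul_of_nonneg_left ?_ (norm_nonneg _)
    simpa only [sub_sub_sub_cancel_right, Real.dist_eq] using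
      norm_waveKernel_sub_le hκ (a - z) (b - z)
  · filter_upwards [ae_sub_ne_zero x] with z hz
    exact ((hasDerivAt_waveKernel κ hz).comp_sub_const x z).const_mul (g z)

theorem hasDerivAt_outgoingSol (hκ0 : κ ≠ 0) (hκ : 0 ≤ κ.im) (hg : Integrable g) (x : ℝ) :
    HasDerivAt (outgoingSol κ g) (outgoingSolDeriv κ g x) x := by
  refine ((hasDerivAt_integral_mul_waveKernel hκ hg x).const_mul _).congr_deriv ?_
  simp_rw [mul_left_comm (g _)]
  rw [integral_const_mul, outgoingSolDeriv, ← mul_assoc]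
  congr 1
  field_simp
  rw [Complex.I_sq]

theorem continuous_outgoingSolDeriv (hκ : 0 ≤ κ.im) (hg : Integrable g) :
    Continuous (outgoingSolDeriv κ g) := by
  refine continuous_iff_continuousAt.2 fun x => continuousAt_const.mul ?_
  refine continuousAt_of_dominated (bound := fun z => ‖g z‖)
    (Eventually.of_forall fun y => (integrable_mul_signedWaveKernel hκ hg y).aestronglyMeasurable)
    (Eventually.of_forall fun y => Eventually.of_forall fun z => (norm_mul _ _).trans_le
      (mul_le_of_le_one_right (norm_nonneg _) (norm_signedWaveKernel_le_one hκ _))) hg.norm ?_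
  filter_upwards [ae_sub_ne_zero x] with z hz
  exact continuousAt_const.mul (ContinuousAt.comp (f := fun y : ℝ => y - z) (x := x)
    (continuousAt_signedWaveKernel κ hz) (by fun_prop))

theorem continuous_outgoingSol (hκ0 : κ ≠ 0) (hκ : 0 ≤ κ.im) (hg : Integrable g) :
    Continuous (outgoingSol κ g) :=
  continuous_iff_continuousAt.2 fun x => (hasDerivAt_outgoingSol hκ0 hκ hg x).continuousAt

theorem deriv_outgoingSol (hκ0 : κ ≠ 0) (hκ : 0 ≤ κ.im) (hg : Integrable g) :
    deriv (outgoingSol κ g) = outgoingSolDeriv κ g :=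
  funext fun x => (hasDerivAt_outgoingSol hκ0 hκ hg x).deriv

theorem contDiff_outgoingSol (hκ0 : κ ≠ 0) (hκ : 0 ≤ κ.im) (hg : Integrable g) :
    ContDiff ℝ 1 (outgoingSol κ g) :=
  contDiff_one_iff_deriv.2 ⟨fun x => (hasDerivAt_outgoingSol hκ0 hκ hg x).differentiableAt,
    deriv_outgoingSol hκ0 hκ hg ▸ continuous_outgoingSolDeriv hκ hg⟩

theorem outgoingSolDeriv_sub (hκ0 : κ ≠ 0) (hκ : 0 ≤ κ.im) (hg : Integrable g) (x : ℝ) :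
    outgoingSolDeriv κ g x - Complex.I * κ * outgoingSol κ g x =
      (1 / 2) * ∫ z, g z * (waveKernel κ (x - z) - signedWaveKernel κ (x - z)) := by
  simp_rw [mul_sub]
  rw [integral_sub (integrable_mul_waveKernel hκ hg x) (integrable_mul_signedWaveKernel hκ hg x),
    outgoingSolDeriv, outgoingSol]
  field_simp
  rw [Complex.I_sq]
  ring

theorem neg_outgoingSolDeriv_sub (hκ0 : κ ≠ 0) (hκ : 0 ≤ κ.im) (hg : Integrable g) (x : ℝ) :
    -outgoingSolDeriv κ g x - Complex.I * κ * outgoingSol κ g x =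
      (1 / 2) * ∫ z, g z * (waveKernel κ (x - z) + signedWaveKernel κ (x - z)) := by
  simp_rw [mul_add]
  rw [integral_add (integrable_mul_waveKernel hκ hg x) (integrable_mul_signedWaveKernel hκ hg x),
    outgoingSolDeriv, outgoingSol]
  field_simp
  rw [Complex.I_sq]
  ring

theorem tendsto_radiation_iff {c d : ℝ → ℂ} :
    Tendsto (fun x : ℝ => ‖d x * ((x / |x| : ℝ) : ℂ) - Complex.I * κ * c x‖)
      (comap (fun x : ℝ => |x|) atTop) (𝓝 0) ↔
    Tendsto (fun x => d x - Complex.I * κ * c x) atTop (𝓝 0) ∧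
      Tendsto (fun x => -d x - Complex.I * κ * c x) atBot (𝓝 0) := by
  rw [comap_abs_atTop, tendsto_sup, ← tendsto_zero_iff_norm_tendsto_zero,
    ← tendsto_zero_iff_norm_tendsto_zero, and_comm]
  refine and_congr (tendsto_congr' ?_) (tendsto_congr' ?_)
  · filter_upwards [eventually_gt_atTop 0] with x hx
    rw [abs_of_pos hx, div_self hx.ne', Complex.ofReal_one, mul_one]
  · filter_upwards [eventually_lt_atBot 0] with x hx
    rw [abs_of_neg hx, div_neg, div_self hx.ne, Complex.ofReal_neg, Complex.ofReal_one, mul_neg_one]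

theorem tendsto_radiation_outgoingSol (hκ0 : κ ≠ 0) (hκ : 0 ≤ κ.im) (hg : Integrable g) :
    Tendsto (fun x : ℝ => ‖outgoingSolDeriv κ g x * ((x / |x| : ℝ) : ℂ) -
      Complex.I * κ * outgoingSol κ g x‖) (comap (fun x : ℝ => |x|) atTop) (𝓝 0) := by
  have hwave := norm_waveKernel_le_one hκ
  have hsigned := norm_signedWaveKernel_le_one hκ
  rw [tendsto_radiation_iff]
  simp_rw [outgoingSolDeriv_sub hκ0 hκ hg, neg_outgoingSolDeriv_sub hκ0 hκ hg]
  rw [← mul_zero (1 / 2 : ℂ)]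
  constructor
  · refine (tendsto_integral_mul_kernel_zero (M := fun t => waveKernel κ t - signedWaveKernel κ t)
      hg (by fun_prop) (fun t => norm_sub_le_of_le (hwave t) (hsigned t)) fun z => ?_).const_mul _
    filter_upwards [eventually_gt_atTop z] with x hx
    rw [signedWaveKernel_of_pos κ (sub_pos.2 hx), sub_self]
  · refine (tendsto_integral_mul_kernel_zero (M := fun t => waveKernel κ t + signedWaveKernel κ t)
      hg (by fun_prop) (fun t => norm_add_le_of_le (hwave t) (hsigned t)) fun z => ?_).const_mul _
    filter_upwards [eventually_lt_atBot z] with x hx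
    rw [signedWaveKernel_of_neg κ (sub_neg.2 hx), add_neg_cancel]

end OutgoingSolution

section WeakDerivativeLine

/-- `d` is the weak derivative of `c` on the line. -/
def HasWeakDeriv1 (c d : ℝ → ℂ) : Prop :=
  ∀ χ : ℝ → ℝ, ContDiff ℝ ∞ χ → HasCompactSupport χ →
    ∫ x, ((deriv χ x : ℝ) : ℂ) * c x = -∫ x, (χ x : ℂ) * d x

variable {χ : ℝ → ℝ} {κ : ℂ} {g : ℝ → ℂ}

theorem hasDerivAt_ofReal_test (hχ : ContDiff ℝ ∞ χ) (x : ℝ) :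
    HasDerivAt (fun x => (χ x : ℂ)) ((deriv χ x : ℝ) : ℂ) x :=
  (hχ.differentiable (by simp) x).hasDerivAt.ofReal_comp

theorem hasWeakDeriv1_of_hasDerivAt {c d : ℝ → ℂ} (h : ∀ x, HasDerivAt c (d x) x)
    (hd : Continuous d) : HasWeakDeriv1 c d := by
  intro χ hχ hs
  have hc : Continuous c := continuous_iff_continuousAt.2 fun x => (h x).continuousAt
  have hχd : Continuous (deriv χ) := hχ.continuous_deriv (by simp)
  exact neg_eq_iff_eq_neg.1 <| Eq.symm <| integral_mul_deriv_eq_deriv_mul_of_integrable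
    (fun x _ => hasDerivAt_ofReal_test hχ x) (fun x _ => h x)
    (integrable_ofReal_mul_of_locallyIntegrable hχ.continuous hs hd.locallyIntegrable)
    (integrable_ofReal_mul_of_locallyIntegrable hχd hs.deriv hc.locallyIntegrable)
    (integrable_ofReal_mul_of_locallyIntegrable hχ.continuous hs hc.locallyIntegrable)

theorem integral_deriv_mul_signedWaveKernel (hκ : 0 ≤ κ.im) (hχ : ContDiff ℝ ∞ χ)
    (hs : HasCompactSupport χ) (z : ℝ) :
    ∫ x, ((deriv χ x : ℝ) : ℂ) * signedWaveKernel κ (x - z) =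
      -2 * χ z - Complex.I * κ * ∫ x, (χ x : ℂ) * waveKernel κ (x - z) := by
  set F : ℝ → ℂ := fun x => (χ x : ℂ) * waveKernel κ (x - z) with hF
  set G : ℝ → ℂ := fun x => ((deriv χ x : ℝ) : ℂ) * signedWaveKernel κ (x - z) +
    Complex.I * κ * ((χ x : ℂ) * waveKernel κ (x - z)) with hG
  have hFcont : Continuous F := by have := hχ.continuous; fun_prop
  have hFs : HasCompactSupport F := (hs.comp_left Complex.ofReal_zero).mul_right
  have hFzero : Tendsto F (cocompact ℝ) (𝓝 0) := hFs.is_zero_at_infty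
  have hχint : Integrable fun x => ((deriv χ x : ℝ) : ℂ) :=
    ((hχ.continuous_deriv (by simp)).integrable_of_hasCompactSupport hs.deriv).ofReal
  have hint : Integrable fun x => ((deriv χ x : ℝ) : ℂ) * signedWaveKernel κ (x - z) :=
    hχint.mul_bdd (Measurable.aestronglyMeasurable (by fun_prop))
      (Eventually.of_forall fun _ => norm_signedWaveKernel_le_one hκ _)
  have hFint : Integrable F := hFcont.integrable_of_hasCompactSupport hFs
  have hGint : Integrable G := hint.add (hFint.const_mul _)
  have hderiv : ∀ x, x ≠ z → HasDerivAt F (((deriv χ x : ℝ) : ℂ) * waveKernel κ (x - z) +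
      (χ x : ℂ) * (Complex.I * κ * signedWaveKernel κ (x - z))) x := fun x hx =>
    (hasDerivAt_ofReal_test hχ x).mul
      ((hasDerivAt_waveKernel κ (sub_ne_zero.2 hx)).comp_sub_const x z)
  have hFz : F z = χ z := by simp [hF, waveKernel]
  have hright : ∫ x in Ioi z, G x = -χ z := by
    rw [integral_Ioi_of_hasDerivAt_of_tendsto hFcont.continuousWithinAt (m := 0) ?_
      hGint.integrableOn (hFzero.mono_left atTop_le_cocompact), hFz, zero_sub]
    refine fun x hx => (hderiv x (ne_of_gt hx)).congr_deriv ?_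
    simp only [hG, signedWaveKernel_of_pos κ (sub_pos.2 hx)]
    ring
  have hleft : ∫ x in Iic z, G x = -χ z := by
    rw [integral_Iic_of_hasDerivAt_of_tendsto hFcont.neg.continuousWithinAt (m := 0) ?_
      hGint.integrableOn (neg_zero (G := ℂ) ▸ (hFzero.mono_left atBot_le_cocompact).neg),
      Pi.neg_apply, hFz, sub_zero]
    refine fun x hx => (hderiv x (ne_of_lt hx)).neg.congr_deriv ?_
    simp only [hG, signedWaveKernel_of_neg κ (sub_neg.2 hx)]
    ring
  have htotal :=
    intervalIntegral.integral_Iic_add_Ioi (b := z) hGint.integrableOn hGint.integrableOn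
  rw [hleft, hright, hG, integral_add hint (hFint.const_mul _), integral_const_mul] at htotal
  linear_combination -htotal

theorem hasWeakDeriv1_outgoingSolDeriv (hκ0 : κ ≠ 0) (hκ : 0 ≤ κ.im) (hg : Integrable g) :
    HasWeakDeriv1 (outgoingSolDeriv κ g) (fun x => -κ ^ 2 * outgoingSol κ g x - g x) := by
  intro χ hχ hs
  have hχint : Integrable fun x => (χ x : ℂ) :=
    (hχ.continuous.integrable_of_hasCompactSupport hs).ofReal
  have hχdint : Integrable fun x => ((deriv χ x : ℝ) : ℂ) :=
    ((hχ.continuous_deriv (by simp)).integrable_of_hasCompactSupport hs.deriv).ofReal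
  have hχg : Integrable fun x => (χ x : ℂ) * g x :=
    integrable_ofReal_mul_of_locallyIntegrable hχ.continuous hs hg.locallyIntegrable
  have hχsol : Integrable fun x => (χ x : ℂ) * outgoingSol κ g x :=
    integrable_ofReal_mul_of_locallyIntegrable hχ.continuous hs
      (continuous_outgoingSol hκ0 hκ hg).locallyIntegrable
  have hwave := integrable_mul_integral_kernel hχint hg (measurable_waveKernel κ)
    (norm_waveKernel_le_one hκ)
  have hsol : ∫ x, (χ x : ℂ) * outgoingSol κ g x =
      Complex.I / (2 * κ) * ∫ z, g z * ∫ x, (χ x : ℂ) * waveKernel κ (x - z) := by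
    simp_rw [outgoingSol, mul_left_comm ((χ _ : ℝ) : ℂ)]
    rw [integral_const_mul, integral_mul_integral_kernel hχint hg (measurable_waveKernel κ)
      (norm_waveKernel_le_one hκ)]
  calc ∫ x, ((deriv χ x : ℝ) : ℂ) * outgoingSolDeriv κ g x
      = -(1 / 2) * ∫ z, g z * ∫ x, ((deriv χ x : ℝ) : ℂ) * signedWaveKernel κ (x - z) := by
        simp_rw [outgoingSolDeriv, mul_left_comm ((deriv χ _ : ℝ) : ℂ)]
        rw [integral_const_mul, integral_mul_integral_kernel hχdint hg
          (measurable_signedWaveKernel κ) (norm_signedWaveKernel_le_one hκ)]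
    _ = -(1 / 2) * ∫ z, (-2 * ((χ z : ℂ) * g z) -
          Complex.I * κ * (g z * ∫ x, (χ x : ℂ) * waveKernel κ (x - z))) := by
        simp_rw [integral_deriv_mul_signedWaveKernel hκ hχ hs]
        congr 2 with z
        ring
    _ = κ ^ 2 * (∫ x, (χ x : ℂ) * outgoingSol κ g x) + ∫ x, (χ x : ℂ) * g x := by
        rw [integral_sub (hχg.const_mul _) (hwave.const_mul _), integral_const_mul,
          integral_const_mul, hsol]
        field_simp
        ring
    _ = -∫ x, (χ x : ℂ) * (-κ ^ 2 * outgoingSol κ g x - g x) := by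
        simp_rw [mul_sub, mul_left_comm ((χ _ : ℝ) : ℂ)]
        rw [integral_sub (hχsol.const_mul _) hχg, integral_const_mul]
        ring

end WeakDerivativeLine

section ExponentialKernel

variable {q : ℝ}

theorem integral_exp_neg_mul_abs (hq : 0 < q) : ∫ t : ℝ, Real.exp (-(q * |t|)) = 2 / q := by
  have hhalf := integral_exp_mul_Ioi (neg_neg_of_pos hq) 0
  simp only [neg_mul, mul_zero, Real.exp_zero] at hhalf
  rw [integral_comp_abs (f := fun t => Real.exp (-(q * t))), hhalf]
  ring

theorem integral_exp_neg_mul_abs_sub_left (hq : 0 < q) (x : ℝ) :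
    ∫ z : ℝ, Real.exp (-(q * |x - z|)) = 2 / q := by
  rw [integral_sub_left_eq_self (fun t => Real.exp (-(q * |t|))) volume x,
    integral_exp_neg_mul_abs hq]

theorem setIntegral_exp_neg_mul_abs_sub_left_le (hq : 0 < q) (s : Set ℝ) (x : ℝ) :
    ∫ z in s, Real.exp (-(q * |x - z|)) ≤ 2 / q := by
  rw [← integral_exp_neg_mul_abs_sub_left hq x]
  exact setIntegral_le_integral
    (.of_integral_ne_zero (by rw [integral_exp_neg_mul_abs_sub_left hq]; positivity))
    (Eventually.of_forall fun z => Real.exp_nonneg _)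

theorem norm_exp_neg_mul_abs_le_one (hq : 0 ≤ q) (t : ℝ) : ‖Real.exp (-(q * |t|))‖ ≤ 1 := by
  rw [Real.norm_of_nonneg (Real.exp_nonneg _), Real.exp_le_one_iff]
  exact neg_nonpos.2 (by positivity)

end ExponentialKernel

section ExponentialPotential

variable {g : ℝ → ℂ} {q r : ℝ}

/-- The convolution `‖g‖ * e^{-q|·|}`, which dominates `outgoingSol (iq) g` and its derivative. -/
noncomputable def expPotential (q : ℝ) (g : ℝ → ℂ) (x : ℝ) : ℝ :=
  ∫ z, ‖g z‖ * Real.exp (-(q * |x - z|))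

theorem expPotential_nonneg (q : ℝ) (g : ℝ → ℂ) (x : ℝ) : 0 ≤ expPotential q g x :=
  integral_nonneg fun _ => by positivity

theorem integrable_norm_mul_exp (hg : Integrable g) (hq : 0 ≤ q) (x : ℝ) :
    Integrable fun z => ‖g z‖ * Real.exp (-(q * |x - z|)) :=
  hg.norm.mul_bdd (by fun_prop) (Eventually.of_forall fun _ => norm_exp_neg_mul_abs_le_one hq _)

theorem continuous_expPotential (hg : Integrable g) (hq : 0 ≤ q) :
    Continuous (expPotential q g) :=
  continuous_of_dominated (fun x => (integrable_norm_mul_exp hg hq x).aestronglyMeasurable)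
    (fun x => Eventually.of_forall fun z => (norm_mul_le _ _).trans
      (mul_le_of_le_one_right (norm_nonneg _) (norm_exp_neg_mul_abs_le_one hq _)))
    hg.norm.norm (Eventually.of_forall fun z => by fun_prop)

theorem sq_setIntegral_norm_mul_exp_le {s : Set ℝ} (hg : Integrable g)
    (hg2 : MemLp g 2 (volume.restrict s)) (hq : 0 < q) (x : ℝ) :
    (∫ z in s, ‖g z‖ * Real.exp (-(q * |x - z|))) ^ 2 ≤
      2 / q * ∫ z in s, ‖g z‖ ^ 2 * Real.exp (-(q * |x - z|)) :=
  sq_integral_mul_le_of_integral_le (by positivity) (fun z => Real.exp_nonneg _)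
    (Integrable.of_integral_ne_zero
      (by rw [integral_exp_neg_mul_abs_sub_left hq]; positivity)).integrableOn
    (setIntegral_exp_neg_mul_abs_sub_left_le hq s x)
    (integrable_norm_mul_exp hg hq.le x).integrableOn
    ((integrable_norm_sq hg2).mul_bdd (by fun_prop)
      (Eventually.of_forall fun _ => norm_exp_neg_mul_abs_le_one hq.le _))

theorem setIntegral_compl_norm_mul_exp_le (hg : Integrable g) (hq : 0 ≤ q) {x : ℝ}
    (hx : |x| < r) :
    ∫ z in (Ioo (-(r + 1)) (r + 1))ᶜ, ‖g z‖ * Real.exp (-(q * |x - z|)) ≤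
      Real.exp (-q) * ∫ z, ‖g z‖ := by
  rw [← integral_const_mul]
  refine (setIntegral_mono_on (integrable_norm_mul_exp hg hq x).integrableOn
    (hg.norm.const_mul _).integrableOn measurableSet_Ioo.compl fun z hz => ?_).trans
    (setIntegral_le_integral (hg.norm.const_mul _) (Eventually.of_forall fun z => by positivity))
  have hz' : r + 1 ≤ |z| := not_lt.1 fun h => hz (abs_lt.1 h)
  have hdist : 1 ≤ |x - z| := by linarith [abs_sub_abs_le_abs_sub z x, abs_sub_comm x z]
  rw [mul_comm]
  exact mul_le_mul_of_nonneg_right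
    (Real.exp_le_exp.2 (neg_le_neg (le_mul_of_one_le_right hq hdist))) (norm_nonneg _)

theorem sq_expPotential_le (hg : Integrable g)
    (hg2 : MemLp g 2 (volume.restrict (Ioo (-(r + 1)) (r + 1)))) (hq : 0 < q) {x : ℝ}
    (hx : |x| < r) :
    expPotential q g x ^ 2 ≤
      4 / q * (∫ z in Ioo (-(r + 1)) (r + 1), ‖g z‖ ^ 2 * Real.exp (-(q * |x - z|))) +
        2 * Real.exp (-(2 * q)) * (∫ z, ‖g z‖) ^ 2 := by
  have hinner := sq_setIntegral_norm_mul_exp_le hg hg2 hq x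
  have houter := pow_le_pow_left₀ (integral_nonneg fun _ => by positivity)
    (setIntegral_compl_norm_mul_exp_le hg hq.le hx) 2
  rw [mul_pow, ← Real.exp_nat_mul, Nat.cast_ofNat, mul_neg] at houter
  rw [expPotential, ← integral_add_compl (measurableSet_Ioo (a := -(r + 1)) (b := r + 1))
    (integrable_norm_mul_exp hg hq.le x)]
  calc _ ≤ _ := add_sq_le
    _ ≤ _ := mul_le_mul_of_nonneg_left (add_le_add hinner houter) zero_le_two
    _ = _ := by ring

theorem integrable_norm_sq_mul_exp_prod {s t : Set ℝ} [IsFiniteMeasure (volume.restrict s)]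
    (hg2 : MemLp g 2 (volume.restrict t)) (hq : 0 ≤ q) :
    Integrable (Function.uncurry fun x z : ℝ => ‖g z‖ ^ 2 * Real.exp (-(q * |x - z|)))
      ((volume.restrict s).prod (volume.restrict t)) :=
  ((integrable_norm_sq hg2).comp_snd _).mul_bdd
    (g := fun p : ℝ × ℝ => Real.exp (-(q * |p.1 - p.2|))) (by fun_prop)
    (Eventually.of_forall fun _ => norm_exp_neg_mul_abs_le_one hq _)

theorem setIntegral_setIntegral_norm_sq_mul_exp_le {s t : Set ℝ}
    [IsFiniteMeasure (volume.restrict s)] (hg2 : MemLp g 2 (volume.restrict t)) (hq : 0 < q) :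
    ∫ x in s, ∫ z in t, ‖g z‖ ^ 2 * Real.exp (-(q * |x - z|)) ≤ 2 / q * ∫ z in t, ‖g z‖ ^ 2 := by
  have hprod := integrable_norm_sq_mul_exp_prod (s := s) hg2 hq.le
  rw [integral_integral_swap hprod, ← integral_const_mul]
  refine integral_mono hprod.integral_prod_right ((integrable_norm_sq hg2).const_mul _)
    fun z => ?_
  simp_rw [integral_const_mul, abs_sub_comm _ z, mul_comm (2 / q)]
  exact mul_le_mul_of_nonneg_left (setIntegral_exp_neg_mul_abs_sub_left_le hq s z) (by positivity)

theorem integral_sq_expPotential_le (hr : 0 ≤ r) (hg : Integrable g)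
    (hg2 : MemLp g 2 (volume.restrict (Ioo (-(r + 1)) (r + 1)))) (hq : 0 < q) :
    ∫ x in Ioo (-r) r, expPotential q g x ^ 2 ≤
      8 / q ^ 2 * (∫ z in Ioo (-(r + 1)) (r + 1), ‖g z‖ ^ 2) +
        4 * r * Real.exp (-(2 * q)) * (∫ z, ‖g z‖) ^ 2 := by
  have hinner : Integrable
      (fun x => ∫ z in Ioo (-(r + 1)) (r + 1), ‖g z‖ ^ 2 * Real.exp (-(q * |x - z|)))
      (volume.restrict (Ioo (-r) r)) :=
    (integrable_norm_sq_mul_exp_prod hg2 hq.le).integral_prod_left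
  refine (integral_mono_of_nonneg (Eventually.of_forall fun x => sq_nonneg _)
    ((hinner.const_mul (4 / q)).add
      (integrable_const (2 * Real.exp (-(2 * q)) * (∫ z, ‖g z‖) ^ 2))) ?_).trans ?_
  · filter_upwards [ae_restrict_mem measurableSet_Ioo] with x hx
    exact sq_expPotential_le hg hg2 hq (abs_lt.2 hx)
  · rw [integral_add' (hinner.const_mul _) (integrable_const _), integral_const_mul,
      setIntegral_const, Real.volume_real_Ioo_of_le (by linarith), smul_eq_mul]
    refine (add_le_add_left (mul_le_mul_of_nonneg_left
      (setIntegral_setIntegral_norm_sq_mul_exp_le hg2 hq) (by positivity)) _).trans_eq ?_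
    field_simp
    ring

theorem norm_outgoingSol_le (hq : 0 < q) (x : ℝ) :
    ‖outgoingSol (Complex.I * q) g x‖ ≤ 1 / (2 * q) * expPotential q g x := by
  rw [outgoingSol, norm_mul]
  refine mul_le_mul (le_of_eq ?_) ((norm_integral_le_integral_norm _).trans_eq ?_)
    (norm_nonneg _) (by positivity)
  · simp [abs_of_pos hq]
  · simp [expPotential, norm_waveKernel]

theorem norm_outgoingSolDeriv_le (hg : Integrable g) (hq : 0 ≤ q) (x : ℝ) :
    ‖outgoingSolDeriv (Complex.I * q) g x‖ ≤ 1 / 2 * expPotential q g x := by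
  rw [outgoingSolDeriv, norm_mul]
  refine mul_le_mul (by simp) (norm_integral_le_of_norm_le (integrable_norm_mul_exp hg hq x)
    (Eventually.of_forall fun z => ?_)) (norm_nonneg _) (by positivity)
  rw [norm_mul]
  refine mul_le_mul_of_nonneg_left ((norm_signedWaveKernel_le _ _).trans_eq ?_) (norm_nonneg _)
  simp [norm_waveKernel]

end ExponentialPotential

section WaveNumber

variable {k : ℝ}

theorem waveNumber_sq (k : ℝ) (n : ℕ) :
    waveNumber k n ^ 2 = (k : ℂ) ^ 2 - (n : ℂ) ^ 2 * (Real.pi : ℂ) ^ 2 :=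
  ((waveNumber_eq_iff k n _).1 rfl).1

theorem waveNumber_im_nonneg (k : ℝ) (n : ℕ) : 0 ≤ (waveNumber k n).im :=
  ((waveNumber_eq_iff k n _).1 rfl).2.2

theorem waveNumber_ne_zero (hk : 0 < k) {n : ℕ} (hkn : k ≠ n * Real.pi) :
    waveNumber k n ≠ 0 := by
  intro h
  have hsq := waveNumber_sq k n
  rw [h, zero_pow two_ne_zero, ← mul_pow, eq_comm, sub_eq_zero] at hsq
  exact hkn ((pow_left_inj₀ hk.le (by positivity) two_ne_zero).1 (mod_cast hsq))

theorem eventually_waveNumber (k : ℝ) :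
    ∀ᶠ n : ℕ in atTop, ∃ q : ℝ, 1 ≤ n ∧ (n : ℝ) ≤ q ∧ waveNumber k n = Complex.I * q := by
  filter_upwards [eventually_ge_atTop 1, tendsto_natCast_atTop_atTop.eventually_ge_atTop |k|]
    with n hn hkn
  have hk_sq : k ^ 2 ≤ (n : ℝ) ^ 2 := sq_le_sq' (abs_le.1 hkn).1 (abs_le.1 hkn).2
  have hpi : 9 ≤ Real.pi ^ 2 := by nlinarith [Real.pi_gt_three]
  have hn_sq : (n : ℝ) ^ 2 ≤ n ^ 2 * Real.pi ^ 2 - k ^ 2 := by nlinarith [sq_nonneg (n : ℝ)]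
  refine ⟨Real.sqrt (n ^ 2 * Real.pi ^ 2 - k ^ 2), hn, Real.le_sqrt_of_sq_le hn_sq, ?_⟩
  rw [waveNumber, Real.sqrt_eq_zero_of_nonpos (by nlinarith [sq_nonneg (n : ℝ)]),
    Complex.ofReal_zero, zero_add]

end WaveNumber

section Summability

variable {k : ℝ} {s : ℝ × ℝ → ℂ}

theorem modalSolution_eq_outgoingSol (k : ℝ) (s : ℝ × ℝ → ℂ) (n : ℕ) :
    modalSolution k s n = outgoingSol (waveNumber k n) (modalCoeff s n) := rfl

/-- The derivative of `modalSolution k s n`. -/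
noncomputable def modalSolutionDeriv (k : ℝ) (s : ℝ × ℝ → ℂ) (n : ℕ) : ℝ → ℂ :=
  outgoingSolDeriv (waveNumber k n) (modalCoeff s n)

theorem nat_sq_mul_integral_sq_expPotential_le (hs1 : IntegrableOn s strip) (hs2 : MemL2Loc s)
    {n : ℕ} {q r : ℝ} (hr : 0 < r) (hn : 1 ≤ n) (hnq : n ≤ q) :
    (n : ℝ) ^ 2 * ∫ x in Ioo (-r) r, expPotential q (modalCoeff s n) x ^ 2 ≤
      8 * (∫ z in Ioo (-(r + 1)) (r + 1), ‖modalCoeff s n z‖ ^ 2) +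
        4 * r * (Real.sqrt 2 * ∫ p in strip, ‖s p‖) ^ 2 * ((n : ℝ) ^ 2 * Real.exp (-2 * n)) := by
  have hn' : (1 : ℝ) ≤ n := mod_cast hn
  have hq : 0 < q := by linarith
  have hratio : (n : ℝ) ^ 2 * (8 / q ^ 2) ≤ 8 := by
    rw [mul_div_assoc', div_le_iff₀ (by positivity), mul_comm]
    gcongr
  have hexp : Real.exp (-(2 * q)) ≤ Real.exp (-2 * n) := Real.exp_le_exp.2 (by linarith)
  have hL1 := pow_le_pow_left₀ (integral_nonneg fun _ => norm_nonneg _)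
    (integral_norm_modalCoeff_le hs1 n) 2
  calc _ ≤ _ := mul_le_mul_of_nonneg_left (integral_sq_expPotential_le hr.le
          (integrable_modalCoeff hs1 n) (hs2.memLp_modalCoeff n (by positivity)) hq)
          (sq_nonneg _)
    _ = (n : ℝ) ^ 2 * (8 / q ^ 2) * (∫ z in Ioo (-(r + 1)) (r + 1), ‖modalCoeff s n z‖ ^ 2) +
          (n : ℝ) ^ 2 * (4 * r * Real.exp (-(2 * q)) * (∫ z, ‖modalCoeff s n z‖) ^ 2) := by ring
    _ ≤ 8 * (∫ z in Ioo (-(r + 1)) (r + 1), ‖modalCoeff s n z‖ ^ 2) +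
          (n : ℝ) ^ 2 * (4 * r * Real.exp (-2 * n) * (Real.sqrt 2 * ∫ p in strip, ‖s p‖) ^ 2) := by
        gcongr
    _ = _ := by ring

theorem summable_integral_norm_sq (hs1 : IntegrableOn s strip) (hs2 : MemL2Loc s)
    {F : ℕ → ℝ → ℂ} {C : ℝ}
    (hF : ∀ (n : ℕ) (q : ℝ), 1 ≤ n → (n : ℝ) ≤ q → waveNumber k n = Complex.I * q →
      ∀ x, ‖F n x‖ ≤ C * n * expPotential q (modalCoeff s n) x)
    {r : ℝ} (hr : 0 < r) : Summable fun n => ∫ x in Ioo (-r) r, ‖F n x‖ ^ 2 := by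
  have hmajorant := (((hs2.summable_modalCoeff (r := r + 1) (by positivity)).mul_left 8).add
    ((Real.summable_pow_mul_exp_neg_nat_mul 2 two_pos).mul_left
      (4 * r * (Real.sqrt 2 * ∫ p in strip, ‖s p‖) ^ 2))).mul_left (C ^ 2)
  refine hmajorant.of_norm_bounded_eventually_nat ?_
  filter_upwards [eventually_waveNumber k] with n hn
  obtain ⟨q, hn1, hnq, hκ⟩ := hn
  have hq : 0 ≤ q := n.cast_nonneg.trans hnq
  rw [Real.norm_of_nonneg (integral_nonneg fun _ => by positivity)]
  calc ∫ x in Ioo (-r) r, ‖F n x‖ ^ 2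
      ≤ ∫ x in Ioo (-r) r, (C * n) ^ 2 * expPotential q (modalCoeff s n) x ^ 2 := by
        refine integral_mono_of_nonneg (Eventually.of_forall fun x => by positivity)
          (integrableOn_Ioo_of_continuous (((continuous_expPotential
            (integrable_modalCoeff hs1 n) hq).pow 2).const_mul _) _ _)
          (Eventually.of_forall fun x => ?_)
        simp_rw [← mul_pow]
        exact pow_le_pow_left₀ (norm_nonneg _) (hF n q hn1 hnq hκ x) 2
    _ = C ^ 2 * (n ^ 2 * ∫ x in Ioo (-r) r, expPotential q (modalCoeff s n) x ^ 2) := by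
        rw [integral_const_mul]
        ring
    _ ≤ _ := mul_le_mul_of_nonneg_left
        (nat_sq_mul_integral_sq_expPotential_le hs1 hs2 hr hn1 hnq) (sq_nonneg _)

theorem norm_modalSolution_le {n : ℕ} {q : ℝ} (hn : 1 ≤ n) (hnq : (n : ℝ) ≤ q)
    (hκ : waveNumber k n = Complex.I * q) (x : ℝ) :
    n * ‖modalSolution k s n x‖ ≤ expPotential q (modalCoeff s n) x := by
  have hn1 : (1 : ℝ) ≤ n := by exact_mod_cast hn
  have hq : 0 < q := by linarith
  have hJ := expPotential_nonneg q (modalCoeff s n) x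
  have h := norm_outgoingSol_le (g := modalCoeff s n) hq x
  rw [modalSolution_eq_outgoingSol, hκ]
  calc _ ≤ n * (1 / (2 * q) * expPotential q (modalCoeff s n) x) := by gcongr
    _ = (n / q) * (1 / 2) * expPotential q (modalCoeff s n) x := by ring
    _ ≤ 1 * 1 * expPotential q (modalCoeff s n) x := by
        gcongr
        · exact div_le_one_of_le₀ hnq hq.le
        · norm_num
    _ = _ := by ring

theorem norm_modalSolutionDeriv_le (hs : IntegrableOn s strip) {n : ℕ} {q : ℝ} (hq : 0 ≤ q)
    (hκ : waveNumber k n = Complex.I * q) (x : ℝ) :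
    ‖modalSolutionDeriv k s n x‖ ≤ expPotential q (modalCoeff s n) x := by
  rw [modalSolutionDeriv, hκ]
  linarith [norm_outgoingSolDeriv_le (integrable_modalCoeff hs n) hq x,
    expPotential_nonneg q (modalCoeff s n) x]

theorem summable_modalSolution (hs1 : IntegrableOn s strip) (hs2 : MemL2Loc s) {a : ℕ → ℂ} {C : ℝ}
    (ha : ∀ n : ℕ, 1 ≤ n → ‖a n‖ ≤ C * n ^ 2) {r : ℝ} (hr : 0 < r) :
    Summable fun n => ∫ x in Ioo (-r) r, ‖a n * modalSolution k s n x‖ ^ 2 := by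
  have hC : 0 ≤ C := by simpa using (norm_nonneg _).trans (ha 1 le_rfl)
  refine summable_integral_norm_sq (k := k) (C := C) hs1 hs2 (fun n q hn hnq hκ x => ?_) hr
  rw [norm_mul]
  calc ‖a n‖ * ‖modalSolution k s n x‖ ≤ C * n ^ 2 * ‖modalSolution k s n x‖ := by
        gcongr
        exact ha n hn
    _ = C * n * (n * ‖modalSolution k s n x‖) := by ring
    _ ≤ _ := by
        gcongr
        exact norm_modalSolution_le hn hnq hκ x

theorem summable_modalSolutionDeriv (hs1 : IntegrableOn s strip) (hs2 : MemL2Loc s) {a : ℕ → ℂ}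
    {C : ℝ} (ha : ∀ n : ℕ, 1 ≤ n → ‖a n‖ ≤ C * n) {r : ℝ} (hr : 0 < r) :
    Summable fun n => ∫ x in Ioo (-r) r, ‖a n * modalSolutionDeriv k s n x‖ ^ 2 := by
  refine summable_integral_norm_sq (k := k) (C := C) hs1 hs2 (fun n q hn hnq hκ x => ?_) hr
  rw [norm_mul]
  exact mul_le_mul (ha n hn) (norm_modalSolutionDeriv_le hs1 (n.cast_nonneg.trans hnq) hκ x)
    (norm_nonneg _) ((norm_nonneg _).trans (ha n hn))

end Summability

section ProductDerivatives

variable {c d : ℝ → ℂ} {b b' : ℝ → ℝ} {C C' : ℝ} {ψ : ℝ × ℝ → ℝ}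

theorem memLp_Ioo_of_continuous (hc : Continuous c) (s t : ℝ) :
    MemLp c 2 (volume.restrict (Ioo s t)) := by
  rw [memLp_two_iff_integrable_sq_norm hc.aestronglyMeasurable]
  exact integrableOn_Ioo_of_continuous (by fun_prop) s t

theorem hasDerivAt_slice_fst (hψ : ContDiff ℝ ∞ ψ) (x y : ℝ) :
    HasDerivAt (fun x => ψ (x, y)) (fderiv ℝ ψ (x, y) (1, 0)) x :=
  (hψ.differentiable (by simp) (x, y)).hasFDerivAt.comp_hasDerivAt x
    ((hasDerivAt_id x).prodMk (hasDerivAt_const x y))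

theorem hasDerivAt_slice_snd (hψ : ContDiff ℝ ∞ ψ) (x y : ℝ) :
    HasDerivAt (fun y => ψ (x, y)) (fderiv ℝ ψ (x, y) (0, 1)) y :=
  (hψ.differentiable (by simp) (x, y)).hasFDerivAt.comp_hasDerivAt y
    ((hasDerivAt_const y x).prodMk (hasDerivAt_id y))

theorem hasCompactSupport_slice_fst (hs : HasCompactSupport ψ) (y : ℝ) :
    HasCompactSupport fun x => ψ (x, y) :=
  HasCompactSupport.intro (hs.isCompact.image continuous_fst) fun x hx => by
    by_contra h
    exact hx ⟨(x, y), subset_tsupport ψ h, rfl⟩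

theorem HasWeakDeriv1.mul_snd (h : HasWeakDeriv1 c d)
    (hc : ∀ r : ℝ, 0 < r → MemLp c 2 (volume.restrict (Ioo (-r) r)))
    (hd : ∀ r : ℝ, 0 < r → MemLp d 2 (volume.restrict (Ioo (-r) r)))
    (hb : Continuous b) (hC : ∀ y, |b y| ≤ C) :
    HasWeakDeriv (1, 0) (fun p => c p.1 * (b p.2 : ℂ)) (fun p => d p.1 * (b p.2 : ℂ)) := by
  have hcb := memL2Loc_mul hc hb hC
  have hdb := memL2Loc_mul hd hb hC
  refine ⟨hcb, hdb, fun ψ hψ hs _ => ?_⟩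
  have hint := (localWeight_fderiv hψ hs (1, 0)).integrableOn_mul hcb
  have hint' := (localWeight_of_hasCompactSupport hψ.continuous hs).integrableOn_mul hdb
  rw [IntegrableOn, restrict_strip] at hint hint'
  rw [restrict_strip, integral_prod_symm _ hint, integral_prod_symm _ hint', ← integral_neg]
  refine integral_congr_ae (Eventually.of_forall fun y => ?_)
  have hslice := h _ (hψ.comp (contDiff_id.prodMk contDiff_const))
    (hasCompactSupport_slice_fst hs y)
  simp only [Function.comp_def, id, (hasDerivAt_slice_fst hψ _ y).deriv] at hslice
  simp only [← mul_assoc, integral_mul_const]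
  rw [hslice, neg_mul]

theorem integral_fderiv_mul_add_mul_deriv (hψ : ContDiff ℝ ∞ ψ) (hb' : Continuous b')
    (hbd : ∀ y, HasDerivAt b (b' y) y) (x : ℝ) :
    ∫ y in Ioo (0 : ℝ) 1, (fderiv ℝ ψ (x, y) (0, 1) * b y + ψ (x, y) * b' y) =
      ψ (x, 1) * b 1 - ψ (x, 0) * b 0 := by
  have hb : Continuous b := continuous_iff_continuousAt.2 fun y => (hbd y).continuousAt
  have hψ' : Continuous fun y => fderiv ℝ ψ (x, y) (0, 1) :=
    ((hψ.continuous_fderiv (by simp)).comp (by fun_prop)).clm_apply continuous_const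
  have hψc := hψ.continuous
  rw [← integral_Ioc_eq_integral_Ioo, ← intervalIntegral.integral_of_le zero_le_one]
  exact intervalIntegral.integral_eq_sub_of_hasDerivAt (f := fun y => ψ (x, y) * b y)
    (fun y _ => (hasDerivAt_slice_snd hψ x y).mul (hbd y))
    (Continuous.intervalIntegrable (by fun_prop) _ _)

theorem integral_fderiv_snd_mul_add_eq_zero
    (hc : ∀ r : ℝ, 0 < r → MemLp c 2 (volume.restrict (Ioo (-r) r)))
    (hb' : Continuous b') (hC : ∀ y, |b y| ≤ C) (hC' : ∀ y, |b' y| ≤ C')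
    (hbd : ∀ y, HasDerivAt b (b' y) y) (hψ : ContDiff ℝ ∞ ψ) (hs : HasCompactSupport ψ)
    (h0 : ∀ x, ψ (x, 0) * b 0 = 0) (h1 : ∀ x, ψ (x, 1) * b 1 = 0) :
    (∫ p in strip, ((fderiv ℝ ψ p (0, 1) : ℝ) : ℂ) * (c p.1 * (b p.2 : ℂ))) +
      ∫ p in strip, (ψ p : ℂ) * (c p.1 * (b' p.2 : ℂ)) = 0 := by
  have hb : Continuous b := continuous_iff_continuousAt.2 fun y => (hbd y).continuousAt
  have hint := (localWeight_fderiv hψ hs (0, 1)).integrableOn_mul (memL2Loc_mul hc hb hC)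
  have hint' := (localWeight_of_hasCompactSupport hψ.continuous hs).integrableOn_mul
    (memL2Loc_mul hc hb' hC')
  have hsum := hint.add hint'
  rw [← integral_add hint hint']
  rw [IntegrableOn, restrict_strip] at hsum
  rw [restrict_strip]
  refine (integral_prod _ hsum).trans
    (integral_eq_zero_of_ae (Eventually.of_forall fun x => ?_))
  calc ∫ y in Ioo (0 : ℝ) 1, (((fderiv ℝ ψ (x, y) (0, 1) : ℝ) : ℂ) * (c x * (b y : ℂ)) +
        (ψ (x, y) : ℂ) * (c x * (b' y : ℂ)))
      = ∫ y in Ioo (0 : ℝ) 1,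
          c x * ((fderiv ℝ ψ (x, y) (0, 1) * b y + ψ (x, y) * b' y : ℝ) : ℂ) := by
        congr 1 with y
        push_cast
        ring
    _ = 0 := by
        rw [integral_const_mul, integral_complex_ofReal,
          integral_fderiv_mul_add_mul_deriv hψ hb' hbd, h0, h1, sub_zero, Complex.ofReal_zero,
          mul_zero]

theorem hasWeakDeriv_mul_snd
    (hc : ∀ r : ℝ, 0 < r → MemLp c 2 (volume.restrict (Ioo (-r) r)))
    (hb' : Continuous b') (hC : ∀ y, |b y| ≤ C) (hC' : ∀ y, |b' y| ≤ C')
    (hbd : ∀ y, HasDerivAt b (b' y) y) :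
    HasWeakDeriv (0, 1) (fun p => c p.1 * (b p.2 : ℂ)) (fun p => c p.1 * (b' p.2 : ℂ)) := by
  have hb : Continuous b := continuous_iff_continuousAt.2 fun y => (hbd y).continuousAt
  refine ⟨memL2Loc_mul hc hb hC, memL2Loc_mul hc hb' hC', fun ψ hψ hs hsupp => ?_⟩
  have hzero : ∀ x y : ℝ, y ∉ Ioo (0 : ℝ) 1 → ψ (x, y) = 0 := fun x y hy =>
    image_eq_zero_of_notMem_tsupport fun h => hy (hsupp h).2
  exact eq_neg_iff_add_eq_zero.2 <| integral_fderiv_snd_mul_add_eq_zero hc hb' hC hC' hbd hψ hs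
    (fun x => by rw [hzero x 0 (by simp), zero_mul])
    (fun x => by rw [hzero x 1 (by simp), zero_mul])

end ProductDerivatives

section SeriesDerivatives

variable {u v : ℝ × ℝ → ℂ} {c d : ℕ → ℝ → ℂ}

theorem LocalWeight.integral_sum_add_eq_zero {f g : ℝ × ℝ → ℂ} (hf : LocalWeight f)
    (hg : LocalWeight g) {S T : ℕ → ℝ × ℝ → ℂ} (hS : ∀ n, MemL2Loc (S n))
    (hT : ∀ n, MemL2Loc (T n))
    (h : ∀ n, (∫ p in strip, f p * S n p) + ∫ p in strip, g p * T n p = 0) (N : ℕ) :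
    (∫ p in strip, f p * ∑ n ∈ Finset.range N, S n p) +
      ∫ p in strip, g p * ∑ n ∈ Finset.range N, T n p = 0 := by
  simp_rw [Finset.mul_sum]
  rw [integral_finsetSum _ fun n _ => hf.integrableOn_mul (hS n),
    integral_finsetSum _ fun n _ => hg.integrableOn_mul (hT n), ← Finset.sum_add_distrib]
  exact Finset.sum_eq_zero fun n _ => h n

theorem HasWeakDeriv.of_tendsto_sum {e : ℝ × ℝ} {S T : ℕ → ℝ × ℝ → ℂ}
    (hu : TendstoL2Loc (fun N p => ∑ n ∈ Finset.range N, S n p) u)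
    (hv : TendstoL2Loc (fun N p => ∑ n ∈ Finset.range N, T n p) v)
    (h : ∀ n, HasWeakDeriv e (S n) (T n)) : HasWeakDeriv e u v :=
  HasWeakDeriv.of_tendsto hu hv fun N => ⟨hu.mem N, hv.mem N, fun ψ hψ hs hsupp =>
    eq_neg_iff_add_eq_zero.2 <| (localWeight_fderiv hψ hs e).integral_sum_add_eq_zero
      (localWeight_of_hasCompactSupport hψ.continuous hs) (fun n => (h n).1) (fun n => (h n).2.1)
      (fun n => eq_neg_iff_add_eq_zero.1 ((h n).2.2 ψ hψ hs hsupp)) N⟩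

theorem hasWeakDeriv_fst_of_series {b : ℕ → ℝ → ℝ} {C : ℝ}
    (hu : TendstoL2Loc (fun N p => ∑ n ∈ Finset.range N, c n p.1 * (b n p.2 : ℂ)) u)
    (hv : TendstoL2Loc (fun N p => ∑ n ∈ Finset.range N, d n p.1 * (b n p.2 : ℂ)) v)
    (h : ∀ n, HasWeakDeriv1 (c n) (d n))
    (hc : ∀ n, ∀ r : ℝ, 0 < r → MemLp (c n) 2 (volume.restrict (Ioo (-r) r)))
    (hd : ∀ n, ∀ r : ℝ, 0 < r → MemLp (d n) 2 (volume.restrict (Ioo (-r) r)))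
    (hb : ∀ n, Continuous (b n)) (hC : ∀ n y, |b n y| ≤ C) : HasWeakDeriv (1, 0) u v :=
  .of_tendsto_sum hu hv fun n => (h n).mul_snd (hc n) (hd n) (hb n) (hC n)

theorem abs_mul_pi_mul_le (n : ℕ) {t : ℝ} (ht : |t| ≤ Real.sqrt 2) :
    |n * Real.pi * t| ≤ n * Real.pi * Real.sqrt 2 := by
  rw [abs_mul, abs_of_nonneg (by positivity)]
  exact mul_le_mul_of_nonneg_left ht (by positivity)

theorem hasWeakDeriv_snd_of_mode_series
    (hu : TendstoL2Loc (fun N p => ∑ n ∈ Finset.range N, c n p.1 * (mode n p.2 : ℂ)) u)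
    (hv : TendstoL2Loc (fun N p => ∑ n ∈ Finset.range N,
      -(n * Real.pi) * c n p.1 * (sinMode n p.2 : ℂ)) v)
    (hc : ∀ n, ∀ r : ℝ, 0 < r → MemLp (c n) 2 (volume.restrict (Ioo (-r) r))) :
    HasWeakDeriv (0, 1) u v := by
  refine .of_tendsto_sum hu hv fun n => ?_
  convert hasWeakDeriv_mul_snd (hc n) (by fun_prop) (abs_mode_le n) (fun y => ?_)
    (hasDerivAt_mode n) using 2 with p
  · push_cast
    ring
  · exact n * Real.pi * Real.sqrt 2
  · rw [neg_mul, abs_neg]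
    exact abs_mul_pi_mul_le n (abs_sinMode_le n y)

/-- The sine modes vanish on `∂Ω`, so the test functions need not. -/
theorem integral_fderiv_snd_mul_add_eq_zero_of_sinMode_series
    (hu : TendstoL2Loc (fun N p => ∑ n ∈ Finset.range N, c n p.1 * (sinMode n p.2 : ℂ)) u)
    (hv : TendstoL2Loc (fun N p => ∑ n ∈ Finset.range N,
      (n * Real.pi) * c n p.1 * (mode n p.2 : ℂ)) v)
    (hc : ∀ n, ∀ r : ℝ, 0 < r → MemLp (c n) 2 (volume.restrict (Ioo (-r) r)))
    {ψ : ℝ × ℝ → ℝ} (hψ : ContDiff ℝ ∞ ψ) (hs : HasCompactSupport ψ) :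
    (∫ p in strip, ((fderiv ℝ ψ p (0, 1) : ℝ) : ℂ) * u p) + ∫ p in strip, (ψ p : ℂ) * v p = 0 := by
  have hterm : ∀ n (p : ℝ × ℝ), (n * Real.pi) * c n p.1 * (mode n p.2 : ℂ) =
      c n p.1 * ((n * Real.pi * mode n p.2 : ℝ) : ℂ) := fun n p => by
    push_cast
    ring
  simp_rw [hterm] at hv
  have hbound := fun n y => abs_mul_pi_mul_le n (abs_mode_le n y)
  have hψ' := localWeight_fderiv hψ hs (0, 1)
  have hψ0 := localWeight_of_hasCompactSupport hψ.continuous hs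
  exact hu.integral_add_eq_zero hv hψ' hψ0 <| hψ'.integral_sum_add_eq_zero hψ0
    (fun n => memL2Loc_mul (hc n) (continuous_sinMode n) (abs_sinMode_le n))
    (fun n => memL2Loc_mul (hc n) (by fun_prop) (hbound n))
    fun n => integral_fderiv_snd_mul_add_eq_zero (hc n) (by fun_prop) (abs_sinMode_le n)
      (hbound n) (hasDerivAt_sinMode n) hψ hs (fun x => by rw [sinMode_zero, mul_zero])
      (fun x => by rw [sinMode_one, mul_zero])

theorem hasWeakDeriv_snd_of_sinMode_series
    (hu : TendstoL2Loc (fun N p => ∑ n ∈ Finset.range N, c n p.1 * (sinMode n p.2 : ℂ)) u)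
    (hv : TendstoL2Loc (fun N p => ∑ n ∈ Finset.range N,
      (n * Real.pi) * c n p.1 * (mode n p.2 : ℂ)) v)
    (hc : ∀ n, ∀ r : ℝ, 0 < r → MemLp (c n) 2 (volume.restrict (Ioo (-r) r))) :
    HasWeakDeriv (0, 1) u v :=
  ⟨hu.mem_lim, hv.mem_lim, fun _ hψ hs _ => eq_neg_iff_add_eq_zero.2 <|
    integral_fderiv_snd_mul_add_eq_zero_of_sinMode_series hu hv hc hψ hs⟩

end SeriesDerivatives

section Existence

variable {k : ℝ} {s u : ℝ × ℝ → ℂ}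

theorem continuous_modalSolution (hκ : ∀ n, waveNumber k n ≠ 0) (hs : IntegrableOn s strip)
    (n : ℕ) : Continuous (modalSolution k s n) :=
  continuous_outgoingSol (hκ n) (waveNumber_im_nonneg k n) (integrable_modalCoeff hs n)

theorem continuous_modalSolutionDeriv (hs : IntegrableOn s strip) (n : ℕ) :
    Continuous (modalSolutionDeriv k s n) :=
  continuous_outgoingSolDeriv (waveNumber_im_nonneg k n) (integrable_modalCoeff hs n)

theorem hasWeakDeriv1_modalSolution (hκ : ∀ n, waveNumber k n ≠ 0) (hs : IntegrableOn s strip)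
    (a : ℂ) (n : ℕ) :
    HasWeakDeriv1 (fun x => a * modalSolution k s n x) fun x => a * modalSolutionDeriv k s n x :=
  hasWeakDeriv1_of_hasDerivAt (fun x => (hasDerivAt_outgoingSol (hκ n) (waveNumber_im_nonneg k n)
    (integrable_modalCoeff hs n) x).const_mul a)
    ((continuous_modalSolutionDeriv hs n).const_mul a)

theorem memLp_mul_modalSolution (hκ : ∀ n, waveNumber k n ≠ 0) (hs : IntegrableOn s strip)
    (a : ℂ) (n : ℕ) (r : ℝ) :
    MemLp (fun x => a * modalSolution k s n x) 2 (volume.restrict (Ioo (-r) r)) :=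
  memLp_Ioo_of_continuous ((continuous_modalSolution hκ hs n).const_mul a) _ _

theorem memLp_mul_modalSolutionDeriv (hs : IntegrableOn s strip) (a : ℂ) (n : ℕ) (r : ℝ) :
    MemLp (fun x => a * modalSolutionDeriv k s n x) 2 (volume.restrict (Ioo (-r) r)) :=
  memLp_Ioo_of_continuous ((continuous_modalSolutionDeriv hs n).const_mul a) _ _

theorem exists_tendstoL2Loc_modalSolution_mode (hκ : ∀ n, waveNumber k n ≠ 0)
    (hs1 : IntegrableOn s strip) (hs2 : MemL2Loc s) {a : ℕ → ℂ} {C : ℝ}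
    (ha : ∀ n : ℕ, 1 ≤ n → ‖a n‖ ≤ C * n ^ 2) :
    ∃ w, TendstoL2Loc
      (fun N p => ∑ n ∈ Finset.range N, a n * modalSolution k s n p.1 * (mode n p.2 : ℂ)) w :=
  exists_tendstoL2Loc_mode_series (c := fun n x => a n * modalSolution k s n x)
    (fun n r _ => memLp_mul_modalSolution hκ hs1 (a n) n r)
    fun _ hr => summable_modalSolution hs1 hs2 ha hr

theorem exists_tendstoL2Loc_modalSolution_sinMode (hκ : ∀ n, waveNumber k n ≠ 0)
    (hs1 : IntegrableOn s strip) (hs2 : MemL2Loc s) {a : ℕ → ℂ} {C : ℝ}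
    (ha : ∀ n : ℕ, 1 ≤ n → ‖a n‖ ≤ C * n ^ 2) :
    ∃ w, TendstoL2Loc
      (fun N p => ∑ n ∈ Finset.range N, a n * modalSolution k s n p.1 * (sinMode n p.2 : ℂ)) w :=
  exists_tendstoL2Loc_sinMode_series (c := fun n x => a n * modalSolution k s n x)
    (fun n r _ => memLp_mul_modalSolution hκ hs1 (a n) n r)
    fun _ hr => summable_modalSolution hs1 hs2 ha hr

theorem exists_tendstoL2Loc_modalSolutionDeriv_mode (hs1 : IntegrableOn s strip)
    (hs2 : MemL2Loc s) {a : ℕ → ℂ} {C : ℝ} (ha : ∀ n : ℕ, 1 ≤ n → ‖a n‖ ≤ C * n) :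
    ∃ w, TendstoL2Loc
      (fun N p => ∑ n ∈ Finset.range N, a n * modalSolutionDeriv k s n p.1 * (mode n p.2 : ℂ)) w :=
  exists_tendstoL2Loc_mode_series (c := fun n x => a n * modalSolutionDeriv k s n x)
    (fun n r _ => memLp_mul_modalSolutionDeriv hs1 (a n) n r)
    fun _ hr => summable_modalSolutionDeriv hs1 hs2 ha hr

theorem exists_tendstoL2Loc_modalSolutionDeriv_sinMode (hs1 : IntegrableOn s strip)
    (hs2 : MemL2Loc s) {a : ℕ → ℂ} {C : ℝ} (ha : ∀ n : ℕ, 1 ≤ n → ‖a n‖ ≤ C * n) :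
    ∃ w, TendstoL2Loc (fun N p =>
      ∑ n ∈ Finset.range N, a n * modalSolutionDeriv k s n p.1 * (sinMode n p.2 : ℂ)) w :=
  exists_tendstoL2Loc_sinMode_series (c := fun n x => a n * modalSolutionDeriv k s n x)
    (fun n r _ => memLp_mul_modalSolutionDeriv hs1 (a n) n r)
    fun _ hr => summable_modalSolutionDeriv hs1 hs2 ha hr

/-- The modal series of `u` and those of the derivatives of `u` obtained by differentiating it
term by term, with their `L²_loc` sums. The series of `∂²u/∂x²` is left out: by the modal
equations it is a linear combination of the series of `u`, `∂²u/∂y²` and `s`. -/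
structure IsModalSum (k : ℝ) (s u ux uy uxy uyy : ℝ × ℝ → ℂ) : Prop where
  tendsto : TendstoL2Loc
    (fun N p => ∑ n ∈ Finset.range N, modalSolution k s n p.1 * (mode n p.2 : ℂ)) u
  tendsto_x : TendstoL2Loc
    (fun N p => ∑ n ∈ Finset.range N, modalSolutionDeriv k s n p.1 * (mode n p.2 : ℂ)) ux
  tendsto_y : TendstoL2Loc (fun N p => ∑ n ∈ Finset.range N,
    -(n * Real.pi) * modalSolution k s n p.1 * (sinMode n p.2 : ℂ)) uy
  tendsto_xy : TendstoL2Loc (fun N p => ∑ n ∈ Finset.range N,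
    -(n * Real.pi) * modalSolutionDeriv k s n p.1 * (sinMode n p.2 : ℂ)) uxy
  tendsto_yy : TendstoL2Loc (fun N p => ∑ n ∈ Finset.range N,
    n * Real.pi * (-(n * Real.pi) * modalSolution k s n p.1) * (mode n p.2 : ℂ)) uyy

theorem exists_isModalSum (hκ : ∀ n, waveNumber k n ≠ 0) (hs1 : IntegrableOn s strip)
    (hs2 : MemL2Loc s) : ∃ u ux uy uxy uyy, IsModalSum k s u ux uy uxy uyy := by
  have hπ : ∀ n : ℕ, ‖-((n : ℂ) * Real.pi)‖ = Real.pi * n := fun n => by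
    rw [norm_neg, norm_mul, Complex.norm_natCast, Complex.norm_of_nonneg Real.pi_pos.le, mul_comm]
  have hcast : ∀ n : ℕ, 1 ≤ n → (1 : ℝ) ≤ n := fun n hn => by exact_mod_cast hn
  obtain ⟨u, hu⟩ := exists_tendstoL2Loc_modalSolution_mode hκ hs1 hs2 (a := 1) (C := 1)
    fun n hn => by simpa using one_le_pow₀ (n := 2) (hcast n hn)
  obtain ⟨ux, hux⟩ := exists_tendstoL2Loc_modalSolutionDeriv_mode (k := k) hs1 hs2 (a := 1)
    (C := 1) fun n hn => by simpa using hn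
  obtain ⟨uy, huy⟩ := exists_tendstoL2Loc_modalSolution_sinMode hκ hs1 hs2 fun n hn =>
    (hπ n).trans_le (mul_le_mul_of_nonneg_left (le_self_pow₀ (hcast n hn) two_ne_zero)
      Real.pi_pos.le)
  obtain ⟨uxy, huxy⟩ := exists_tendstoL2Loc_modalSolutionDeriv_sinMode (k := k) hs1 hs2
    fun n _ => (hπ n).le
  obtain ⟨uyy, huyy⟩ := exists_tendstoL2Loc_modalSolution_mode hκ hs1 hs2
    (a := fun n => n * Real.pi * -(n * Real.pi)) (C := Real.pi ^ 2) fun n _ => by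
      rw [norm_mul, ← norm_neg, hπ, ← mul_pow, sq]
  simp only [Pi.one_apply, one_mul] at hu hux
  simp only [mul_assoc (_ * _)] at huyy
  exact ⟨u, ux, uy, uxy, uyy, hu, hux, huy, huxy, by simpa only [mul_assoc] using huyy⟩

namespace IsModalSum

variable {ux uy uxy uyy : ℝ × ℝ → ℂ}

theorem hasWeakDeriv_fst (h : IsModalSum k s u ux uy uxy uyy) (hκ : ∀ n, waveNumber k n ≠ 0)
    (hs1 : IntegrableOn s strip) : HasWeakDeriv (1, 0) u ux :=
  hasWeakDeriv_fst_of_series h.tendsto h.tendsto_x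
    (fun n => by simpa only [one_mul] using hasWeakDeriv1_modalSolution hκ hs1 1 n)
    (fun n r _ => by simpa only [one_mul] using memLp_mul_modalSolution hκ hs1 1 n r)
    (fun n r _ => by simpa only [one_mul] using memLp_mul_modalSolutionDeriv hs1 1 n r)
    continuous_mode abs_mode_le

theorem hasWeakDeriv_snd (h : IsModalSum k s u ux uy uxy uyy) (hκ : ∀ n, waveNumber k n ≠ 0)
    (hs1 : IntegrableOn s strip) : HasWeakDeriv (0, 1) u uy :=
  hasWeakDeriv_snd_of_mode_series h.tendsto h.tendsto_y
    fun n r _ => by simpa only [one_mul] using memLp_mul_modalSolution hκ hs1 1 n r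

theorem hasWeakDeriv_fst_snd (h : IsModalSum k s u ux uy uxy uyy) (hs1 : IntegrableOn s strip) :
    HasWeakDeriv (0, 1) ux uxy :=
  hasWeakDeriv_snd_of_mode_series h.tendsto_x h.tendsto_xy
    fun n r _ => by simpa only [one_mul] using memLp_mul_modalSolutionDeriv hs1 1 n r

theorem hasWeakDeriv_snd_fst (h : IsModalSum k s u ux uy uxy uyy)
    (hκ : ∀ n, waveNumber k n ≠ 0) (hs1 : IntegrableOn s strip) : HasWeakDeriv (1, 0) uy uxy :=
  hasWeakDeriv_fst_of_series (c := fun n x => -(n * Real.pi) * modalSolution k s n x)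
    (d := fun n x => -(n * Real.pi) * modalSolutionDeriv k s n x) h.tendsto_y h.tendsto_xy
    (fun n => hasWeakDeriv1_modalSolution hκ hs1 _ n)
    (fun n r _ => memLp_mul_modalSolution hκ hs1 _ n r)
    (fun n r _ => memLp_mul_modalSolutionDeriv hs1 _ n r) continuous_sinMode abs_sinMode_le

theorem hasWeakDeriv_snd_snd (h : IsModalSum k s u ux uy uxy uyy)
    (hκ : ∀ n, waveNumber k n ≠ 0) (hs1 : IntegrableOn s strip) : HasWeakDeriv (0, 1) uy uyy :=
  hasWeakDeriv_snd_of_sinMode_series (c := fun n x => -(n * Real.pi) * modalSolution k s n x)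
    h.tendsto_y h.tendsto_yy fun n r _ => memLp_mul_modalSolution hκ hs1 _ n r

theorem tendsto_xx (h : IsModalSum k s u ux uy uxy uyy) (hs2 : MemL2Loc s) :
    TendstoL2Loc (fun N p => ∑ n ∈ Finset.range N,
      (-waveNumber k n ^ 2 * modalSolution k s n p.1 - modalCoeff s n p.1) * (mode n p.2 : ℂ))
      fun p => -1 * s p + -(k : ℂ) ^ 2 * u p + -1 * uyy p := by
  convert ((hs2.tendstoL2Loc_modalExpansion.const_mul (-1)).add
    (h.tendsto.const_mul (-(k : ℂ) ^ 2))).add (h.tendsto_yy.const_mul (-1)) using 3 with N p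
  simp_rw [Finset.mul_sum, ← Finset.sum_add_distrib]
  refine Finset.sum_congr rfl fun n _ => ?_
  rw [waveNumber_sq]
  ring

theorem hasWeakDeriv_fst_fst (h : IsModalSum k s u ux uy uxy uyy)
    (hκ : ∀ n, waveNumber k n ≠ 0) (hs1 : IntegrableOn s strip) (hs2 : MemL2Loc s) :
    HasWeakDeriv (1, 0) ux fun p => -1 * s p + -(k : ℂ) ^ 2 * u p + -1 * uyy p :=
  hasWeakDeriv_fst_of_series h.tendsto_x (h.tendsto_xx hs2)
    (fun n => hasWeakDeriv1_outgoingSolDeriv (hκ n) (waveNumber_im_nonneg k n)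
      (integrable_modalCoeff hs1 n))
    (fun n r _ => by simpa only [one_mul] using memLp_mul_modalSolutionDeriv hs1 1 n r)
    (fun n r hr => (memLp_mul_modalSolution hκ hs1 _ n r).sub (hs2.memLp_modalCoeff n hr))
    continuous_mode abs_mode_le

theorem neumannZero (h : IsModalSum k s u ux uy uxy uyy) (hκ : ∀ n, waveNumber k n ≠ 0)
    (hs1 : IntegrableOn s strip) : NeumannZero u := by
  refine ⟨uy, h.hasWeakDeriv_snd hκ hs1, locallyIntegrable_zero, locallyIntegrable_zero, uyy,
    h.hasWeakDeriv_snd_snd hκ hs1, fun ψ hψ hs => ?_⟩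
  rw [integral_fderiv_snd_mul_add_eq_zero_of_sinMode_series
    (c := fun n x => -(n * Real.pi) * modalSolution k s n x) h.tendsto_y h.tendsto_yy
    (fun n r _ => memLp_mul_modalSolution hκ hs1 _ n r) hψ hs]
  simp only [Pi.zero_apply, mul_zero, integral_zero, sub_zero]

theorem modalCoeff_ae_eq (h : IsModalSum k s u ux uy uxy uyy) (hκ : ∀ n, waveNumber k n ≠ 0)
    (hs1 : IntegrableOn s strip) (n : ℕ) : ∀ᵐ x : ℝ, modalCoeff u n x = modalSolution k s n x := by
  refine h.tendsto.modalCoeff_ae_eq n (continuous_modalSolution hκ hs1 n).locallyIntegrable ?_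
  filter_upwards [eventually_gt_atTop n] with N hN x
  exact modalCoeff_sum_mode _ hN x

theorem outgoing (h : IsModalSum k s u ux uy uxy uyy) (hκ : ∀ n, waveNumber k n ≠ 0)
    (hs1 : IntegrableOn s strip) : Outgoing k u := fun n => by
  have him := waveNumber_im_nonneg k n
  have hg := integrable_modalCoeff hs1 n
  refine ⟨modalSolution k s n, contDiff_outgoingSol (hκ n) him hg, h.modalCoeff_ae_eq hκ hs1 n,
    (tendsto_radiation_outgoingSol (hκ n) him hg).congr fun x => ?_⟩
  rw [modalSolution_eq_outgoingSol, deriv_outgoingSol (hκ n) him hg]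

theorem isSolution (h : IsModalSum k s u ux uy uxy uyy) (hκ : ∀ n, waveNumber k n ≠ 0)
    (hs1 : IntegrableOn s strip) (hs2 : MemL2Loc s) : IsSolution k s u where
  memH2Loc := ⟨ux, uy, h.hasWeakDeriv_fst hκ hs1, h.hasWeakDeriv_snd hκ hs1,
    ⟨_, uxy, h.hasWeakDeriv_fst_fst hκ hs1 hs2, h.hasWeakDeriv_fst_snd hs1⟩,
    ⟨uxy, uyy, h.hasWeakDeriv_snd_fst hκ hs1, h.hasWeakDeriv_snd_snd hκ hs1⟩⟩
  helmholtz := ⟨ux, uy, _, uyy, h.hasWeakDeriv_fst hκ hs1, h.hasWeakDeriv_snd hκ hs1,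
    h.hasWeakDeriv_fst_fst hκ hs1 hs2, h.hasWeakDeriv_snd_snd hκ hs1,
    Eventually.of_forall fun p => by ring⟩
  neumann := h.neumannZero hκ hs1
  outgoing := h.outgoing hκ hs1

end IsModalSum

/-- By Cauchy–Schwarz, `∑ ‖a n‖ ≤ (∑ n⁻⁴)^{1/2} (∑ ‖n² a n‖²)^{1/2}`. -/
theorem summable_norm_of_summable_norm_sq {a : ℕ → ℂ}
    (h : Summable fun n : ℕ => ‖(n : ℂ) ^ 2 * a n‖ ^ 2) : Summable fun n => ‖a n‖ := by
  have hp : Summable fun n : ℕ => ((n : ℝ) ^ 2)⁻¹ ^ 2 := by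
    simpa only [inv_pow, ← pow_mul] using
      Real.summable_nat_pow_inv.2 (show 1 < 2 * 2 by norm_num)
  refine (hp.add h).of_norm_bounded_eventually_nat ?_
  filter_upwards [eventually_ge_atTop 1] with n hn
  have hn0 : (n : ℝ) ^ 2 ≠ 0 := by positivity
  rw [norm_norm, norm_mul, norm_pow, Complex.norm_natCast]
  calc ‖a n‖ = ((n : ℝ) ^ 2)⁻¹ * ((n : ℝ) ^ 2 * ‖a n‖) := (inv_mul_cancel_left₀ hn0 _).symm
    _ ≤ 2 * ((n : ℝ) ^ 2)⁻¹ * ((n : ℝ) ^ 2 * ‖a n‖) := by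
        rw [mul_assoc]
        exact le_mul_of_one_le_left (by positivity) one_le_two
    _ ≤ ((n : ℝ) ^ 2)⁻¹ ^ 2 + ((n : ℝ) ^ 2 * ‖a n‖) ^ 2 := two_mul_le_add_sq _ _

theorem ae_summable_norm_modalSolution (hκ : ∀ n, waveNumber k n ≠ 0)
    (hs1 : IntegrableOn s strip) (hs2 : MemL2Loc s) :
    ∀ᵐ x : ℝ, Summable fun n => ‖modalSolution k s n x‖ := by
  refine ae_real_iff.2 fun r hr => ?_
  have hsum := summable_modalSolution (k := k) (a := fun n => (n : ℂ) ^ 2) (C := 1) hs1 hs2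
    (fun n _ => by rw [norm_pow, Complex.norm_natCast, one_mul]) hr
  have hint : ∀ n : ℕ, IntegrableOn (fun x => ‖(n : ℂ) ^ 2 * modalSolution k s n x‖ ^ 2)
      (Ioo (-r) r) := fun n => integrableOn_Ioo_of_continuous
    (((continuous_modalSolution hκ hs1 n).const_mul _).norm.pow 2) _ _
  filter_upwards [ae_summable_of_summable_integral hint (fun n x => sq_nonneg _) hsum] with x hx
  exact summable_norm_of_summable_norm_sq hx

theorem ae_hasSum_modalSolution (hκ : ∀ n, waveNumber k n ≠ 0) (hs1 : IntegrableOn s strip)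
    (hs2 : MemL2Loc s) (hu : TendstoL2Loc
      (fun N p => ∑ n ∈ Finset.range N, modalSolution k s n p.1 * (mode n p.2 : ℂ)) u) :
    ∀ᵐ p ∂(volume.restrict strip),
      HasSum (fun n : ℕ => modalSolution k s n p.1 * (mode n p.2 : ℂ)) (u p) := by
  have hsum : ∀ᵐ p ∂(volume.restrict strip),
      Summable fun n : ℕ => modalSolution k s n p.1 * (mode n p.2 : ℂ) := by
    filter_upwards [ae_strip_of_ae_fst (ae_summable_norm_modalSolution hκ hs1 hs2)] with p hp
    refine (hp.mul_right (Real.sqrt 2)).of_norm_bounded fun n => ?_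
    rw [norm_mul, Complex.norm_real]
    exact mul_le_mul_of_nonneg_left (abs_mode_le n _) (norm_nonneg _)
  have hlim := hu.ae_eq_of_tendsto (hsum.mono fun p hp => hp.hasSum.tendsto_sum_nat)
  filter_upwards [hsum, hlim] with p hp hpu
  exact hpu ▸ hp.hasSum

end Existence

section Cutoff

@[fun_prop]
theorem continuous_deriv_smoothTransition : Continuous (deriv Real.smoothTransition) :=
  (Real.smoothTransition.contDiff (n := 1)).continuous_deriv le_rfl

theorem deriv_smoothTransition_of_notMem_Icc {t : ℝ} (ht : t ∉ Icc (0 : ℝ) 1) :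
    deriv Real.smoothTransition t = 0 := by
  rw [mem_Icc, not_and_or, not_le, not_le] at ht
  rcases ht with ht | ht
  · have hzero : Real.smoothTransition =ᶠ[𝓝 t] fun _ => 0 := by
      filter_upwards [Iio_mem_nhds ht] with s hs
      exact Real.smoothTransition.zero_of_nonpos hs.le
    rw [hzero.deriv_eq, deriv_const]
  · have hone : Real.smoothTransition =ᶠ[𝓝 t] fun _ => 1 := by
      filter_upwards [Ioi_mem_nhds ht] with s hs
      exact Real.smoothTransition.one_of_one_le hs.le
    rw [hone.deriv_eq, deriv_const]

theorem exists_bound_mul_deriv_smoothTransition :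
    ∃ M : ℝ, ∀ t : ℝ, |t * deriv Real.smoothTransition (t - 1)| ≤ M := by
  have hsupp : HasCompactSupport fun t : ℝ => t * deriv Real.smoothTransition (t - 1) := by
    refine HasCompactSupport.intro (isCompact_Icc (a := (1 : ℝ)) (b := 2)) fun t ht => ?_
    rw [deriv_smoothTransition_of_notMem_Icc fun h => ht ⟨?_, ?_⟩, mul_zero] <;>
      linarith [h.1, h.2]
  exact hsupp.exists_bound_of_continuous (by fun_prop)

/-- Smooth cutoffs vanishing near `y = 0` and `y = 1` that increase to `1` on `(0,1)`. As they
are functions of `j y (1 - y)`, their derivatives are `O(1 / (y (1 - y)))` uniformly in `j`. -/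
noncomputable def cutoff (j : ℕ) (y : ℝ) : ℝ := Real.smoothTransition (j * (y * (1 - y)) - 1)

theorem contDiff_cutoff (j : ℕ) : ContDiff ℝ ∞ (cutoff j) :=
  Real.smoothTransition.contDiff.comp (by fun_prop)

@[fun_prop]
theorem continuous_cutoff (j : ℕ) : Continuous (cutoff j) := (contDiff_cutoff j).continuous

@[fun_prop]
theorem continuous_deriv_cutoff (j : ℕ) : Continuous (deriv (cutoff j)) :=
  (contDiff_cutoff j).continuous_deriv (by simp)

theorem abs_cutoff_le_one (j : ℕ) (y : ℝ) : |cutoff j y| ≤ 1 :=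
  (abs_of_nonneg (Real.smoothTransition.nonneg _)).trans_le (Real.smoothTransition.le_one _)

theorem deriv_cutoff (j : ℕ) (y : ℝ) : deriv (cutoff j) y =
    deriv Real.smoothTransition (j * (y * (1 - y)) - 1) * (j * (1 - 2 * y)) := by
  have hinner : HasDerivAt (fun y : ℝ => j * (y * (1 - y)) - 1) (j * (1 - 2 * y)) y :=
    ((((hasDerivAt_id y).mul ((hasDerivAt_id y).const_sub 1)).const_mul (j : ℝ)).sub_const
      1).congr_deriv (by simp only [id]; ring)
  exact ((Real.smoothTransition.contDiff (n := 1)).differentiable (by simp)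
    _).hasDerivAt.comp y hinner |>.deriv

theorem exists_bound_mul_deriv_cutoff :
    ∃ M : ℝ, ∀ (j : ℕ), ∀ y ∈ Ioo (0 : ℝ) 1, |deriv (cutoff j) y| * (y * (1 - y)) ≤ M := by
  obtain ⟨M, hM⟩ := exists_bound_mul_deriv_smoothTransition
  refine ⟨M, fun j y hy => ?_⟩
  have hy' : 0 ≤ y * (1 - y) := mul_nonneg hy.1.le (sub_nonneg.2 hy.2.le)
  have hle : |1 - 2 * y| ≤ 1 := abs_le.2 ⟨by linarith [hy.2], by linarith [hy.1]⟩
  calc |deriv (cutoff j) y| * (y * (1 - y))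
      = |j * (y * (1 - y)) * deriv Real.smoothTransition (j * (y * (1 - y)) - 1)| *
          |1 - 2 * y| := by
        rw [deriv_cutoff, ← abs_of_nonneg hy', ← abs_mul, ← abs_mul, abs_of_nonneg hy']
        ring_nf
    _ ≤ |j * (y * (1 - y)) * deriv Real.smoothTransition (j * (y * (1 - y)) - 1)| :=
        mul_le_of_le_one_right (abs_nonneg _) hle
    _ ≤ M := hM _

theorem eventually_cutoff {y : ℝ} (hy : y ∈ Ioo (0 : ℝ) 1) :
    ∀ᶠ j : ℕ in atTop, cutoff j y = 1 ∧ deriv (cutoff j) y = 0 := by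
  have hlim : Tendsto (fun j : ℕ => (j : ℝ) * (y * (1 - y))) atTop atTop :=
    tendsto_natCast_atTop_atTop.atTop_mul_const (mul_pos hy.1 (sub_pos.2 hy.2))
  filter_upwards [hlim.eventually_gt_atTop 2] with j hj
  refine ⟨Real.smoothTransition.one_of_one_le (by linarith), ?_⟩
  rw [deriv_cutoff, deriv_smoothTransition_of_notMem_Icc fun h => by linarith [h.2], zero_mul]

theorem tsupport_mul_cutoff_subset (ψ : ℝ × ℝ → ℝ) (j : ℕ) :
    tsupport (fun p => ψ p * cutoff j p.2) ⊆ strip := by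
  have hclosed : IsClosed {p : ℝ × ℝ | 1 ≤ (j : ℝ) * (p.2 * (1 - p.2))} :=
    isClosed_le (by fun_prop) (by fun_prop)
  refine (closure_minimal (fun p hp => ?_) hclosed).trans fun p hp => ⟨trivial, ?_⟩
  · contrapose! hp
    have hp' : (j : ℝ) * (p.2 * (1 - p.2)) - 1 ≤ 0 := by
      rw [mem_ofPred_eq, not_le] at hp
      linarith
    rw [Function.mem_support, not_not, cutoff, Real.smoothTransition.zero_of_nonpos hp', mul_zero]
  · have hpos : 0 < p.2 * (1 - p.2) :=
      pos_of_mul_pos_right (zero_lt_one.trans_le hp) (Nat.cast_nonneg j)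
    rcases mul_pos_iff.1 hpos with h | h
    · exact ⟨h.1, sub_pos.1 h.2⟩
    · linarith [h.1, h.2]

theorem fderiv_mul_cutoff {ψ : ℝ × ℝ → ℝ} (hψ : ContDiff ℝ ∞ ψ) (j : ℕ) (p e : ℝ × ℝ) :
    fderiv ℝ (fun p => ψ p * cutoff j p.2) p e =
      cutoff j p.2 * fderiv ℝ ψ p e + deriv (cutoff j) p.2 * (e.2 * ψ p) := by
  have hcut := (((contDiff_cutoff j).differentiable (by simp)) p.2).hasDerivAt.comp_hasFDerivAt p
    (hasFDerivAt_snd (p := p) (𝕜 := ℝ))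
  have hprod : fderiv ℝ (fun p => ψ p * cutoff j p.2) p = _ :=
    (((hψ.differentiable (by simp)) p).hasFDerivAt.mul hcut).fderiv
  rw [hprod]
  simp only [add_apply, smul_apply, smul_eq_mul,
    ContinuousLinearMap.coe_snd', Function.comp_apply]
  ring

theorem tendsto_integral_cutoff_mul {f : ℝ × ℝ → ℂ} (hf : IntegrableOn f strip) :
    Tendsto (fun j => ∫ p in strip, (cutoff j p.2 : ℂ) * f p) atTop (𝓝 (∫ p in strip, f p)) := by
  refine tendsto_integral_of_dominated_convergence (fun p => ‖f p‖)
    (fun j => (by fun_prop : Continuous fun p : ℝ × ℝ =>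
      (cutoff j p.2 : ℂ)).aestronglyMeasurable.mul hf.aestronglyMeasurable) hf.norm
    (fun j => Eventually.of_forall fun p => ?_) ?_
  · rw [norm_mul, Complex.norm_real]
    exact mul_le_of_le_one_left (norm_nonneg _) (abs_cutoff_le_one j p.2)
  · filter_upwards [ae_restrict_mem isOpen_strip.measurableSet] with p hp
    refine tendsto_const_nhds.congr' ?_
    filter_upwards [eventually_cutoff hp.2] with j hj
    rw [hj.1, Complex.ofReal_one, one_mul]

theorem tendsto_integral_deriv_cutoff_mul {f g : ℝ × ℝ → ℂ}
    (hf : AEStronglyMeasurable f (volume.restrict strip)) (hg : IntegrableOn g strip)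
    (hfg : ∀ p ∈ strip, ‖f p‖ ≤ p.2 * (1 - p.2) * ‖g p‖) :
    Tendsto (fun j => ∫ p in strip, ((deriv (cutoff j) p.2 : ℝ) : ℂ) * f p) atTop (𝓝 0) := by
  obtain ⟨M, hM⟩ := exists_bound_mul_deriv_cutoff
  have hstrip : ∀ᵐ p ∂(volume.restrict strip), p ∈ strip :=
    ae_restrict_mem isOpen_strip.measurableSet
  rw [← integral_zero (ℝ × ℝ) ℂ (μ := volume.restrict strip)]
  refine tendsto_integral_of_dominated_convergence (fun p => M * ‖g p‖)
    (fun j => (by fun_prop : Continuous fun p : ℝ × ℝ =>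
      ((deriv (cutoff j) p.2 : ℝ) : ℂ)).aestronglyMeasurable.mul hf) (hg.norm.const_mul M)
    (fun j => ?_) ?_
  · filter_upwards [hstrip] with p hp
    calc ‖((deriv (cutoff j) p.2 : ℝ) : ℂ) * f p‖
        ≤ |deriv (cutoff j) p.2| * (p.2 * (1 - p.2) * ‖g p‖) := by
          rw [norm_mul, Complex.norm_real]
          exact mul_le_mul_of_nonneg_left (hfg p hp) (norm_nonneg _)
      _ = |deriv (cutoff j) p.2| * (p.2 * (1 - p.2)) * ‖g p‖ := (mul_assoc _ _ _).symm
      _ ≤ M * ‖g p‖ := mul_le_mul_of_nonneg_right (hM j p.2 hp.2) (norm_nonneg _)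
  · filter_upwards [hstrip] with p hp
    refine tendsto_const_nhds.congr' ?_
    filter_upwards [eventually_cutoff hp.2] with j hj
    rw [hj.2, Complex.ofReal_zero, zero_mul]

theorem HasWeakDeriv.integral_cutoff {e : ℝ × ℝ} {u v : ℝ × ℝ → ℂ} (h : HasWeakDeriv e u v)
    {ψ : ℝ × ℝ → ℝ} (hψ : ContDiff ℝ ∞ ψ) (hs : HasCompactSupport ψ) (j : ℕ) :
    (∫ p in strip, (cutoff j p.2 : ℂ) * (((fderiv ℝ ψ p e : ℝ) : ℂ) * u p)) +
        ∫ p in strip, ((deriv (cutoff j) p.2 : ℝ) : ℂ) * (((e.2 * ψ p : ℝ) : ℂ) * u p) =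
      -∫ p in strip, (cutoff j p.2 : ℂ) * ((ψ p : ℂ) * v p) := by
  have htest := h.2.2 (fun p => ψ p * cutoff j p.2)
    (hψ.mul ((contDiff_cutoff j).comp contDiff_snd)) hs.mul_right (tsupport_mul_cutoff_subset ψ j)
  have hψ' := (hψ.continuous_fderiv (by simp)).clm_apply (continuous_const (y := e))
  have hweight : LocalWeight fun p => ((cutoff j p.2 * fderiv ℝ ψ p e : ℝ) : ℂ) :=
    localWeight_of_hasCompactSupport (by fun_prop) (hs.fderiv_apply (𝕜 := ℝ) e).mul_left
  have hweight' : LocalWeight fun p => ((deriv (cutoff j) p.2 * (e.2 * ψ p) : ℝ) : ℂ) := by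
    have hψc := hψ.continuous
    exact localWeight_of_hasCompactSupport (by fun_prop) hs.mul_left.mul_left
  simp_rw [fderiv_mul_cutoff hψ, Complex.ofReal_add, add_mul] at htest
  rw [integral_add (hweight.integrableOn_mul h.1) (hweight'.integrableOn_mul h.1)] at htest
  simpa only [Complex.ofReal_mul, mul_assoc, mul_left_comm] using htest

/-- Test functions need not vanish near `∂Ω` when their component normal to `∂Ω` vanishes
linearly there: the derivative of the cutoff is then absorbed by the test function. -/
theorem HasWeakDeriv.integral_by_parts {e : ℝ × ℝ} {u v : ℝ × ℝ → ℂ} (h : HasWeakDeriv e u v)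
    {ψ : ℝ × ℝ → ℝ} (hψ : ContDiff ℝ ∞ ψ) (hs : HasCompactSupport ψ) {η : ℝ × ℝ → ℂ}
    (hη : LocalWeight η) (hb : ∀ p ∈ strip, |e.2 * ψ p| ≤ p.2 * (1 - p.2) * ‖η p‖) :
    ∫ p in strip, ((fderiv ℝ ψ p e : ℝ) : ℂ) * u p = -∫ p in strip, (ψ p : ℂ) * v p := by
  have hψc := hψ.continuous
  have hleft := tendsto_integral_cutoff_mul ((localWeight_fderiv hψ hs e).integrableOn_mul h.1)
  have hright := tendsto_integral_cutoff_mul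
    ((localWeight_of_hasCompactSupport hψc hs).integrableOn_mul h.2.1)
  have hboundary := tendsto_integral_deriv_cutoff_mul
    (f := fun p => ((e.2 * ψ p : ℝ) : ℂ) * u p)
    ((by fun_prop : Continuous fun p => ((e.2 * ψ p : ℝ) : ℂ)).aestronglyMeasurable.mul
      h.1.aestronglyMeasurable) (hη.integrableOn_mul h.1) fun p hp => by
        rw [norm_mul, norm_mul, Complex.norm_real, ← mul_assoc]
        exact mul_le_mul_of_nonneg_right (hb p hp) (norm_nonneg _)
  have hsum := hleft.add hboundary
  simp only [h.integral_cutoff hψ hs, add_zero] at hsum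
  exact tendsto_nhds_unique hsum hright.neg

end Cutoff

section ProductTests

variable {χ b : ℝ → ℝ} {e : ℝ × ℝ} {u v : ℝ × ℝ → ℂ}

theorem exists_hasCompactSupport_eqOn_Ioo (hb : ContDiff ℝ ∞ b) :
    ∃ b₀ : ℝ → ℝ, ContDiff ℝ ∞ b₀ ∧ HasCompactSupport b₀ ∧ EqOn b₀ b (Ioo 0 1) := by
  let ζ : ContDiffBump (0 : ℝ) := ⟨1, 2, one_pos, one_lt_two⟩
  refine ⟨fun y => b y * ζ y, hb.mul ζ.contDiff, ζ.hasCompactSupport.mul_left, fun y hy => ?_⟩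
  have hone : ζ y = 1 := ζ.one_of_mem_closedBall <| by
    rw [mem_closedBall_zero_iff, Real.norm_of_nonneg hy.1.le]
    exact hy.2.le
  simp only [hone, mul_one]

theorem exists_test_eqOn_strip (hχ : ContDiff ℝ ∞ χ) (hs : HasCompactSupport χ)
    (hb : ContDiff ℝ ∞ b) :
    ∃ ψ : ℝ × ℝ → ℝ, ContDiff ℝ ∞ ψ ∧ HasCompactSupport ψ ∧
      EqOn ψ (fun p => χ p.1 * b p.2) strip := by
  obtain ⟨b₀, hb₀, hs₀, heq⟩ := exists_hasCompactSupport_eqOn_Ioo hb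
  refine ⟨fun p => χ p.1 * b₀ p.2, (hχ.comp contDiff_fst).mul (hb₀.comp contDiff_snd),
    HasCompactSupport.intro (hs.isCompact.prod hs₀.isCompact) fun p hp => ?_,
    fun p hp => congrArg (χ p.1 * ·) (heq hp.2)⟩
  rw [mem_prod, not_and_or] at hp
  rcases hp with hp | hp
  · rw [image_eq_zero_of_notMem_tsupport hp, zero_mul]
  · rw [image_eq_zero_of_notMem_tsupport hp, mul_zero]

theorem fderiv_of_eqOn_strip (hχ : Differentiable ℝ χ) (hb : Differentiable ℝ b)
    {ψ : ℝ × ℝ → ℝ} (hψ : EqOn ψ (fun p => χ p.1 * b p.2) strip) {p : ℝ × ℝ} (hp : p ∈ strip) :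
    fderiv ℝ ψ p e = e.1 * (deriv χ p.1 * b p.2) + e.2 * (χ p.1 * deriv b p.2) := by
  have hfst := (hχ p.1).hasDerivAt.comp_hasFDerivAt p (hasFDerivAt_fst (p := p) (𝕜 := ℝ))
  have hsnd := (hb p.2).hasDerivAt.comp_hasFDerivAt p (hasFDerivAt_snd (p := p) (𝕜 := ℝ))
  have hnhds : ψ =ᶠ[𝓝 p] fun p => χ p.1 * b p.2 :=
    hψ.eventuallyEq_of_mem (isOpen_strip.mem_nhds hp)
  rw [((hfst.mul hsnd).congr_of_eventuallyEq hnhds).fderiv]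
  simp only [add_apply, smul_apply, smul_eq_mul, ContinuousLinearMap.coe_fst',
    ContinuousLinearMap.coe_snd', Function.comp_apply]
  ring

theorem setIntegral_strip_congr {f g : ℝ × ℝ → ℂ} (h : EqOn f g strip) :
    ∫ p in strip, f p = ∫ p in strip, g p :=
  setIntegral_congr_fun isOpen_strip.measurableSet h

theorem HasWeakDeriv.integral_by_parts_mul (h : HasWeakDeriv e u v) (hχ : ContDiff ℝ ∞ χ)
    (hs : HasCompactSupport χ) (hb : ContDiff ℝ ∞ b) {C : ℝ}
    (hC : ∀ y ∈ Ioo (0 : ℝ) 1, |e.2 * b y| ≤ y * (1 - y) * C) :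
    ∫ p in strip,
        ((e.1 * (deriv χ p.1 * b p.2) + e.2 * (χ p.1 * deriv b p.2) : ℝ) : ℂ) * u p =
      -∫ p in strip, ((χ p.1 : ℂ) * (b p.2 : ℂ)) * v p := by
  obtain ⟨ψ, hψ, hψs, heq⟩ := exists_test_eqOn_strip hχ hs hb
  have hparts := h.integral_by_parts hψ hψs
    (localWeight_mul hχ.continuous hs (continuous_const (y := C)) fun _ => le_rfl) fun p hp => by
      rw [heq hp, mul_left_comm, abs_mul, norm_mul, Complex.norm_real, Complex.norm_real,
        mul_left_comm]
      refine mul_le_mul_of_nonneg_left ((hC p.2 hp.2).trans ?_) (abs_nonneg _)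
      exact mul_le_mul_of_nonneg_left (le_abs_self C)
        (mul_nonneg hp.2.1.le (sub_nonneg.2 hp.2.2.le))
  calc _ = ∫ p in strip, ((fderiv ℝ ψ p e : ℝ) : ℂ) * u p := setIntegral_strip_congr fun p hp => by
          simp only [fderiv_of_eqOn_strip (hχ.differentiable (by simp))
            (hb.differentiable (by simp)) heq hp]
    _ = -∫ p in strip, (ψ p : ℂ) * v p := hparts
    _ = _ := congrArg Neg.neg <| setIntegral_strip_congr fun p hp => by
          simp only [heq hp, Complex.ofReal_mul]

end ProductTests

section ModalEquation

variable {χ : ℝ → ℝ} {u uy v : ℝ × ℝ → ℂ}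

theorem abs_sinMode_le_mul (n : ℕ) {y : ℝ} (hy : y ∈ Ioo (0 : ℝ) 1) :
    |sinMode n y| ≤ y * (1 - y) * (2 * (n * Real.pi * Real.sqrt 2)) := by
  have hlip : ∀ a, |sinMode n y - sinMode n a| ≤ n * Real.pi * Real.sqrt 2 * |y - a| := by
    intro a
    refine convex_univ.norm_image_sub_le_of_norm_hasDerivWithin_le
      (fun x _ => (hasDerivAt_sinMode n x).hasDerivWithinAt) (fun x _ => ?_)
      (mem_univ a) (mem_univ y)
    rw [Real.norm_eq_abs, abs_mul, abs_of_nonneg (by positivity)]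
    exact mul_le_mul_of_nonneg_left (abs_mode_le n x) (by positivity)
  have hleft := hlip 0
  have hright := hlip 1
  rw [sinMode_zero, sub_zero, sub_zero, abs_of_pos hy.1] at hleft
  rw [sinMode_one, sub_zero, abs_sub_comm, abs_of_pos (sub_pos.2 hy.2)] at hright
  have hL : 0 ≤ n * Real.pi * Real.sqrt 2 := by positivity
  rcases le_total y (1 / 2) with h | h
  · nlinarith [mul_nonneg hL (mul_nonneg hy.1.le (by linarith : 0 ≤ 1 - 2 * y))]
  · nlinarith [mul_nonneg hL (mul_nonneg (sub_nonneg.2 hy.2.le) (by linarith : 0 ≤ 2 * y - 1))]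

theorem HasWeakDeriv.modalCoeff_fst (h : HasWeakDeriv (1, 0) u v) (n : ℕ) :
    HasWeakDeriv1 (modalCoeff u n) (modalCoeff v n) := by
  intro χ hχ hs
  have hparts := h.integral_by_parts_mul hχ hs (contDiff_mode n) (C := 0) fun y _ => by
    simp only [zero_mul, abs_zero, mul_zero, le_refl]
  simp only [one_mul, zero_mul, add_zero, Complex.ofReal_mul] at hparts
  rwa [integral_strip_mode_mul (hχ.continuous_deriv (by simp)) hs.deriv n h.1,
    integral_strip_mode_mul hχ.continuous hs n h.2.1] at hparts

theorem HasWeakDeriv.integral_sinMode_mul (h : HasWeakDeriv (0, 1) u uy)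
    (hχ : ContDiff ℝ ∞ χ) (hs : HasCompactSupport χ) (n : ℕ) :
    ∫ p in strip, ((χ p.1 : ℂ) * (sinMode n p.2 : ℂ)) * uy p =
      -(n * Real.pi) * ∫ x, (χ x : ℂ) * modalCoeff u n x := by
  have hparts := h.integral_by_parts_mul hχ hs (contDiff_sinMode n) fun y hy =>
    (congrArg abs (one_mul _)).trans_le (abs_sinMode_le_mul n hy)
  rw [eq_neg_iff_add_eq_zero, add_comm, ← eq_neg_iff_add_eq_zero] at hparts
  rw [hparts, neg_mul, ← integral_strip_mode_mul hχ.continuous hs n h.1, ← integral_const_mul]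
  congr 2 with p
  simp only [(hasDerivAt_sinMode n p.2).deriv]
  push_cast
  ring

/-- The modes do not vanish on `∂Ω`: this is where the Neumann condition enters. -/
theorem HasTraces.modalCoeff_ae_eq {uyy : ℝ × ℝ → ℂ} (htr : HasTraces uy 0 0)
    (h : HasWeakDeriv (0, 1) u uy) (h' : HasWeakDeriv (0, 1) uy uyy) (n : ℕ) :
    ∀ᵐ x : ℝ, modalCoeff uyy n x = -(n * Real.pi) ^ 2 * modalCoeff u n x := by
  obtain ⟨-, -, wy, hwy, hgreen⟩ := htr
  refine ae_eq_of_integral_test_mul (h'.2.1.locallyIntegrable_modalCoeff n)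
    ((h.1.locallyIntegrable_modalCoeff n).smul (-(n * Real.pi : ℂ) ^ 2)) fun χ hχ hs => ?_
  obtain ⟨ψ, hψ, hψs, heq⟩ := exists_test_eqOn_strip hχ hs (contDiff_mode n)
  have hderiv : ∫ p in strip, ((fderiv ℝ ψ p (0, 1) : ℝ) : ℂ) * uy p =
      -(n * Real.pi) * ∫ p in strip, ((χ p.1 : ℂ) * (sinMode n p.2 : ℂ)) * uy p := by
    rw [← integral_const_mul]
    refine setIntegral_strip_congr fun p hp => ?_
    simp only [fderiv_of_eqOn_strip (hχ.differentiable (by simp))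
      ((contDiff_mode n).differentiable (by simp)) heq hp, (hasDerivAt_mode n p.2).deriv]
    push_cast
    ring
  have hcoeff : ∫ p in strip, (ψ p : ℂ) * wy p = ∫ x, (χ x : ℂ) * modalCoeff uyy n x := by
    rw [← integral_strip_mode_mul hχ.continuous hs n h'.2.1]
    refine integral_congr_ae ?_
    filter_upwards [hwy.ae_eq h' (ae_of_all _ fun _ => rfl),
      ae_restrict_mem isOpen_strip.measurableSet] with p hp hps
    rw [hp, heq hps, Complex.ofReal_mul]
  have hzero := hgreen ψ hψ hψs
  simp only [Pi.zero_apply, mul_zero, integral_zero, sub_zero] at hzero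
  rw [hderiv, hcoeff, h.integral_sinMode_mul hχ hs n] at hzero
  simp_rw [mul_left_comm _ (-(n * Real.pi : ℂ) ^ 2)]
  rw [integral_const_mul]
  linear_combination hzero

theorem modalCoeff_congr (h : ∀ᵐ p ∂(volume.restrict strip), u p = v p) (n : ℕ) :
    ∀ᵐ x : ℝ, modalCoeff u n x = modalCoeff v n x := by
  rw [restrict_strip] at h
  filter_upwards [Measure.ae_ae_of_ae_prod h] with x hx
  refine integral_congr_ae ?_
  filter_upwards [hx] with y hy
  rw [hy]

theorem modalCoeff_const_mul (c : ℂ) (f : ℝ × ℝ → ℂ) (n : ℕ) (x : ℝ) :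
    modalCoeff (fun p => c * f p) n x = c * modalCoeff f n x := by
  simp only [modalCoeff, mul_left_comm _ c, integral_const_mul]

theorem HasWeakDeriv1.congr {c c' d d' : ℝ → ℂ} (h : HasWeakDeriv1 c d)
    (hc : ∀ᵐ x : ℝ, c x = c' x) (hd : ∀ᵐ x : ℝ, d x = d' x) : HasWeakDeriv1 c' d' := by
  intro χ hχ hs
  have hleft : ∫ x, ((deriv χ x : ℝ) : ℂ) * c x = ∫ x, ((deriv χ x : ℝ) : ℂ) * c' x :=
    integral_congr_ae (hc.mono fun x hx => congrArg _ hx)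
  have hright : ∫ x, (χ x : ℂ) * d x = ∫ x, (χ x : ℂ) * d' x :=
    integral_congr_ae (hd.mono fun x hx => congrArg _ hx)
  rw [← hleft, ← hright, h χ hχ hs]

theorem SolvesHelmholtz.modal_equation {k : ℝ} {s : ℝ × ℝ → ℂ} (hu : SolvesHelmholtz k s u)
    (hN : NeumannZero u) (hs : MemL2Loc s) (n : ℕ) :
    ∃ d : ℝ → ℂ, LocallyIntegrable d ∧ HasWeakDeriv1 (modalCoeff u n) d ∧
      HasWeakDeriv1 d fun x => -waveNumber k n ^ 2 * modalCoeff u n x - modalCoeff s n x := by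
  obtain ⟨ux, uy, uxx, uyy, hx, hy, hxx, hyy, heq⟩ := hu
  obtain ⟨wy, hwy, htr⟩ := hN
  have hwyy : HasWeakDeriv (0, 1) wy uyy := ⟨hwy.2.1, hyy.2.1, fun ψ hψ hc hsupp => by
    rw [← hyy.2.2 ψ hψ hc hsupp]
    refine integral_congr_ae ?_
    filter_upwards [hwy.ae_eq hy (ae_of_all _ fun _ => rfl)] with p hp
    rw [hp]⟩
  have huxx : ∀ᵐ p ∂(volume.restrict strip), uxx p = -(k : ℂ) ^ 2 * u p - s p - uyy p := by
    filter_upwards [heq] with p hp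
    linear_combination hp
  have hku : MemL2Loc fun p => -(k : ℂ) ^ 2 * u p := hx.1.const_mul _
  refine ⟨modalCoeff ux n, hx.2.1.locallyIntegrable_modalCoeff n, hx.modalCoeff_fst n,
    (hxx.modalCoeff_fst n).congr (ae_of_all _ fun _ => rfl) ?_⟩
  filter_upwards [modalCoeff_congr huxx n, (hku.sub hs).modalCoeff_sub hyy.2.1 n,
    hku.modalCoeff_sub hs n, htr.modalCoeff_ae_eq hwy hwyy n] with x h₁ h₂ h₃ h₄
  rw [h₁, h₂, h₃, h₄, modalCoeff_const_mul, waveNumber_sq]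
  ring

end ModalEquation

section DuBoisReymond

theorem hasDerivAt_setIntegral_Iic {η : ℝ → ℝ} (hη : Continuous η) (hi : Integrable η) (x : ℝ) :
    HasDerivAt (fun x => ∫ t in Iic x, η t) (η x) x := by
  have hsplit : (fun x => ∫ t in Iic x, η t) =
      fun x => (∫ t in (0 : ℝ)..x, η t) + ∫ t in Iic 0, η t := by
    ext y
    rw [← intervalIntegral.integral_Iic_sub_Iic hi.integrableOn hi.integrableOn, sub_add_cancel]
  rw [hsplit]
  exact (hη.integral_hasStrictDerivAt 0 x).hasDerivAt.add_const _

theorem hasCompactSupport_setIntegral_Iic {η : ℝ → ℝ} (hs : HasCompactSupport η)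
    (h0 : ∫ x, η x = 0) : HasCompactSupport fun x => ∫ t in Iic x, η t := by
  obtain ⟨R, hR⟩ := hs.isCompact.isBounded.subset_closedBall 0
  have hzero : ∀ x, R < |x| → η x = 0 := fun x hx => image_eq_zero_of_notMem_tsupport fun h => by
    have := mem_closedBall_zero_iff.1 (hR h)
    exact absurd hx (not_lt.2 this)
  refine HasCompactSupport.intro (isCompact_Icc (a := -R) (b := R)) fun x hx => ?_
  rw [mem_Icc, not_and_or, not_le, not_le] at hx
  rcases hx with hx | hx
  · exact setIntegral_eq_zero_of_forall_eq_zero fun t (ht : t ≤ x) =>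
      hzero t ((by linarith : R < -t).trans_le (neg_le_abs t))
  · rw [← h0]
    exact setIntegral_eq_integral_of_forall_compl_eq_zero fun t ht =>
      hzero t ((hx.trans (not_le.1 ht)).trans_le (le_abs_self t))

theorem exists_test_deriv_eq {η : ℝ → ℝ} (hη : ContDiff ℝ ∞ η) (hs : HasCompactSupport η)
    (h0 : ∫ x, η x = 0) :
    ∃ χ : ℝ → ℝ, ContDiff ℝ ∞ χ ∧ HasCompactSupport χ ∧ deriv χ = η := by
  have hd := hasDerivAt_setIntegral_Iic hη.continuous
    (hη.continuous.integrable_of_hasCompactSupport hs)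
  have hderiv : deriv (fun x => ∫ t in Iic x, η t) = η := funext fun x => (hd x).deriv
  exact ⟨_, contDiff_infty_iff_deriv.2 ⟨fun x => (hd x).differentiableAt, hderiv.symm ▸ hη⟩,
    hasCompactSupport_setIntegral_Iic hs h0, hderiv⟩

/-- A test function `ψ` minus `(∫ ψ) ζ`, where `ζ` is a normalized bump, has a test function as
primitive, so `∫ ψ G = (∫ ψ) (∫ ζ G)`. -/
theorem HasWeakDeriv1.exists_ae_eq_const {G : ℝ → ℂ} (hG : LocallyIntegrable G)
    (h : HasWeakDeriv1 G 0) : ∃ C : ℂ, ∀ᵐ x, G x = C := by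
  let ζ : ContDiffBump (0 : ℝ) := ⟨1, 2, by norm_num, by norm_num⟩
  have hζ : ContDiff ℝ ∞ (ζ.normed volume) := ζ.contDiff_normed
  have hζs : HasCompactSupport (ζ.normed volume) := ζ.hasCompactSupport_normed
  have hζint : Integrable (ζ.normed volume) := hζ.continuous.integrable_of_hasCompactSupport hζs
  refine ⟨∫ x, ((ζ.normed volume x : ℝ) : ℂ) * G x,
    ae_eq_of_integral_test_mul hG (locallyIntegrable_const _) fun ψ hψ hψs => ?_⟩
  have hψint : Integrable ψ := hψ.continuous.integrable_of_hasCompactSupport hψs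
  set a := ∫ x, ψ x
  obtain ⟨χ, hχ, hχs, hχd⟩ := exists_test_deriv_eq (η := fun x => ψ x - a * ζ.normed volume x)
    (hψ.sub (contDiff_const.mul hζ)) (hψs.sub hζs.mul_left) (by
      rw [integral_sub hψint (hζint.const_mul a), integral_const_mul, ζ.integral_normed, mul_one,
        sub_self])
  have hsplit : ∀ x, ((ψ x - a * ζ.normed volume x : ℝ) : ℂ) * G x =
      (ψ x : ℂ) * G x - (a : ℂ) * (((ζ.normed volume x : ℝ) : ℂ) * G x) := fun x => by
    push_cast
    ring
  have hzero := h χ hχ hχs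
  simp_rw [hχd, hsplit, Pi.zero_apply, mul_zero, integral_zero, neg_zero] at hzero
  rw [integral_sub (integrable_ofReal_mul_of_locallyIntegrable hψ.continuous hψs hG)
    ((integrable_ofReal_mul_of_locallyIntegrable hζ.continuous hζs hG).const_mul _),
    integral_const_mul, sub_eq_zero] at hzero
  rw [hzero, integral_mul_const, integral_complex_ofReal]

theorem HasWeakDeriv1.sub {c c' d d' : ℝ → ℂ} (h : HasWeakDeriv1 c d) (h' : HasWeakDeriv1 c' d')
    (hc : LocallyIntegrable c) (hc' : LocallyIntegrable c') (hd : LocallyIntegrable d)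
    (hd' : LocallyIntegrable d') :
    HasWeakDeriv1 (fun x => c x - c' x) (fun x => d x - d' x) := by
  intro χ hχ hs
  have hχd : Continuous (deriv χ) := hχ.continuous_deriv (by simp)
  simp_rw [mul_sub]
  rw [integral_sub (integrable_ofReal_mul_of_locallyIntegrable hχd hs.deriv hc)
      (integrable_ofReal_mul_of_locallyIntegrable hχd hs.deriv hc'),
    integral_sub (integrable_ofReal_mul_of_locallyIntegrable hχ.continuous hs hd)
      (integrable_ofReal_mul_of_locallyIntegrable hχ.continuous hs hd'), h χ hχ hs, h' χ hχ hs]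
  ring

theorem HasWeakDeriv1.ae_unique {c d d' : ℝ → ℂ} (h : HasWeakDeriv1 c d) (h' : HasWeakDeriv1 c d')
    (hd : LocallyIntegrable d) (hd' : LocallyIntegrable d') : ∀ᵐ x, d x = d' x :=
  ae_eq_of_integral_test_mul hd hd' fun χ hχ hs =>
    neg_injective ((h χ hχ hs).symm.trans (h' χ hχ hs))

theorem HasWeakDeriv1.hasDerivAt {c d : ℝ → ℂ} (h : HasWeakDeriv1 c d) (hc : Continuous c)
    (hd : Continuous d) (x : ℝ) : HasDerivAt c (d x) x := by
  set D : ℝ → ℂ := fun x => ∫ t in (0 : ℝ)..x, d t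
  have hD : ∀ x, HasDerivAt D (d x) x := fun x => (hd.integral_hasStrictDerivAt 0 x).hasDerivAt
  have hDcont : Continuous D := continuous_iff_continuousAt.2 fun x => (hD x).continuousAt
  have hweak : HasWeakDeriv1 (fun x => c x - D x) 0 :=
    (h.sub (hasWeakDeriv1_of_hasDerivAt hD hd) hc.locallyIntegrable hDcont.locallyIntegrable
      hd.locallyIntegrable hd.locallyIntegrable).congr (ae_of_all _ fun _ => rfl)
      (ae_of_all _ fun _ => sub_self _)
  obtain ⟨C, hC⟩ := hweak.exists_ae_eq_const (hc.sub hDcont).locallyIntegrable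
  have hconst : (fun x => c x - D x) = fun _ => C :=
    ((hc.sub hDcont).ae_eq_iff_eq volume continuous_const).1 hC
  have hcD : c = fun x => C + D x := funext fun x => sub_eq_iff_eq_add.1 (congrFun hconst x)
  rw [hcD]
  exact (hD x).const_add C

end DuBoisReymond

section Uniqueness

variable {κ : ℂ}

theorem eq_mul_exp_of_hasDerivAt {p : ℝ → ℂ} {a : ℂ} (hp : ∀ x, HasDerivAt p (a * p x) x)
    (x : ℝ) : p x = p 0 * Complex.exp (a * x) := by
  have hderiv : ∀ x : ℝ, HasDerivAt (fun x : ℝ => p x * Complex.exp (-a * x)) 0 x := fun x => by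
    have hlin : HasDerivAt (fun x : ℝ => -a * (x : ℂ)) (-a) x := by
      simpa using (hasDerivAt_id x).ofReal_comp.const_mul (-a)
    exact ((hp x).mul hlin.cexp).congr_deriv (by ring)
  have hconst := is_const_of_deriv_eq_zero (fun x => (hderiv x).differentiableAt)
    (fun x => (hderiv x).deriv) x 0
  simp only [Complex.ofReal_zero, mul_zero, Complex.exp_zero, mul_one] at hconst
  rw [← hconst, mul_assoc, ← Complex.exp_add, neg_mul, neg_add_cancel, Complex.exp_zero, mul_one]

theorem eq_zero_of_hasDerivAt_of_tendsto_atTop {p : ℝ → ℂ} {a : ℂ} (ha : 0 ≤ a.re)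
    (hp : ∀ x, HasDerivAt p (a * p x) x) (hlim : Tendsto p atTop (𝓝 0)) (x : ℝ) : p x = 0 := by
  have hexp := eq_mul_exp_of_hasDerivAt hp
  have hp0 : p 0 = 0 := by
    rw [← norm_le_zero_iff]
    refine ge_of_tendsto (tendsto_zero_iff_norm_tendsto_zero.1 hlim) ?_
    filter_upwards [eventually_ge_atTop 0] with x hx
    rw [hexp x, norm_mul, Complex.norm_exp, Complex.re_mul_ofReal]
    exact le_mul_of_one_le_right (norm_nonneg _) (Real.one_le_exp (mul_nonneg ha hx))
  rw [hexp x, hp0, zero_mul]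

theorem eq_zero_of_hasDerivAt_of_tendsto_atBot {p : ℝ → ℂ} {a : ℂ} (ha : a.re ≤ 0)
    (hp : ∀ x, HasDerivAt p (a * p x) x) (hlim : Tendsto p atBot (𝓝 0)) (x : ℝ) : p x = 0 := by
  have hreflect := eq_zero_of_hasDerivAt_of_tendsto_atTop (p := fun x => p (-x)) (a := -a)
    (by rwa [Complex.neg_re, neg_nonneg])
    (fun x => ((hp (-x)).scomp x (hasDerivAt_neg x)).congr_deriv (by simp))
    (hlim.comp tendsto_neg_atTop_atBot) (-x)
  rwa [neg_neg] at hreflect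

/-- The combinations `h' - iκh` and `-h' - iκh` solve first order equations whose solutions cannot
decay at `+∞`, respectively `-∞`. -/
theorem eq_zero_of_outgoing {h h' : ℝ → ℂ} (hκ0 : κ ≠ 0) (hκ : 0 ≤ κ.im)
    (hd : ∀ x, HasDerivAt h (h' x) x) (hd' : ∀ x, HasDerivAt h' (-κ ^ 2 * h x) x)
    (hrad : Tendsto (fun x : ℝ => ‖h' x * ((x / |x| : ℝ) : ℂ) - Complex.I * κ * h x‖)
      (comap (fun x : ℝ => |x|) atTop) (𝓝 0)) (x : ℝ) : h x = 0 := by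
  obtain ⟨hright, hleft⟩ := tendsto_radiation_iff.1 hrad
  have hplus : h' x - Complex.I * κ * h x = 0 :=
    eq_zero_of_hasDerivAt_of_tendsto_atTop (p := fun x => h' x - Complex.I * κ * h x)
      (a := -(Complex.I * κ)) (by simpa using hκ)
      (fun x => ((hd' x).sub ((hd x).const_mul _)).congr_deriv (by
        linear_combination -κ ^ 2 * h x * Complex.I_sq)) hright x
  have hminus : -h' x - Complex.I * κ * h x = 0 :=
    eq_zero_of_hasDerivAt_of_tendsto_atBot (p := fun x => -h' x - Complex.I * κ * h x)
      (a := Complex.I * κ) (by simpa using hκ)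
      (fun x => ((hd' x).neg.sub ((hd x).const_mul _)).congr_deriv (by
        linear_combination κ ^ 2 * h x * Complex.I_sq)) hleft x
  have hsum : Complex.I * κ * h x = 0 := by linear_combination -(hplus + hminus) / 2
  exact (mul_eq_zero.1 hsum).resolve_left (mul_ne_zero Complex.I_ne_zero hκ0)

theorem eq_outgoingSol {c g : ℝ → ℂ} (hκ0 : κ ≠ 0) (hκ : 0 ≤ κ.im) (hg : Integrable g)
    (hc : ContDiff ℝ 1 c) (hweak : HasWeakDeriv1 (deriv c) fun x => -κ ^ 2 * c x - g x)
    (hrad : Tendsto (fun x : ℝ => ‖deriv c x * ((x / |x| : ℝ) : ℂ) - Complex.I * κ * c x‖)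
      (comap (fun x : ℝ => |x|) atTop) (𝓝 0)) (x : ℝ) : c x = outgoingSol κ g x := by
  have hU : Continuous (outgoingSol κ g) := continuous_outgoingSol hκ0 hκ hg
  have hU' : Continuous (outgoingSolDeriv κ g) := continuous_outgoingSolDeriv hκ hg
  have hc' : Continuous (deriv c) := hc.continuous_deriv le_rfl
  have hrhs : ∀ {f : ℝ → ℂ}, Continuous f → LocallyIntegrable fun x => -κ ^ 2 * f x - g x :=
    fun hf => (continuous_const.mul hf).locallyIntegrable.sub hg.locallyIntegrable
  have hdiff : HasWeakDeriv1 (fun x => deriv c x - outgoingSolDeriv κ g x)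
      fun x => -κ ^ 2 * (c x - outgoingSol κ g x) :=
    (hweak.sub (hasWeakDeriv1_outgoingSolDeriv hκ0 hκ hg) hc'.locallyIntegrable
      hU'.locallyIntegrable (hrhs hc.continuous) (hrhs hU)).congr (ae_of_all _ fun _ => rfl)
      (ae_of_all _ fun x => by ring)
  refine sub_eq_zero.1 (eq_zero_of_outgoing (h := fun x => c x - outgoingSol κ g x) hκ0 hκ
    (fun x => (hc.differentiable one_ne_zero x).hasDerivAt.sub (hasDerivAt_outgoingSol hκ0 hκ hg x))
    (hdiff.hasDerivAt (hc'.sub hU') (continuous_const.mul (hc.continuous.sub hU)))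
    (tendsto_radiation_iff.2 ⟨?_, ?_⟩) x)
  · refine sub_zero (0 : ℂ) ▸ ((tendsto_radiation_iff.1 hrad).1.sub
      (tendsto_radiation_iff.1 (tendsto_radiation_outgoingSol hκ0 hκ hg)).1).congr fun x => ?_
    ring
  · refine sub_zero (0 : ℂ) ▸ ((tendsto_radiation_iff.1 hrad).2.sub
      (tendsto_radiation_iff.1 (tendsto_radiation_outgoingSol hκ0 hκ hg)).2).congr fun x => ?_
    ring

variable {k : ℝ} {s v : ℝ × ℝ → ℂ}

theorem IsSolution.modalCoeff_ae_eq (hv : IsSolution k s v) (hκ : ∀ n, waveNumber k n ≠ 0)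
    (hs1 : IntegrableOn s strip) (hs2 : MemL2Loc s) (n : ℕ) :
    ∀ᵐ x : ℝ, modalCoeff v n x = modalSolution k s n x := by
  obtain ⟨c, hc, hvc, hrad⟩ := hv.outgoing n
  obtain ⟨d, hd, hvd, hdd⟩ := hv.helmholtz.modal_equation hv.neumann hs2 n
  have hc' : Continuous (deriv c) := hc.continuous_deriv le_rfl
  have hderiv : ∀ᵐ x, d x = deriv c x :=
    (hvd.congr hvc (ae_of_all _ fun _ => rfl)).ae_unique
      (hasWeakDeriv1_of_hasDerivAt (fun x => (hc.differentiable one_ne_zero x).hasDerivAt) hc')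
      hd hc'.locallyIntegrable
  have hweak : HasWeakDeriv1 (deriv c) fun x => -waveNumber k n ^ 2 * c x - modalCoeff s n x :=
    hdd.congr hderiv (hvc.mono fun x hx => by rw [hx])
  filter_upwards [hvc] with x hx
  rw [hx, modalSolution_eq_outgoingSol]
  exact eq_outgoingSol (hκ n) (waveNumber_im_nonneg k n) (integrable_modalCoeff hs1 n) hc hweak
    hrad x

theorem IsSolution.memL2Loc (hv : IsSolution k s v) : MemL2Loc v :=
  let ⟨_, _, hx, _⟩ := hv.memH2Loc
  hx.1

theorem IsSolution.ae_eq {u : ℝ × ℝ → ℂ} (hv : IsSolution k s v) (hu : IsSolution k s u)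
    (hκ : ∀ n, waveNumber k n ≠ 0) (hs1 : IntegrableOn s strip) (hs2 : MemL2Loc s) :
    ∀ᵐ p ∂(volume.restrict strip), v p = u p :=
  hv.memL2Loc.ae_eq_of_modalCoeff hu.memL2Loc fun n => by
    filter_upwards [hv.modalCoeff_ae_eq hκ hs1 hs2 n, hu.modalCoeff_ae_eq hκ hs1 hs2 n]
      with x hvx hux
    rw [hvx, hux]

end Uniqueness

end Waveguide

theorem mainTheorem8 (k : ℝ) (hk : 0 < k) (hkn : ∀ n : ℕ, k ≠ n * Real.pi)
    (s : ℝ × ℝ → ℂ) (hs1 : IntegrableOn s Waveguide.strip volume)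
    (hs2 : Waveguide.MemL2Loc s) :
    ∃ u : ℝ × ℝ → ℂ,
      Waveguide.IsSolution k s u ∧
      (∀ v : ℝ × ℝ → ℂ, Waveguide.IsSolution k s v →
        ∀ᵐ p ∂(volume.restrict Waveguide.strip), v p = u p) ∧
      (∀ (n : ℕ) (x : ℝ), Integrable (fun z : ℝ => Waveguide.modalCoeff s n z *
        Complex.exp (Complex.I * Waveguide.waveNumber k n * (|x - z| : ℝ)))) ∧
      (∀ n : ℕ, ∀ᵐ x : ℝ, Waveguide.modalCoeff u n x = Waveguide.modalSolution k s n x) ∧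
      (∀ᵐ p ∂(volume.restrict Waveguide.strip),
        HasSum (fun n : ℕ => Waveguide.modalSolution k s n p.1 * (Waveguide.mode n p.2 : ℂ))
          (u p)) ∧
      (∀ r : ℝ, 0 < r →
        Tendsto (fun N : ℕ => eLpNorm (fun p : ℝ × ℝ => u p - ∑ n ∈ Finset.range N,
            Waveguide.modalSolution k s n p.1 * (Waveguide.mode n p.2 : ℂ)) 2
            (volume.restrict (Waveguide.truncStrip r))) atTop (𝓝 0)) := by
  have hκ : ∀ n, Waveguide.waveNumber k n ≠ 0 := fun n => Waveguide.waveNumber_ne_zero hk (hkn n)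
  obtain ⟨u, ux, uy, uxy, uyy, hsum⟩ := Waveguide.exists_isModalSum hκ hs1 hs2
  have hu : Waveguide.IsSolution k s u := hsum.isSolution hκ hs1 hs2
  refine ⟨u, hu, fun v hv => hv.ae_eq hu hκ hs1 hs2, fun n x =>
    Waveguide.integrable_mul_waveKernel (Waveguide.waveNumber_im_nonneg k n)
      (Waveguide.integrable_modalCoeff hs1 n) x,
    hu.modalCoeff_ae_eq hκ hs1 hs2, Waveguide.ae_hasSum_modalSolution hκ hs1 hs2 hsum.tendsto,
    fun r hr => (hsum.tendsto.tendsto r hr).congr fun N => ?_⟩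
  exact eLpNorm_sub_comm _ _ _ _
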